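/- \textbf{Model.} Let $\mathcal C=\{C_1,\dots,C_k\}$ be a partition of $[n]$ into nonempty clusters, and let $D_1,D_2,D_3$ be probability distributions on $\mathbb R$ with means $p$, $q$ and $0$ respectively, where $q<p$, each with variance at most $\sigma^2$ and each supported within distance $\kappa$ of its mean. $\mathcal{PP}(n,\mathcal C,D_1,D_2,D_3)$ is the law of the random real symmetric $n\times n$ matrix $\hat A=(\hat a_{uv})$ whose entries $\hat a_{uv}$, $u\le v$, are independent with law $D_1$ if $u\ne v$ are in the same cluster, $D_2$ if $u\neq v$ are in different clusters, and $D_3$ if $u=v$. \textbf{Supercluster assumptions} with separation $\Delta>0$ and tolerance $\varepsilon$: every cluster has size at least $\Delta$, and $\mathcal C$ is partitioned into nonempty superclusters $\mathcal C_1,\dots,\mathcal C_K$ such that $$\min_{C\in\mathcal C_i}|C|\ \ge\ \max_{C\in\mathcal C_{i+1}}|C|+\Delta\quad(1\le i<K),\qquad \max_{C\in\mathcal C_i}|C|\ \le\ (1+\varepsilon)\min_{C\in\mathcal C_i}|C|\quad(1\le i\le K).$$ \textbf{Theorem.} There are an absolute constant $c>0$ and a single deterministic algorithm (a program for the real RAM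 with unit-cost operations $+,-,\times,/$ and comparisons on real numbers), with running time bounded by a polynomial in $n$ on every input, such that the following holds. The input of the algorithm is a real $n\times n$ matrix together with the values $p,q$ and the numbers $k_i=|\mathcal C_i|\ge 1$ of clusters in the superclusters ($\sum_i k_i\le n$); its output is a partition of $[n]$. For each $n$ let $\mathcal C$, $D_1,D_2,D_3$, $\mathcal C_1,\dots,\mathcal C_K$ and the parameters $p,q,\sigma,\kappa,\Delta,\varepsilon$ (all may depend on $n$) be as above, and put $\mu:=\max\{|p|,|q|\}$. Suppose that, for all sufficiently large $n$, $$\varepsilon<\frac{p-q}{34\mu+32\kappa+2},\qquad \Delta\ \ge\ c\,\frac{\kappa(\mu+\kappa)\sqrt n}{(p-q)^2},$$ and that, as $n\to\infty$, $$\Delta=\omega\!\left(\frac{(\mu+\kappa)^2\kappa^2\log n}{(p-q)^2}\right),\qquad\text{i.e.}\qquad \frac{(\mu+\kappa)^2\kappa^2\log n}{(p-q)^2}=o(\Delta).$$ Then the probability that the algorithm, run on $\hat A\sim\mathcal{PP}(n,\mathcal C,D_1,D_2,D_3)$ with $p,q,k_1,\dots,k_K$, outputs exactly the partition $\mathcal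 C$ tends to $1$ as $n\to\infty$. -/

import Mathlib

open MeasureTheory ProbabilityTheory Filter Topology Asymptotics

/-! ## A real random access machine with a step count

Programs over two memories, one holding natural numbers (used for indices, counters and labels) and
one holding real numbers. Every arithmetic operation, memory access, comparison and assignment
costs one step. On the reals the operations are `+, -, *, /` and comparison, with rational
constants; there is no rounding and no conversion from reals to naturals. On the naturals there are
only `+` and truncated `-`. Programs consist of assignments, branching and counting loops, so they
are particular programs of the usual real RAM, run with their usual number of steps. -/

/-- The memory: integer arrays `ints a i` and real two-dimensional arrays `reals a i j`,
where `a` is the name of the array. -/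
structure RamState where
  ints : ℕ → ℕ → ℕ
  reals : ℕ → ℕ → ℕ → ℝ

/-- Natural number expressions. -/
inductive IntExp where
  | const (c : ℕ)
  | get (a : ℕ) (i : IntExp)
  | add (e f : IntExp)
  | sub (e f : IntExp)

/-- Real expressions. -/
inductive RealExp where
  | const (c : ℚ)
  | get (a : ℕ) (i j : IntExp)
  | add (e f : RealExp)
  | sub (e f : RealExp)
  | mul (e f : RealExp)
  | div (e f : RealExp)

/-- Tests: `e ≤ f` for natural numbers or for real numbers. -/
inductive RamTest where
  | intLe (e f : IntExp)
  | realLe (e f : RealExp)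

/-- Programs. `loop x b c` evaluates `b` once, to a number `m` say, and then runs `c` successively
with `ints x 0` set to `0, 1, …, m - 1`. -/
inductive RamProgram where
  | skip
  | setInt (a : ℕ) (i e : IntExp)
  | setReal (a : ℕ) (i j : IntExp) (e : RealExp)
  | seq (c d : RamProgram)
  | cond (t : RamTest) (c d : RamProgram)
  | loop (x : ℕ) (b : IntExp) (c : RamProgram)

namespace RamState

/-- Overwrite one integer cell. -/
def setInt (s : RamState) (a i v : ℕ) : RamState where
  ints := Function.update s.ints a (Function.update (s.ints a) i v)
  reals := s.reals

/-- Overwrite one real cell. -/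
noncomputable def setReal (s : RamState) (a i j : ℕ) (v : ℝ) : RamState where
  ints := s.ints
  reals := Function.update s.reals a
    (Function.update (s.reals a) i (Function.update (s.reals a i) j v))

end RamState

namespace IntExp

def eval (s : RamState) : IntExp → ℕ
  | const c => c
  | get a i => s.ints a (i.eval s)
  | add e f => e.eval s + f.eval s
  | sub e f => e.eval s - f.eval s

/-- The number of steps of an evaluation. -/
def cost : IntExp → ℕ
  | const _ => 1
  | get _ i => i.cost + 1
  | add e f => e.cost + f.cost + 1
  | sub e f => e.cost + f.cost + 1

end IntExp

namespace RealExp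

noncomputable def eval (s : RamState) : RealExp → ℝ
  | const c => (c : ℝ)
  | get a i j => s.reals a (i.eval s) (j.eval s)
  | add e f => e.eval s + f.eval s
  | sub e f => e.eval s - f.eval s
  | mul e f => e.eval s * f.eval s
  | div e f => e.eval s / f.eval s

/-- The number of steps of an evaluation. -/
def cost : RealExp → ℕ
  | const _ => 1
  | get _ i j => i.cost + j.cost + 1
  | add e f => e.cost + f.cost + 1
  | sub e f => e.cost + f.cost + 1
  | mul e f => e.cost + f.cost + 1
  | div e f => e.cost + f.cost + 1

end RealExp

namespace RamTest

def Holds (s : RamState) : RamTest → Prop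
  | intLe e f => e.eval s ≤ f.eval s
  | realLe e f => e.eval s ≤ f.eval s

def cost : RamTest → ℕ
  | intLe e f => e.cost + f.cost + 1
  | realLe e f => e.cost + f.cost + 1

end RamTest

namespace RamProgram

/-- The state after `m` rounds of a counting loop with counter `x` and body `f`. -/
def rounds (f : RamState → RamState) (x : ℕ) (s : RamState) : ℕ → RamState
  | 0 => s
  | m + 1 => f ((rounds f x s m).setInt x 0 m)

open Classical in
/-- The state in which a program halts when it is started in `s`. -/
noncomputable def exec : RamProgram → RamState → RamState
  | skip, s => s
  | setInt a i e, s => s.setInt a (i.eval s) (e.eval s)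
  | setReal a i j e, s => s.setReal a (i.eval s) (j.eval s) (e.eval s)
  | seq c d, s => d.exec (c.exec s)
  | cond t c d, s => if t.Holds s then c.exec s else d.exec s
  | loop x b c, s => rounds c.exec x s (b.eval s)

open Classical in
/-- The number of steps that a program takes when it is started in `s`. -/
noncomputable def time : RamProgram → RamState → ℕ
  | skip, _ => 1
  | setInt _ i e, _ => i.cost + e.cost + 1
  | setReal _ i j e, _ => i.cost + j.cost + e.cost + 1
  | seq c d, s => c.time s + d.time (c.exec s)
  | cond t c d, s => t.cost + (if t.Holds s then c.time s else d.time s)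
  | loop x b c, s => b.cost + 1 +
      ∑ m ∈ Finset.range (b.eval s), (c.time ((rounds c.exec x s m).setInt x 0 m) + 1)

/-- The initial memory. Integer array `0` holds `n`, integer array `1` holds the number `K` of
superclusters and integer array `2` the numbers `k₀, …, k_{K-1}` of clusters in each of them;
real array `0` holds the `n × n` matrix `M`, and real array `1` holds `p` and `q`.
All other cells are `0`. -/
noncomputable def input {n : ℕ} (M : Matrix (Fin n) (Fin n) ℝ) (p q : ℝ) {K : ℕ} (k : Fin K → ℕ) :
    RamState where
  ints a i :=
    if a = 0 ∧ i = 0 then n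
    else if a = 1 ∧ i = 0 then K
    else if h : a = 2 ∧ i < K then k ⟨i, h.2⟩
    else 0
  reals a i j :=
    if h : a = 0 ∧ i < n ∧ j < n then M ⟨i, h.2.1⟩ ⟨j, h.2.2⟩
    else if a = 1 ∧ i = 0 ∧ j = 0 then p
    else if a = 1 ∧ i = 0 ∧ j = 1 then q
    else 0

/-- The labelling of the indices `0, …, n - 1` computed by a program: the final content of integer
array `3`. -/
noncomputable def label (prog : RamProgram) {n : ℕ} (M : Matrix (Fin n) (Fin n) ℝ) (p q : ℝ)
    {K : ℕ} (k : Fin K → ℕ) (u : Fin n) : ℕ :=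
  (prog.exec (input M p q k)).ints 3 u

end RamProgram

/-! ## The planted partition model for random symmetric matrices -/

/-- `u` and `v` lie in the same cluster of the partition `P`. -/
def SameCluster {n : ℕ} (P : Finpartition (Finset.univ : Finset (Fin n))) (u v : Fin n) : Prop :=
  ∃ C ∈ P.parts, u ∈ C ∧ v ∈ C

/-- The law of the entry at an unordered pair of indices `s(u, v)`. -/
noncomputable def entryLaw {n : ℕ} (P : Finpartition (Finset.univ : Finset (Fin n)))
    (D₁ D₂ D₃ : Measure ℝ) (e : Sym2 (Fin n)) : Measure ℝ :=
  open Classical in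
  if e.IsDiag then D₃ else if ∃ C ∈ P.parts, ∀ u ∈ e, u ∈ C then D₁ else D₂

/-- Matrices carry the product (Borel) sigma-algebra of their entries. -/
instance instMeasurableSpaceRealMatrix {m n : Type*} : MeasurableSpace (Matrix m n ℝ) :=
  inferInstanceAs (MeasurableSpace (m → n → ℝ))

/-- The symmetric matrix with the given entries on unordered pairs of indices. -/
def symmMatrix {n : ℕ} (x : Sym2 (Fin n) → ℝ) : Matrix (Fin n) (Fin n) ℝ :=
  Matrix.of fun u v => x s(u, v)

theorem measurable_symmMatrix {n : ℕ} : Measurable (symmMatrix (n := n)) :=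
  measurable_pi_lambda _ fun u => measurable_pi_lambda _ fun v => measurable_pi_apply s(u, v)

/-- The planted partition model: the law of a random symmetric matrix whose entries on and above
the diagonal are independent, distributed as `D₁` off the diagonal within a cluster, as `D₂`
between different clusters, and as `D₃` on the diagonal. -/
noncomputable def plantedMatrix {n : ℕ} (P : Finpartition (Finset.univ : Finset (Fin n)))
    (D₁ D₂ D₃ : Measure ℝ) : Measure (Matrix (Fin n) (Fin n) ℝ) :=
  (Measure.pi (entryLaw P D₁ D₂ D₃)).map symmMatrix

/-- `D` has mean `m`, variance at most `σ ^ 2`, and lives within distance `κ` of its mean. -/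
structure IsEntryDistribution (D : Measure ℝ) (m σ κ : ℝ) : Prop where
  isProbabilityMeasure : IsProbabilityMeasure D
  integrable : Integrable (fun x => x) D
  mean : ∫ x, x ∂D = m
  variance_le : Var[fun x => x; D] ≤ σ ^ 2
  bounded : ∀ᵐ x ∂D, |x - m| ≤ κ

/-- The supercluster assumptions with separation `Δ` and tolerance `ε`: the set of clusters is
partitioned into the superclusters `S 0, S 1, …, S (K - 1)`, in decreasing order of the cluster
sizes. -/
structure IsSuperclustering {n : ℕ} (P : Finpartition (Finset.univ : Finset (Fin n))) {K : ℕ}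
    (S : Fin K → Finset (Finset (Fin n))) (Δ ε : ℝ) : Prop where
  nonempty : ∀ i, (S i).Nonempty
  disjoint : Pairwise fun i j => Disjoint (S i) (S j)
  cover : ∀ C, C ∈ P.parts ↔ ∃ i, C ∈ S i
  size_ge : ∀ C ∈ P.parts, Δ ≤ (C.card : ℝ)
  separated : ∀ i j : Fin K, (i : ℕ) + 1 = j → ∀ C ∈ S i, ∀ D ∈ S j, (D.card : ℝ) + Δ ≤ C.card
  within : ∀ i, ∀ C ∈ S i, ∀ D ∈ S i, (C.card : ℝ) ≤ (1 + ε) * D.card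

/-- On input `M`, `p`, `q` and the supercluster sizes `k`, the program outputs the partition `P`
(up to the names of the clusters). -/
def RamProgram.Recovers (prog : RamProgram) {n : ℕ}
    (P : Finpartition (Finset.univ : Finset (Fin n))) (p q : ℝ) {K : ℕ} (k : Fin K → ℕ)
    (M : Matrix (Fin n) (Fin n) ℝ) : Prop :=
  ∀ u v : Fin n, prog.label M p q k u = prog.label M p q k v ↔ SameCluster P u v

/-!
The matrix with its mean `(p + q) / 2` removed and `(p - q) / 2` on the diagonal is
`M = (p - q) / 2 * (2 H - J) + E`, where `H` is the zero-one matrix of the relation "same cluster",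
`J` is the all-ones matrix and `E` is the noise, with zero diagonal. The program finds the clusters
one by one, from `M` alone; it has no need of the numbers of clusters in the superclusters.

*One round.* Let `U` be the union of the clusters not found yet, `d = p - q`, and `B` the matrix
`M + d / 2 J = d H + E` restricted to `U`. Let `m` be the smallest size in the first supercluster
that is not exhausted, and `T` the remaining clusters of at least that size; all other remaining
clusters have size at most `m - Δ`. If `‖E‖ ≤ τ` with `τ` small compared to `d Δ`, then `B` has no
eigenvalue near the threshold `t = d (m - Δ / 2)`, and its spectral projection above `t` is close, in
the Frobenius norm, to the orthogonal projection onto the span of the indicators of `T`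
(`IsBlockSignal.sum_sq_sub_blockProj_le`). The program tries all multiples `t` of `d / 2` and
approximates the projection by the Newton-Schulz iteration for the sign of `B - t`, which converges
in `O(n)` steps because the eigenvalues stay away from `0` (`one_sub_newtonSchulzStep_iterate_le`).
Some column of the approximate projection is close to a multiple of the indicator of a cluster in
`T`, so one of its level sets is close to this cluster (`exists_candidate_close`). Among all level
sets of all columns and all thresholds the program picks one, `W`, of maximal density
`∑_{W × W} M / |W|`. The density of a set near a cluster of size `m` is nearly `d m / 2`
(`le_density`), while a set of high density differs from some cluster `C` in few elements
(`exists_density_le`); the number of these is controlled by `|C| ≤ (1 + ε) m`. The bound on `ε` then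
makes the sign of `∑_{w ∈ W} M_xw` tell exactly whether `x` belongs to `C`
(`exists_cluster_of_isDensestCandidate`), so `C` is found without error and can be removed.

*The noise.* The argument uses three properties of `E`, collected in `IsTypical`: the bound `τ` on the
norm, the bound `κ` on the entries, and small row sums over clusters. A bilinear form in `E` is a
weighted sum of independent bounded centred variables, so Hoeffding's inequality applies. A union
bound over a net of `5 ^ n` points gives `‖E‖ ≤ 20 κ √n` (`norm_le_of_net`), and one over the
vertices and clusters gives the row sums. The hypothesis `Δ ≥ c κ (μ + κ) √n / d²` makes `τ` small
enough, and makes the failure probability for the row sums at most `2 n² exp (-√n)`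
(`plantedMatrix_real_not_isTypical_le`, `plantedMatrix_not_recovers_le`).

*The running time.* All loop bounds of the program are affine functions of `n`, so the time is at most
the value at `n` of a polynomial read off from its text (`RamProgram.time_le_timePoly`).
-/

/-! ### Frames, loop rules and running times for the random access machine -/

namespace RamProgram

/-- `c.WritesInt a`: the text of `c` contains an assignment to the integer array `a`, or a loop
whose counter is `a`. -/
def WritesInt (a : ℕ) : RamProgram → Prop
  | skip => False
  | setInt b _ _ => b = a
  | setReal _ _ _ _ => False
  | seq c d => c.WritesInt a ∨ d.WritesInt a
  | cond _ c d => c.WritesInt a ∨ d.WritesInt a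
  | loop x _ c => x = a ∨ c.WritesInt a

/-- `c.WritesReal a`: the text of `c` contains an assignment to the real array `a`. -/
def WritesReal (a : ℕ) : RamProgram → Prop
  | skip => False
  | setInt _ _ _ => False
  | setReal b _ _ _ => b = a
  | seq c d => c.WritesReal a ∨ d.WritesReal a
  | cond _ c d => c.WritesReal a ∨ d.WritesReal a
  | loop _ _ c => c.WritesReal a

theorem exec_ints_of_not_writesInt {a : ℕ} {c : RamProgram} (h : ¬ c.WritesInt a) (s : RamState) :
    (c.exec s).ints a = s.ints a := by
  induction c generalizing s with
  | skip => rfl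
  | setInt b i e =>
    have : a ≠ b := fun hab => h hab.symm
    simp [exec, RamState.setInt, this]
  | setReal b i j e => rfl
  | seq c d ihc ihd =>
    simp only [WritesInt, not_or] at h
    rw [exec, ihd h.2, ihc h.1]
  | cond t c d ihc ihd =>
    simp only [WritesInt, not_or] at h
    rw [exec]
    split_ifs
    exacts [ihc h.1 s, ihd h.2 s]
  | loop x b c ih =>
    simp only [WritesInt, not_or] at h
    have : a ≠ x := fun hab => h.1 hab.symm
    rw [exec]
    induction b.eval s with
    | zero => rfl
    | succ m ihm => rw [rounds, ih h.2, ← ihm]; simp [RamState.setInt, this]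

theorem exec_reals_of_not_writesReal {a : ℕ} {c : RamProgram} (h : ¬ c.WritesReal a)
    (s : RamState) : (c.exec s).reals a = s.reals a := by
  induction c generalizing s with
  | skip => rfl
  | setInt b i e => rfl
  | setReal b i j e =>
    have : a ≠ b := fun hab => h hab.symm
    simp [exec, RamState.setReal, this]
  | seq c d ihc ihd =>
    simp only [WritesReal, not_or] at h
    rw [exec, ihd h.2, ihc h.1]
  | cond t c d ihc ihd =>
    simp only [WritesReal, not_or] at h
    rw [exec]
    split_ifs
    exacts [ihc h.1 s, ihd h.2 s]
  | loop x b c ih =>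
    rw [exec]
    induction b.eval s with
    | zero => rfl
    | succ m ihm => rw [rounds, ih h, ← ihm]; rfl

/-- The states `s` and `st` agree on all arrays that `c` does not write. -/
def Agrees (c : RamProgram) (s st : RamState) : Prop :=
  (∀ a, ¬ c.WritesInt a → st.ints a = s.ints a) ∧
    ∀ a, ¬ c.WritesReal a → st.reals a = s.reals a

theorem Agrees.refl (c : RamProgram) (s : RamState) : c.Agrees s s :=
  ⟨fun _ _ => rfl, fun _ _ => rfl⟩

theorem Agrees.trans {c : RamProgram} {s t u : RamState} (h₁ : c.Agrees s t) (h₂ : c.Agrees t u) :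
    c.Agrees s u :=
  ⟨fun a ha => (h₂.1 a ha).trans (h₁.1 a ha), fun a ha => (h₂.2 a ha).trans (h₁.2 a ha)⟩

theorem Agrees.mono {c d : RamProgram} {s t : RamState} (h : c.Agrees s t)
    (hi : ∀ a, c.WritesInt a → d.WritesInt a) (hr : ∀ a, c.WritesReal a → d.WritesReal a) :
    d.Agrees s t :=
  ⟨fun a ha => h.1 a fun h => ha (hi a h), fun a ha => h.2 a fun h => ha (hr a h)⟩

theorem agrees_exec (c : RamProgram) (s : RamState) : c.Agrees s (c.exec s) :=
  ⟨fun _ h => exec_ints_of_not_writesInt h s, fun _ h => exec_reals_of_not_writesReal h s⟩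

theorem agrees_setInt_loop (x : ℕ) (b : IntExp) (c : RamProgram) (s : RamState) (m : ℕ) :
    (loop x b c).Agrees s (s.setInt x 0 m) := by
  refine ⟨fun a ha => ?_, fun _ _ => rfl⟩
  have : a ≠ x := fun h => ha (Or.inl h.symm)
  simp [RamState.setInt, this]

/-- The invariant rule for counting loops. An invariant only has to be preserved from states that
agree with the initial one outside the arrays written by the loop. -/
theorem loop_induction {x : ℕ} {b : IntExp} {c : RamProgram} {s : RamState}
    (I : ℕ → RamState → Prop) (h0 : I 0 s)
    (hset : ∀ m st k, I m st → I m (st.setInt x 0 k))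
    (hstep : ∀ m < b.eval s, ∀ st, (loop x b c).Agrees s st → st.ints x 0 = m → I m st →
      I (m + 1) (c.exec st)) :
    I (b.eval s) ((loop x b c).exec s) := by
  have key : ∀ m ≤ b.eval s, (loop x b c).Agrees s (rounds c.exec x s m) ∧
      I m (rounds c.exec x s m) := by
    intro m
    induction m with
    | zero => exact fun _ => ⟨Agrees.refl _ _, h0⟩
    | succ m ih =>
      intro hm
      obtain ⟨hA, hI⟩ := ih (by omega)
      have hA' := hA.trans (agrees_setInt_loop x b c _ m)
      refine ⟨hA'.trans ((agrees_exec c _).mono (fun a h => Or.inr h) fun a h => h), ?_⟩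
      exact hstep m (by omega) _ hA' (by simp [RamState.setInt]) (hset _ _ _ hI)
  exact (key _ le_rfl).2

/-- The real array `f` with the entry at `(i, j)` replaced by `v`. -/
def updCell (f : ℕ → ℕ → ℝ) (i j : ℕ) (v : ℝ) : ℕ → ℕ → ℝ :=
  Function.update f i (Function.update (f i) j v)

theorem updCell_apply (f : ℕ → ℕ → ℝ) (i j : ℕ) (v : ℝ) (k l : ℕ) :
    updCell f i j v k l = if k = i ∧ l = j then v else f k l := by
  unfold updCell
  rcases eq_or_ne k i with rfl | h
  · rcases eq_or_ne l j with rfl | h' <;> simp [*]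
  · simp [h]

theorem exec_setReal_reals (a : ℕ) (i j : IntExp) (e : RealExp) (s : RamState) :
    ((setReal a i j e).exec s).reals a = updCell (s.reals a) (i.eval s) (j.eval s) (e.eval s) := by
  simp [exec, RamState.setReal, updCell]

/-- A loop that adds `F m` to one fixed cell in round `m` adds the sum of all `F m`. -/
theorem reals_loop_accum {x : ℕ} {b : IntExp} {c : RamProgram} {s : RamState} {arr i j n : ℕ}
    {F : ℕ → ℝ} (hb : b.eval s = n)
    (h : ∀ m < n, ∀ st, (loop x b c).Agrees s st → st.ints x 0 = m →
      (c.exec st).reals arr = updCell (st.reals arr) i j (st.reals arr i j + F m)) :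
    ((loop x b c).exec s).reals arr =
      updCell (s.reals arr) i j (s.reals arr i j + ∑ m ∈ Finset.range n, F m) := by
  subst hb
  refine loop_induction (fun m st => st.reals arr =
      updCell (s.reals arr) i j (s.reals arr i j + ∑ m ∈ Finset.range m, F m)) ?_
    (fun _ _ _ h => h) ?_
  · simp [updCell]
  · intro m hm st hA hx hI
    rw [h m hm st hA hx, hI]
    ext k l
    simp only [updCell_apply, Finset.sum_range_succ]
    split_ifs <;> simp_all [add_assoc]

/-- A loop that writes `F m` into the cell `(i, m)` in round `m`. -/
theorem reals_loop_row {x : ℕ} {b : IntExp} {c : RamProgram} {s : RamState} {arr i n : ℕ}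
    {F : ℕ → ℝ} (hb : b.eval s = n)
    (h : ∀ m < n, ∀ st, (loop x b c).Agrees s st → st.ints x 0 = m →
      (c.exec st).reals arr = updCell (st.reals arr) i m (F m)) :
    ((loop x b c).exec s).reals arr =
      fun k l => if k = i ∧ l < n then F l else s.reals arr k l := by
  subst hb
  refine loop_induction (fun m st => st.reals arr =
      fun k l => if k = i ∧ l < m then F l else s.reals arr k l) ?_ (fun _ _ _ h => h) ?_
  · simp
  · intro m hm st hA hx hI
    rw [h m hm st hA hx, hI]
    ext k l
    simp only [updCell_apply]
    grind

/-- Two nested loops that write `F i j` into the cell `(i, j)` in round `(i, j)`. -/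
theorem reals_loop_loop {x y : ℕ} {b b' : IntExp} {c : RamProgram} {s : RamState} {arr n : ℕ}
    {F : ℕ → ℕ → ℝ} (hb : b.eval s = n)
    (hb' : ∀ st, (loop x b (loop y b' c)).Agrees s st → b'.eval st = n)
    (hx : ¬ (loop y b' c).WritesInt x)
    (h : ∀ i < n, ∀ j < n, ∀ st, (loop x b (loop y b' c)).Agrees s st →
      st.ints x 0 = i → st.ints y 0 = j →
      (c.exec st).reals arr = updCell (st.reals arr) i j (F i j)) :
    ((loop x b (loop y b' c)).exec s).reals arr =
      fun k l => if k < n ∧ l < n then F k l else s.reals arr k l := by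
  subst hb
  refine loop_induction (fun m st => st.reals arr =
      fun k l => if k < m ∧ l < b.eval s then F k l else s.reals arr k l) ?_ (fun _ _ _ h => h) ?_
  · simp
  · intro m hm st hA hxm hI
    rw [reals_loop_row (i := m) (F := F m) (hb' st hA), hI]
    · ext k l
      grind
    · intro j hj st' hA' hj'
      refine h m hm j hj st' (hA.trans (hA'.mono (fun a h => Or.inr h) fun a h => h)) ?_ hj'
      rw [hA'.1 x hx, hxm]

/-- Two nested loops that add `F i j` to one fixed cell in round `(i, j)`. -/
theorem reals_loop_loop_accum {x y : ℕ} {b b' : IntExp} {c : RamProgram} {s : RamState}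
    {arr i j n : ℕ} {F : ℕ → ℕ → ℝ} (hb : b.eval s = n)
    (hb' : ∀ st, (loop x b (loop y b' c)).Agrees s st → b'.eval st = n)
    (hx : ¬ (loop y b' c).WritesInt x)
    (h : ∀ k < n, ∀ l < n, ∀ st, (loop x b (loop y b' c)).Agrees s st →
      st.ints x 0 = k → st.ints y 0 = l →
      (c.exec st).reals arr = updCell (st.reals arr) i j (st.reals arr i j + F k l)) :
    ((loop x b (loop y b' c)).exec s).reals arr =
      updCell (s.reals arr) i j
        (s.reals arr i j + ∑ k ∈ Finset.range n, ∑ l ∈ Finset.range n, F k l) := by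
  refine reals_loop_accum hb fun m hm st hA hxm => ?_
  refine reals_loop_accum (hb' st hA) fun l hl st' hA' hl' => ?_
  refine h m hm l hl st' (hA.trans (hA'.mono (fun a h => Or.inr h) fun a h => h)) ?_ hl'
  rw [hA'.1 x hx, hxm]

/-! ### Running times -/

/-- The value of an expression built from constants, `ints 0 0` and `+`, as a polynomial in
`ints 0 0`. -/
noncomputable def boundPoly : IntExp → Polynomial ℕ
  | .const c => Polynomial.C c
  | .get _ _ => Polynomial.X
  | .add e f => boundPoly e + boundPoly f
  | .sub _ _ => 0

/-- The expression is built from constants, `ints 0 0` and `+`. -/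
def IsSizeExp : IntExp → Prop
  | .const _ => True
  | .get a i => a = 0 ∧ i = .const 0
  | .add e f => IsSizeExp e ∧ IsSizeExp f
  | .sub _ _ => False

/-- All loop bounds are built from constants, `ints 0 0` and `+`. -/
def HasSizeLoops : RamProgram → Prop
  | skip => True
  | setInt _ _ _ => True
  | setReal _ _ _ _ => True
  | seq c d => c.HasSizeLoops ∧ d.HasSizeLoops
  | cond _ c d => c.HasSizeLoops ∧ d.HasSizeLoops
  | loop _ b c => IsSizeExp b ∧ c.HasSizeLoops

/-- A bound for the running time, as a polynomial in `ints 0 0`. -/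
noncomputable def timePoly : RamProgram → Polynomial ℕ
  | skip => 1
  | setInt _ i e => Polynomial.C (i.cost + e.cost + 1)
  | setReal _ i j e => Polynomial.C (i.cost + j.cost + e.cost + 1)
  | seq c d => c.timePoly + d.timePoly
  | cond t c d => Polynomial.C t.cost + (c.timePoly + d.timePoly)
  | loop _ b c => Polynomial.C (b.cost + 1) + boundPoly b * (c.timePoly + 1)

theorem eval_boundPoly {e : IntExp} (h : IsSizeExp e) (s : RamState) :
    (boundPoly e).eval (s.ints 0 0) = e.eval s := by
  induction e with
  | const c => simp [boundPoly, IntExp.eval]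
  | get a i =>
    obtain ⟨rfl, rfl⟩ := h
    simp [boundPoly, IntExp.eval]
  | add e f ihe ihf => simp [boundPoly, IntExp.eval, ihe h.1, ihf h.2]
  | sub e f => exact h.elim

/-- A program whose loop bounds are linear in the unchanging number `ints 0 0` runs in polynomial
time. -/
theorem time_le_timePoly {c : RamProgram} (h : c.HasSizeLoops) (h0 : ¬ c.WritesInt 0)
    (s : RamState) : c.time s ≤ c.timePoly.eval (s.ints 0 0) := by
  induction c generalizing s with
  | skip => simp [time, timePoly]
  | setInt b i e => simp [time, timePoly]
  | setReal b i j e => simp [time, timePoly]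
  | seq c d ihc ihd =>
    simp only [WritesInt, not_or] at h0
    have h1 := ihc h.1 h0.1 s
    have h2 := ihd h.2 h0.2 (c.exec s)
    rw [exec_ints_of_not_writesInt h0.1] at h2
    simpa [time, timePoly] using add_le_add h1 h2
  | cond t c d ihc ihd =>
    simp only [WritesInt, not_or] at h0
    have h1 := ihc h.1 h0.1 s
    have h2 := ihd h.2 h0.2 s
    simp only [time, timePoly, Polynomial.eval_add, Polynomial.eval_C]
    split_ifs <;> omega
  | loop x b c ih =>
    have h0' := h0
    simp only [WritesInt, not_or] at h0
    simp only [time, timePoly, Polynomial.eval_add, Polynomial.eval_C, Polynomial.eval_mul,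
      eval_boundPoly h.1, Polynomial.eval_one]
    gcongr
    refine (Finset.sum_le_card_nsmul _ _ (c.timePoly.eval (s.ints 0 0) + 1) ?_).trans (by simp)
    intro m _
    have hs : ((rounds c.exec x s m).setInt x 0 m).ints 0 = s.ints 0 := by
      have h1 := exec_ints_of_not_writesInt (c := loop x (.const m) c) (a := 0) h0' s
      rw [← h1]
      have : (0 : ℕ) ≠ x := fun h => h0.1 h.symm
      simp [RamState.setInt, this, exec, IntExp.eval]
    have := ih h.2 h0.2 ((rounds c.exec x s m).setInt x 0 m)
    rw [hs] at this
    omega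

end RamProgram

/-! ### The recovery program

The programs share the following memory, beyond the input. A vector is kept in row `0` of a real
array, and a scalar in the cell `(0, 0)`.

* Integer arrays: `3` holds the labels, with `0` for an index without a label; `10` to `17` are
  loop counters.
* Matrices: `2` the identity, `3` the centred input, `5` the shifted signal, `6` the Newton-Schulz
  iterate, `7`, `8` and `9` auxiliary products.
* Vectors: `4` the indicator of the unlabelled indices, `11` that of the current candidate, `12`
  that of the best candidate so far.
* Scalars: `13` the threshold, `14` the sum of absolute values, `15` and `16` the entry sum and the
  size of the current candidate, `17` the score of the best candidate, `18` a row sum.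
-/

namespace RamProgram

/-- The matrix size, held in `ints 0 0`. -/
def size : IntExp := .get 0 (.const 0)

/-- The number held in `ints x 0`, for instance a loop counter. -/
def ctr (x : ℕ) : IntExp := .get x (.const 0)

/-- The real number held in `reals a 0 0`. -/
def scalar (a : ℕ) : RealExp := .get a (.const 0) (.const 0)

/-- The entry of the real array `a` at the loop counters `15` and `16`. -/
def entry (a : ℕ) : RealExp := .get a (ctr 15) (ctr 16)

/-- The entry of the vector in row `0` of the real array `a` at the loop counter `x`. -/
def coord (a x : ℕ) : RealExp := .get a (.const 0) (ctr x)

/-- `(p - q) / 2`. -/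
def halfGap : RealExp :=
  .div (.sub (.get 1 (.const 0) (.const 0)) (.get 1 (.const 0) (.const 1))) (.const 2)

/-- `(p + q) / 2`. -/
def midpoint : RealExp :=
  .div (.add (.get 1 (.const 0) (.const 0)) (.get 1 (.const 0) (.const 1))) (.const 2)

/-- Run `c` for all values below the matrix size of the counters `15` and `16`. -/
def overEntries (c : RamProgram) : RamProgram := loop 15 size (loop 16 size c)

/-- Write the identity matrix into the real array `2`. -/
def identityProg : RamProgram := loop 15 size (setReal 2 (ctr 15) (ctr 15) (.const 1))

/-- Write into the real array `3` the input matrix minus `(p + q) / 2`, with diagonal `(p - q) / 2`.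
The array `2` has to hold the identity matrix. -/
def centreProg : RamProgram :=
  overEntries (setReal 3 (ctr 15) (ctr 16)
    (.add (.sub (entry 0) midpoint)
      (.mul (entry 2) (.sub (.get 1 (.const 0) (.const 0)) (entry 0)))))

/-- Write into the real vector `4` the indicator of the set of unlabelled indices. -/
def unlabelledProg : RamProgram :=
  loop 15 size (cond (.intLe (.get 3 (ctr 15)) (.const 0))
    (setReal 4 (.const 0) (ctr 15) (.const 1)) (setReal 4 (.const 0) (ctr 15) (.const 0)))

/-- Write into the real array `5` the matrix whose sign is to be computed: the shift by the scalar
`13` of the signal matrix restricted to the unlabelled indices. -/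
def shiftProg : RamProgram :=
  overEntries (setReal 5 (ctr 15) (ctr 16)
    (.sub (.mul (.mul (coord 4 15) (coord 4 16)) (.add (entry 3) halfGap))
      (.mul (entry 2) (scalar 13))))

/-- Write into the scalar `14` the sum of the absolute values of the entries of the matrix `5`. -/
def absSumProg : RamProgram :=
  seq (setReal 14 (.const 0) (.const 0) (.const 0))
    (overEntries (cond (.realLe (.const 0) (entry 5))
      (setReal 14 (.const 0) (.const 0) (.add (scalar 14) (entry 5)))
      (setReal 14 (.const 0) (.const 0) (.sub (scalar 14) (entry 5)))))

/-- Write into the real array `6` the quotient of the matrix `5` by the scalar `14`. -/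
def scaleProg : RamProgram :=
  overEntries (setReal 6 (ctr 15) (ctr 16) (.div (entry 5) (scalar 14)))

/-- Write into the real array `c` the product of the matrices `a` and `b`. -/
def mulProg (a b c : ℕ) : RamProgram :=
  overEntries (seq (setReal c (ctr 15) (ctr 16) (.const 0))
    (loop 17 size (setReal c (ctr 15) (ctr 16)
      (.add (entry c) (.mul (.get a (ctr 15) (ctr 17)) (.get b (ctr 17) (ctr 16)))))))

/-- Replace the matrix `X` in the real array `6` by `(3 X - X³) / 2`. -/
def newtonProg : RamProgram :=
  seq (mulProg 6 6 7) (seq (mulProg 6 7 8)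
    (seq (overEntries (setReal 9 (ctr 15) (ctr 16)
        (.mul (.const (1 / 2)) (.sub (.mul (.const 3) (entry 6)) (entry 8)))))
      (overEntries (setReal 6 (ctr 15) (ctr 16) (entry 9)))))

/-- Write into the real array `6` an approximation of the sign of the matrix `5`. -/
def signProg : RamProgram :=
  seq absSumProg (seq scaleProg (loop 12 (.add size size) newtonProg))

/-- Write into the real vector `11` the indicator of the level set, among the unlabelled indices, of
row `13` of the sum of the matrices `6` and `2` at the height of the entry in column `14`. -/
def levelProg : RamProgram :=
  loop 15 size (cond
    (.realLe (.add (.get 6 (ctr 13) (ctr 14)) (.get 2 (ctr 13) (ctr 14)))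
      (.add (.get 6 (ctr 13) (ctr 15)) (.get 2 (ctr 13) (ctr 15))))
    (setReal 11 (.const 0) (ctr 15) (coord 4 15))
    (setReal 11 (.const 0) (ctr 15) (.const 0)))

/-- Write into the scalar `16` the size of the set `11`, and into the scalar `15` the sum of the
entries of the matrix `3` over pairs from this set. -/
def scoreProg : RamProgram :=
  seq (setReal 16 (.const 0) (.const 0) (.const 0))
    (seq (loop 15 size (setReal 16 (.const 0) (.const 0) (.add (scalar 16) (coord 11 15))))
      (seq (setReal 15 (.const 0) (.const 0) (.const 0))
        (overEntries (setReal 15 (.const 0) (.const 0)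
          (.add (scalar 15) (.mul (.mul (coord 11 15) (coord 11 16)) (entry 3)))))))

/-- Replace the set `12` and its score `17` by the set `11` and its score if the latter is
higher. -/
def keepProg : RamProgram :=
  cond (.realLe (.div (scalar 15) (scalar 16)) (scalar 17)) skip
    (seq (setReal 17 (.const 0) (.const 0) (.div (scalar 15) (scalar 16)))
      (loop 15 size (setReal 12 (.const 0) (ctr 15) (coord 11 15))))

/-- One candidate set. -/
def tryProg : RamProgram := seq levelProg (seq scoreProg keepProg)

/-- All candidate sets for one threshold, and the passage to the next threshold. -/
def thresholdProg : RamProgram :=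
  seq (seq shiftProg signProg)
    (seq (loop 13 size (loop 14 size tryProg))
      (setReal 13 (.const 0) (.const 0) (.add (scalar 13) halfGap)))

/-- Write into the real vector `12` the indicator of a candidate set of highest score. -/
def searchProg : RamProgram :=
  seq (setReal 17 (.const 0) (.const 0) (.const 0))
    (seq (loop 15 size (setReal 12 (.const 0) (ctr 15) (.const 0)))
      (seq (setReal 13 (.const 0) (.const 0) (.const 0))
        (loop 11 (.add (.add size size) (.const 1)) thresholdProg)))

/-- Give a new label to the unlabelled indices whose row of the matrix `3` has a nonnegative sum
over the set `12`. -/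
def markProg : RamProgram :=
  loop 13 size
    (seq (seq (setReal 18 (.const 0) (.const 0) (.const 0))
      (loop 15 size (setReal 18 (.const 0) (.const 0)
        (.add (scalar 18) (.mul (coord 12 15) (.get 3 (ctr 13) (ctr 15)))))))
      (cond (.realLe (.const 1) (coord 4 13))
        (cond (.realLe (.const 0) (scalar 18))
          (setInt 3 (ctr 13) (.add (ctr 10) (.const 1))) skip) skip))

/-- Find one cluster among the unlabelled indices and label it. -/
def roundProg : RamProgram := seq unlabelledProg (seq searchProg markProg)

/-- The recovery program. -/
def recoveryProg : RamProgram := seq identityProg (seq centreProg (loop 10 size roundProg))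

theorem hasSizeLoops_recoveryProg : recoveryProg.HasSizeLoops := by
  simp [recoveryProg, identityProg, centreProg, roundProg, unlabelledProg, searchProg, markProg,
    thresholdProg, shiftProg, signProg, tryProg, levelProg, scoreProg, keepProg, absSumProg,
    scaleProg, newtonProg, mulProg, overEntries, HasSizeLoops, IsSizeExp, size]

theorem not_writesInt_recoveryProg : ¬ recoveryProg.WritesInt 0 := by
  simp [recoveryProg, identityProg, centreProg, roundProg, unlabelledProg, searchProg, markProg,
    thresholdProg, shiftProg, signProg, tryProg, levelProg, scoreProg, keepProg, absSumProg,
    scaleProg, newtonProg, mulProg, overEntries, WritesInt]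

end RamProgram

/-! ### What the program computes -/

/-- The sum of the absolute values of the entries. -/
def Matrix.absSum {n : ℕ} (Y : Matrix (Fin n) (Fin n) ℝ) : ℝ := ∑ i, ∑ j, |Y i j|

/-- One step of the Newton-Schulz iteration for the sign of a matrix. -/
noncomputable def Matrix.newtonSchulz {n : ℕ} (X : Matrix (Fin n) (Fin n) ℝ) :
    Matrix (Fin n) (Fin n) ℝ :=
  (1 / 2 : ℝ) • ((3 : ℝ) • X - X * (X * X))

/-- The approximation of the sign of a matrix by `2 n` Newton-Schulz steps. -/
noncomputable def Matrix.approxSign {n : ℕ} (Y : Matrix (Fin n) (Fin n) ℝ) :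
    Matrix (Fin n) (Fin n) ℝ :=
  Matrix.newtonSchulz^[n + n] (Y.absSum⁻¹ • Y)

/-- The matrix `M + h`, restricted to the rows and columns in `U`. -/
def restrictedSignal {n : ℕ} (M : Matrix (Fin n) (Fin n) ℝ) (h : ℝ) (U : Finset (Fin n)) :
    Matrix (Fin n) (Fin n) ℝ :=
  Matrix.of fun a b => (if a ∈ U then 1 else 0) * (if b ∈ U then 1 else 0) * (M a b + h)

/-- Twice the approximate projection onto the eigenspaces of the restricted signal matrix with
eigenvalue above `t`. -/
noncomputable def spectralCut {n : ℕ} (M : Matrix (Fin n) (Fin n) ℝ) (h : ℝ) (U : Finset (Fin n))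
    (t : ℝ) : Matrix (Fin n) (Fin n) ℝ :=
  (restrictedSignal M h U - t • (1 : Matrix (Fin n) (Fin n) ℝ)).approxSign + 1

/-- The part in `U` of a level set of row `u` of a matrix. -/
noncomputable def rowLevelSet {n : ℕ} (X : Matrix (Fin n) (Fin n) ℝ) (U : Finset (Fin n))
    (u v : Fin n) : Finset (Fin n) :=
  {w ∈ U | X u v ≤ X u w}

/-- The sum of the entries of `M` over pairs from `W`, divided by the size of `W`;
it is `0` for the empty set. -/
noncomputable def density {n : ℕ} (M : Matrix (Fin n) (Fin n) ℝ) (W : Finset (Fin n)) : ℝ :=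
  (∑ a ∈ W, ∑ b ∈ W, M a b) / W.card

/-- The upper left `n × n` block of a real array. -/
def block (n : ℕ) (f : ℕ → ℕ → ℝ) : Matrix (Fin n) (Fin n) ℝ := Matrix.of fun i j => f i j

/-- Row `0` of a real array is the indicator of `W`. -/
def IsIndicator {n : ℕ} (f : ℕ → ℕ → ℝ) (W : Finset (Fin n)) : Prop :=
  ∀ w : Fin n, f 0 w = if w ∈ W then 1 else 0

/-- The input matrix minus `(p + q) / 2`, with diagonal `(p - q) / 2`. -/
noncomputable def centredMatrix {n : ℕ} (A : Matrix (Fin n) (Fin n) ℝ) (p q : ℝ) :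
    Matrix (Fin n) (Fin n) ℝ :=
  Matrix.of fun i j => if i = j then (p - q) / 2 else A i j - (p + q) / 2

namespace RamProgram

theorem identityProg_spec {n : ℕ} {s : RamState} (hn : s.ints 0 0 = n)
    (h : ∀ i j, s.reals 2 i j = 0) : block n ((identityProg.exec s).reals 2) = 1 := by
  have : ((identityProg.exec s).reals 2) = fun i j => if i = j ∧ i < n then 1 else 0 := by
    subst hn
    refine loop_induction (b := size) (fun m st => st.reals 2 =
      fun i j => if i = j ∧ i < m then 1 else 0) ?_ (fun _ _ _ h => h) ?_
    · ext i j; simp [h]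
    · intro m hm st hA hx hI
      rw [exec_setReal_reals, hI]
      ext k l
      simp only [updCell_apply, ctr, IntExp.eval, hx, RealExp.eval, Rat.cast_one]
      grind
  rw [this]
  ext i j
  simp [block, Matrix.one_apply, Fin.ext_iff]

theorem centreProg_spec {n : ℕ} {s : RamState} (hn : s.ints 0 0 = n)
    (h : block n (s.reals 2) = 1) :
    block n ((centreProg.exec s).reals 3) =
      centredMatrix (block n (s.reals 0)) (s.reals 1 0 0) (s.reals 1 0 1) := by
  have key : (centreProg.exec s).reals 3 = _ :=
    reals_loop_loop (n := n) (F := fun i j => s.reals 0 i j - (s.reals 1 0 0 + s.reals 1 0 1) / 2 +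
      s.reals 2 i j * (s.reals 1 0 0 - s.reals 0 i j)) hn
      (fun st hA => by
        rw [size, IntExp.eval, hA.1 0 (by simp [WritesInt]), IntExp.eval, hn])
      (by simp [WritesInt])
      (fun i hi j hj st hA hx hy => by
        rw [exec_setReal_reals]
        have h0 := hA.2 0 (by simp [WritesReal])
        have h1 := hA.2 1 (by simp [WritesReal])
        have h2 := hA.2 2 (by simp [WritesReal])
        simp [ctr, entry, midpoint, IntExp.eval, RealExp.eval, hx, hy, h0, h1, h2])
  rw [key]
  ext i j
  have hij := congrFun (congrFun h i) j
  simp only [block, Matrix.of_apply] at hij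
  simp only [block, Matrix.of_apply, Fin.is_lt, and_self, if_true, hij, centredMatrix,
    Matrix.one_apply]
  split_ifs <;> ring

theorem unlabelledProg_spec {n : ℕ} {s : RamState} (hn : s.ints 0 0 = n) :
    IsIndicator ((unlabelledProg.exec s).reals 4) ({x : Fin n | s.ints 3 x = 0} : Finset (Fin n)) := by
  have key : (unlabelledProg.exec s).reals 4 = _ :=
    reals_loop_row (n := n) (i := 0) (F := fun j => if s.ints 3 j = 0 then 1 else 0) hn
      (fun i hi st hA hx => by
        have h3 := hA.1 3 (by simp [WritesInt])
        rw [exec]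
        simp only [RamTest.Holds, IntExp.eval, ctr, hx, h3, Nat.le_zero]
        split_ifs <;> rw [exec_setReal_reals] <;> simp [IntExp.eval, RealExp.eval, hx])
  rw [key]
  intro w
  simp

theorem shiftProg_spec {n : ℕ} {s : RamState} {M : Matrix (Fin n) (Fin n) ℝ} {U : Finset (Fin n)}
    (hn : s.ints 0 0 = n) (h2 : block n (s.reals 2) = 1) (h3 : block n (s.reals 3) = M)
    (h4 : IsIndicator (s.reals 4) U) :
    block n ((shiftProg.exec s).reals 5) =
      restrictedSignal M ((s.reals 1 0 0 - s.reals 1 0 1) / 2) U -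
        s.reals 13 0 0 • (1 : Matrix (Fin n) (Fin n) ℝ) := by
  have key : (shiftProg.exec s).reals 5 = _ :=
    reals_loop_loop (n := n) (F := fun i j => s.reals 4 0 i * s.reals 4 0 j *
      (s.reals 3 i j + (s.reals 1 0 0 - s.reals 1 0 1) / 2) - s.reals 2 i j * s.reals 13 0 0) hn
      (fun st hA => by
        rw [size, IntExp.eval, hA.1 0 (by simp [WritesInt]), IntExp.eval, hn])
      (by simp [WritesInt])
      (fun i hi j hj st hA hx hy => by
        rw [exec_setReal_reals]
        have h1 := hA.2 1 (by simp [WritesReal])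
        have h2 := hA.2 2 (by simp [WritesReal])
        have h3 := hA.2 3 (by simp [WritesReal])
        have h4 := hA.2 4 (by simp [WritesReal])
        have h5 := hA.2 13 (by simp [WritesReal])
        simp [ctr, entry, coord, scalar, halfGap, IntExp.eval, RealExp.eval, hx, hy, h1, h2, h3,
          h4, h5])
  rw [key]
  ext i j
  have hij := congrFun (congrFun h2 i) j
  simp only [block, Matrix.of_apply] at hij
  simp [block, ← h3, restrictedSignal, hij, h4 i, h4 j, mul_comm]

theorem absSumProg_spec {n : ℕ} {s : RamState} (hn : s.ints 0 0 = n) :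
    (absSumProg.exec s).reals 14 0 0 = (block n (s.reals 5)).absSum := by
  have h1 : ((setReal 14 (.const 0) (.const 0) (.const 0)).exec s).reals 14 0 0 = 0 := by
    rw [exec_setReal_reals]; simp [updCell_apply, IntExp.eval, RealExp.eval]
  have key := reals_loop_loop_accum (x := 15) (y := 16) (b := size) (b' := size)
    (c := cond (.realLe (.const 0) (entry 5))
      (setReal 14 (.const 0) (.const 0) (.add (scalar 14) (entry 5)))
      (setReal 14 (.const 0) (.const 0) (.sub (scalar 14) (entry 5))))
    (s := (setReal 14 (.const 0) (.const 0) (.const 0)).exec s) (arr := 14) (i := 0) (j := 0)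
    (n := n) (F := fun i j => |s.reals 5 i j|) hn
      (fun st hA => by
        rw [size, IntExp.eval, hA.1 0 (by simp [WritesInt]), IntExp.eval, ← hn]; rfl)
      (by simp [WritesInt])
      (fun i hi j hj st hA hx hy => by
        have h5 : st.reals 5 = s.reals 5 := hA.2 5 (by simp [WritesReal])
        rw [exec]
        simp only [RamTest.Holds, RealExp.eval, IntExp.eval, ctr, entry, hx, hy, h5]
        split_ifs with h
        · rw [exec_setReal_reals]
          simp [scalar, IntExp.eval, RealExp.eval, hx, hy, h5]
          simp only [Rat.cast_zero] at h
          rw [abs_of_nonneg h]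
        · rw [exec_setReal_reals]
          simp [scalar, IntExp.eval, RealExp.eval, hx, hy, h5]
          simp only [Rat.cast_zero] at h
          rw [abs_of_neg (not_le.1 h), sub_eq_add_neg])
  rw [absSumProg, exec, overEntries, key, updCell_apply, h1]
  simp [Matrix.absSum, block, Finset.sum_range]

theorem scaleProg_spec {n : ℕ} {s : RamState} (hn : s.ints 0 0 = n) :
    block n ((scaleProg.exec s).reals 6) = (s.reals 14 0 0)⁻¹ • block n (s.reals 5) := by
  have key : (scaleProg.exec s).reals 6 = _ :=
    reals_loop_loop (n := n) (F := fun i j => s.reals 5 i j / s.reals 14 0 0) hn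
      (fun st hA => by
        rw [size, IntExp.eval, hA.1 0 (by simp [WritesInt]), IntExp.eval, hn])
      (by simp [WritesInt])
      (fun i hi j hj st hA hx hy => by
        rw [exec_setReal_reals]
        have h1 := hA.2 5 (by simp [WritesReal])
        have h2 := hA.2 14 (by simp [WritesReal])
        simp [ctr, entry, scalar, IntExp.eval, RealExp.eval, hx, hy, h1, h2])
  rw [key]
  ext i j
  simp [block, div_eq_inv_mul]

theorem mulProg_spec {n a b c : ℕ} {s : RamState} (hn : s.ints 0 0 = n) (hac : a ≠ c)
    (hbc : b ≠ c) :
    block n (((mulProg a b c).exec s).reals c) = block n (s.reals a) * block n (s.reals b) := by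
  have key : ((mulProg a b c).exec s).reals c = _ :=
    reals_loop_loop (n := n)
      (F := fun i j => ∑ k ∈ Finset.range n, s.reals a i k * s.reals b k j) hn
      (fun st hA => by
        rw [size, IntExp.eval, hA.1 0 (by simp [WritesInt]), IntExp.eval, hn])
      (by simp [WritesInt])
      (fun i hi j hj st hA hx hy => by
        have h0 := hA.1 0 (by simp [WritesInt])
        have ha := hA.2 a (by simp [WritesReal, hac.symm])
        have hb := hA.2 b (by simp [WritesReal, hbc.symm])
        rw [exec, reals_loop_accum (arr := c) (i := i) (j := j) (n := n)
          (F := fun k => s.reals a i k * s.reals b k j)]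
        · rw [exec_setReal_reals]
          ext k l
          simp only [updCell_apply, ctr, IntExp.eval, RealExp.eval, hx, hy]
          split_ifs <;> simp_all
        · have h0' : ((setReal c (ctr 15) (ctr 16) (.const 0)).exec st).ints = st.ints := rfl
          rw [size, IntExp.eval, h0', h0, IntExp.eval, hn]
        · intro k hk st' hA' hz
          rw [exec_setReal_reals]
          have e1 : st'.ints 15 = st.ints 15 := hA'.1 15 (by simp [WritesInt])
          have e2 : st'.ints 16 = st.ints 16 := hA'.1 16 (by simp [WritesInt])
          have ea : st'.reals a = s.reals a := (hA'.2 a (by simp [WritesReal, hac.symm])).trans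
            ((exec_reals_of_not_writesReal (by simp [WritesReal, hac.symm]) _).trans ha)
          have eb : st'.reals b = s.reals b := (hA'.2 b (by simp [WritesReal, hbc.symm])).trans
            ((exec_reals_of_not_writesReal (by simp [WritesReal, hbc.symm]) _).trans hb)
          simp [ctr, entry, IntExp.eval, RealExp.eval, e1, e2, ea, eb, hx, hy, hz])
  rw [key]
  ext i j
  simp [block, Matrix.mul_apply, Finset.sum_range]

theorem newtonProg_spec {n : ℕ} {s : RamState} (hn : s.ints 0 0 = n) :
    block n ((newtonProg.exec s).reals 6) = (block n (s.reals 6)).newtonSchulz := by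
  simp only [newtonProg, exec]
  set s1 := (mulProg 6 6 7).exec s with hs1
  set s2 := (mulProg 6 7 8).exec s1 with hs2
  set s3 := (overEntries (setReal 9 (ctr 15) (ctr 16)
        (.mul (.const (1 / 2)) (.sub (.mul (.const 3) (entry 6)) (entry 8))))).exec s2 with hs3
  have n1 : s1.ints 0 0 = n := by
    rw [hs1, exec_ints_of_not_writesInt (by simp [mulProg, overEntries, WritesInt]), hn]
  have n2 : s2.ints 0 0 = n := by
    rw [hs2, exec_ints_of_not_writesInt (by simp [mulProg, overEntries, WritesInt]), n1]
  have n3 : s3.ints 0 0 = n := by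
    rw [hs3, exec_ints_of_not_writesInt (by simp [overEntries, WritesInt]), n2]
  have e1 : s1.reals 6 = s.reals 6 :=
    exec_reals_of_not_writesReal (by simp [mulProg, overEntries, WritesReal]) _
  have e2 : s2.reals 6 = s1.reals 6 :=
    exec_reals_of_not_writesReal (by simp [mulProg, overEntries, WritesReal]) _
  have m1 : block n (s1.reals 7) = _ := mulProg_spec hn (by decide) (by decide)
  have m2 : block n (s2.reals 8) = _ := mulProg_spec n1 (by decide) (by decide)
  have key3 : s3.reals 9 = _ :=
    reals_loop_loop (n := n) (F := fun i j => 1 / 2 * (3 * s2.reals 6 i j - s2.reals 8 i j)) n2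
      (fun st hA => by
        rw [size, IntExp.eval, hA.1 0 (by simp [WritesInt]), IntExp.eval, n2])
      (by simp [WritesInt])
      (fun i hi j hj st hA hx hy => by
        rw [exec_setReal_reals]
        have h1 := hA.2 6 (by simp [WritesReal])
        have h2 := hA.2 8 (by simp [WritesReal])
        simp [ctr, entry, IntExp.eval, RealExp.eval, hx, hy, h1, h2])
  have key4 : ((overEntries (setReal 6 (ctr 15) (ctr 16) (entry 9))).exec s3).reals 6 = _ :=
    reals_loop_loop (n := n) (F := fun i j => s3.reals 9 i j) n3
      (fun st hA => by
        rw [size, IntExp.eval, hA.1 0 (by simp [WritesInt]), IntExp.eval, n3])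
      (by simp [WritesInt])
      (fun i hi j hj st hA hx hy => by
        rw [exec_setReal_reals]
        have h1 := hA.2 9 (by simp [WritesReal])
        simp [ctr, entry, IntExp.eval, RealExp.eval, hx, hy, h1])
  rw [key4, key3]
  rw [m1, e1] at m2
  ext i j
  have hij := congrFun (congrFun m2 i) j
  simp only [block, Matrix.of_apply] at hij
  simp [block, Matrix.newtonSchulz, hij, e2, e1]

theorem signProg_spec {n : ℕ} {s : RamState} (hn : s.ints 0 0 = n) :
    block n ((signProg.exec s).reals 6) = (block n (s.reals 5)).approxSign := by
  simp only [signProg, exec.eq_4]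
  set s1 := absSumProg.exec s with hs1
  set s2 := scaleProg.exec s1 with hs2
  have n1 : s1.ints 0 0 = n := by
    rw [hs1, exec_ints_of_not_writesInt (by simp [absSumProg, overEntries, WritesInt]), hn]
  have n2 : s2.ints 0 0 = n := by
    rw [hs2, exec_ints_of_not_writesInt (by simp [scaleProg, overEntries, WritesInt]), n1]
  have e5 : s1.reals 5 = s.reals 5 :=
    exec_reals_of_not_writesReal (by simp [absSumProg, overEntries, WritesReal]) _
  have m1 : s1.reals 14 0 0 = _ := absSumProg_spec hn
  have m2 : block n (s2.reals 6) = _ := scaleProg_spec n1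
  have hb : (IntExp.add size size).eval s2 = n + n := by simp [IntExp.eval, size, n2]
  rw [Matrix.approxSign, ← hb, ← m1, ← e5, ← m2]
  refine loop_induction (fun m st => block n (st.reals 6) =
    Matrix.newtonSchulz^[m] (block n (s2.reals 6))) rfl (fun _ _ _ h => h) ?_
  intro m hm st hA hx hI
  rw [newtonProg_spec, hI, Function.iterate_succ_apply']
  rw [hA.1 0 (by simp [newtonProg, mulProg, overEntries, WritesInt]), n2]

end RamProgram

/-! ### Correctness of the search and of the rounds -/

theorem mem_rowLevelSet {n : ℕ} {X : Matrix (Fin n) (Fin n) ℝ} {U : Finset (Fin n)}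
    {u v w : Fin n} : w ∈ rowLevelSet X U u v ↔ w ∈ U ∧ X u v ≤ X u w :=
  Finset.mem_filter

/-- `W` is a subset of `U` whose density is at least that of all candidates, which are the level
sets in `U` of the rows of the spectral cuts at the thresholds `0, h, 2 h, …, 2 n h`. -/
structure IsDensestCandidate {n : ℕ} (M : Matrix (Fin n) (Fin n) ℝ) (h : ℝ)
    (U W : Finset (Fin n)) : Prop where
  subset : W ⊆ U
  density_le : ∀ j < n + n + 1, ∀ u v : Fin n,
    density M (rowLevelSet (spectralCut M h U (j * h)) U u v) ≤ density M W

namespace RamProgram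

/-- The arrays that stay fixed during the search for a cluster in `U`. -/
structure SearchContext {n : ℕ} (M : Matrix (Fin n) (Fin n) ℝ) (h : ℝ) (U : Finset (Fin n))
    (s : RamState) : Prop where
  size_eq : s.ints 0 0 = n
  gap_eq : (s.reals 1 0 0 - s.reals 1 0 1) / 2 = h
  identity_eq : block n (s.reals 2) = 1
  matrix_eq : block n (s.reals 3) = M
  indicator : IsIndicator (s.reals 4) U

variable {n : ℕ} {M : Matrix (Fin n) (Fin n) ℝ} {h : ℝ} {U : Finset (Fin n)} {s st : RamState}

theorem SearchContext.of_agrees (hs : SearchContext M h U s) {c : RamProgram}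
    (hA : c.Agrees s st) (h0 : ¬ c.WritesInt 0) (h1 : ∀ a, 1 ≤ a → a ≤ 4 → ¬ c.WritesReal a) :
    SearchContext M h U st where
  size_eq := by rw [hA.1 0 h0, hs.size_eq]
  gap_eq := by rw [hA.2 1 (h1 1 (by simp) (by simp)), hs.gap_eq]
  identity_eq := by rw [hA.2 2 (h1 2 (by simp) (by simp)), hs.identity_eq]
  matrix_eq := by rw [hA.2 3 (h1 3 (by simp) (by simp)), hs.matrix_eq]
  indicator := by rw [hA.2 4 (h1 4 (by simp) (by simp))]; exact hs.indicator

theorem levelProg_spec (hs : SearchContext M h U s) {u v : Fin n} (hu : s.ints 13 0 = u)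
    (hv : s.ints 14 0 = v) :
    IsIndicator ((levelProg.exec s).reals 11)
      (rowLevelSet (block n (s.reals 6) + 1) U u v) := by
  have key : (levelProg.exec s).reals 11 = _ :=
    reals_loop_row (n := n) (i := 0) (F := fun w =>
      if s.reals 6 u v + s.reals 2 u v ≤ s.reals 6 u w + s.reals 2 u w then s.reals 4 0 w else 0)
      hs.size_eq
      (fun i hi st hA hx => by
        have h13 := hA.1 13 (by simp [WritesInt])
        have h14 := hA.1 14 (by simp [WritesInt])
        have h2 := hA.2 2 (by simp [WritesReal])
        have h4 := hA.2 4 (by simp [WritesReal])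
        have h6 := hA.2 6 (by simp [WritesReal])
        rw [exec]
        simp only [RamTest.Holds, RealExp.eval, IntExp.eval, ctr, hx, h13, h14, h2, h6, hu, hv]
        split_ifs <;> rw [exec_setReal_reals] <;>
          simp [coord, ctr, IntExp.eval, RealExp.eval, hx, h4])
  rw [key]
  intro w
  have e : ∀ w : Fin n, s.reals 2 u w = (1 : Matrix (Fin n) (Fin n) ℝ) u w := fun w => by
    rw [← hs.identity_eq]; rfl
  simp only [Fin.is_lt, and_self, if_true, e, hs.indicator w, mem_rowLevelSet,
    Matrix.add_apply, block, Matrix.of_apply]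
  by_cases hw : w ∈ U <;> simp [hw]

theorem scoreProg_spec (hs : SearchContext M h U s) {W : Finset (Fin n)}
    (hW : IsIndicator (s.reals 11) W) :
    (scoreProg.exec s).reals 15 0 0 / (scoreProg.exec s).reals 16 0 0 = density M W := by
  simp only [scoreProg, exec.eq_4]
  set s1 := (setReal 16 (.const 0) (.const 0) (.const 0)).exec s with hs1
  set s2 := (loop 15 size
    (setReal 16 (.const 0) (.const 0) (.add (scalar 16) (coord 11 15)))).exec s1 with hs2
  set s3 := (setReal 15 (.const 0) (.const 0) (.const 0)).exec s2 with hs3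
  have c1 : SearchContext M h U s1 := hs.of_agrees (agrees_exec _ s) (by simp [WritesInt])
    (by simp only [WritesReal]; omega)
  have c2 : SearchContext M h U s2 := c1.of_agrees (agrees_exec _ s1) (by simp [WritesInt])
    (by simp only [WritesReal]; omega)
  have c3 : SearchContext M h U s3 := c2.of_agrees (agrees_exec _ s2) (by simp [WritesInt])
    (by simp only [WritesReal]; omega)
  have a1 : s1.reals 11 = s.reals 11 := exec_reals_of_not_writesReal (by simp [WritesReal]) _
  have a2 : s2.reals 11 = s.reals 11 :=
    (exec_reals_of_not_writesReal (by simp [WritesReal]) _).trans a1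
  have a3 : s3.reals 11 = s.reals 11 :=
    (exec_reals_of_not_writesReal (by simp [WritesReal]) _).trans a2
  have z1 : s1.reals 16 0 0 = 0 := by
    rw [hs1, exec_setReal_reals]; simp [updCell_apply, IntExp.eval, RealExp.eval]
  have z3 : s3.reals 15 0 0 = 0 := by
    rw [hs3, exec_setReal_reals]; simp [updCell_apply, IntExp.eval, RealExp.eval]
  have k2 : s2.reals 16 = _ := reals_loop_accum (arr := 16) (i := 0) (j := 0) (n := n)
    (F := fun w => s.reals 11 0 w) c1.size_eq (fun m hm st hA hx => by
      have h11 := hA.2 11 (by simp [WritesReal])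
      rw [exec_setReal_reals]
      simp [scalar, coord, ctr, IntExp.eval, RealExp.eval, hx, h11, a1])
  have k4 := reals_loop_loop_accum (x := 15) (y := 16) (b := size) (b' := size)
    (c := setReal 15 (.const 0) (.const 0)
      (.add (scalar 15) (.mul (.mul (coord 11 15) (coord 11 16)) (entry 3)))) (s := s3)
    (arr := 15) (i := 0) (j := 0) (n := n)
    (F := fun a b => s.reals 11 0 a * s.reals 11 0 b * s3.reals 3 a b) c3.size_eq
    (fun st hA => by
        rw [size, IntExp.eval, hA.1 0 (by simp [WritesInt]), IntExp.eval, c3.size_eq])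
    (by simp [WritesInt])
    (fun i hi j hj st hA hx hy => by
      have h11 := hA.2 11 (by simp [WritesReal])
      have h3 := hA.2 3 (by simp [WritesReal])
      rw [exec_setReal_reals]
      simp [scalar, coord, entry, ctr, IntExp.eval, RealExp.eval, hx, hy, h11, h3, a3])
  have e4 : ((overEntries (setReal 15 (.const 0) (.const 0)
      (.add (scalar 15) (.mul (.mul (coord 11 15) (coord 11 16)) (entry 3))))).exec s3).reals 16
      = s2.reals 16 :=
    (exec_reals_of_not_writesReal (by simp [overEntries, WritesReal]) _).trans
      (exec_reals_of_not_writesReal (by simp [WritesReal]) _)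
  rw [e4, k2, overEntries, k4, updCell_apply, updCell_apply, z1, z3]
  have e : ∀ a b : Fin n, s3.reals 3 a b = M a b := fun a b => by rw [← c3.matrix_eq]; rfl
  simp only [and_self, if_true, zero_add, Finset.sum_range, e, hW _, density]
  congr 1
  · simp [Finset.sum_ite_mem]
  · simp

/-- The real vector `12` is the indicator of a subset `W` of `U`, whose score is in the scalar
`17`. -/
def HoldsBest (M : Matrix (Fin n) (Fin n) ℝ) (U : Finset (Fin n)) (s : RamState)
    (W : Finset (Fin n)) : Prop :=
  W ⊆ U ∧ IsIndicator (s.reals 12) W ∧ s.reals 17 0 0 = density M W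

theorem tryProg_spec (hs : SearchContext M h U s) {u v : Fin n} (hu : s.ints 13 0 = u)
    (hv : s.ints 14 0 = v) {W : Finset (Fin n)} (hW : HoldsBest M U s W) :
    ∃ W', HoldsBest M U (tryProg.exec s) W' ∧ density M W ≤ density M W' ∧
      density M (rowLevelSet (block n (s.reals 6) + 1) U u v) ≤ density M W' := by
  set L := rowLevelSet (block n (s.reals 6) + 1) U u v with hL
  simp only [tryProg, exec.eq_4]
  have l1 := levelProg_spec hs hu hv
  set s1 := levelProg.exec s with hs1
  have c1 : SearchContext M h U s1 := hs.of_agrees (agrees_exec _ s)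
    (by simp [levelProg, WritesInt]) (by simp only [levelProg, WritesReal]; omega)
  have l2 := scoreProg_spec c1 l1
  set s2 := scoreProg.exec s1 with hs2
  have c2 : SearchContext M h U s2 := c1.of_agrees (agrees_exec _ s1)
    (by simp [scoreProg, overEntries, WritesInt])
    (by simp only [scoreProg, overEntries, WritesReal]; omega)
  have e11 : s2.reals 11 = s1.reals 11 :=
    exec_reals_of_not_writesReal (by simp [scoreProg, overEntries, WritesReal]) _
  have e12 : s2.reals 12 = s.reals 12 :=
    (exec_reals_of_not_writesReal (by simp [scoreProg, overEntries, WritesReal]) _).trans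
      (exec_reals_of_not_writesReal (by simp [levelProg, WritesReal]) _)
  have e17 : s2.reals 17 = s.reals 17 :=
    (exec_reals_of_not_writesReal (by simp [scoreProg, overEntries, WritesReal]) _).trans
      (exec_reals_of_not_writesReal (by simp [levelProg, WritesReal]) _)
  obtain ⟨hWU, hW12, hW17⟩ := hW
  rw [keepProg, exec]
  simp only [RamTest.Holds, RealExp.eval, scalar, IntExp.eval, l2, e17, hW17]
  split_ifs with hle
  · exact ⟨W, ⟨hWU, by rw [exec, e12]; exact hW12, by rw [exec, e17]; exact hW17⟩, le_rfl, hle⟩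
  · refine ⟨L, ⟨Finset.filter_subset _ _, ?_, ?_⟩, (not_le.1 hle).le, le_rfl⟩
    · rw [exec, reals_loop_row (n := n) (i := 0) (F := fun w => s1.reals 11 0 w)]
      · intro w
        simpa using l1 w
      · exact c2.size_eq
      · intro m hm st hA hx
        have h11 := hA.2 11 (by simp [WritesReal])
        have : (setReal 17 (.const 0) (.const 0)
          (.div (.get 15 (.const 0) (.const 0)) (.get 16 (.const 0) (.const 0))) |>.exec
            s2).reals 11 = s1.reals 11 :=
          (exec_reals_of_not_writesReal (by simp [WritesReal]) _).trans e11
        rw [exec_setReal_reals]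
        simp [coord, ctr, IntExp.eval, RealExp.eval, hx, h11, this]
    · rw [exec, exec_reals_of_not_writesReal (by simp [WritesReal]), exec_setReal_reals,
        updCell_apply]
      simp [IntExp.eval, RealExp.eval, l2, hL]

theorem thresholdProg_spec (hs : SearchContext M h U s) {W : Finset (Fin n)}
    (hW : HoldsBest M U s W) :
    SearchContext M h U (thresholdProg.exec s) ∧
    (thresholdProg.exec s).reals 13 0 0 = s.reals 13 0 0 + h ∧
    ∃ W', HoldsBest M U (thresholdProg.exec s) W' ∧ density M W ≤ density M W' ∧
      ∀ u v, density M (rowLevelSet (spectralCut M h U (s.reals 13 0 0)) U u v) ≤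
        density M W' := by
  refine ⟨hs.of_agrees (agrees_exec _ s) (by simp [thresholdProg, shiftProg, signProg, tryProg,
    levelProg, scoreProg, keepProg, absSumProg, scaleProg, newtonProg, mulProg, overEntries,
    WritesInt]) (by
    simp only [thresholdProg, shiftProg, signProg, tryProg,
    levelProg, scoreProg, keepProg, absSumProg, scaleProg, newtonProg, mulProg, overEntries,
    WritesReal, false_or]; omega), ?_⟩
  simp only [thresholdProg, exec.eq_4]
  have l1 := shiftProg_spec hs.size_eq hs.identity_eq hs.matrix_eq hs.indicator
  set s1 := shiftProg.exec s with hs1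
  have c1 : SearchContext M h U s1 := hs.of_agrees (agrees_exec _ s)
    (by simp [shiftProg, overEntries, WritesInt])
    (by simp only [shiftProg, overEntries, WritesReal]; omega)
  have l2 := signProg_spec c1.size_eq
  set s2 := signProg.exec s1 with hs2
  have c2 : SearchContext M h U s2 := c1.of_agrees (agrees_exec _ s1)
    (by simp [signProg, absSumProg, scaleProg, newtonProg, mulProg, overEntries, WritesInt])
    (by simp only [signProg, absSumProg, scaleProg, newtonProg, mulProg, overEntries,
      WritesReal]; omega)
  have fr : ∀ a, 10 ≤ a → a ≠ 14 → s2.reals a = s.reals a := fun a ha ha' =>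
    (exec_reals_of_not_writesReal (by
      simp only [signProg, absSumProg, scaleProg, newtonProg, mulProg, overEntries,
        WritesReal]; omega) _).trans
    (exec_reals_of_not_writesReal (by
      simp only [shiftProg, overEntries, WritesReal]; omega) _)
  set s3 := (loop 13 size (loop 14 size tryProg)).exec s2 with hs3
  have c3 : SearchContext M h U s3 := c2.of_agrees (agrees_exec _ s2)
    (by simp [tryProg, levelProg, scoreProg, keepProg, overEntries, WritesInt])
    (by simp only [tryProg, levelProg, scoreProg, keepProg, overEntries, WritesReal, false_or]; omega)
  have e13 : s3.reals 13 = s.reals 13 := (exec_reals_of_not_writesReal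
    (by simp [tryProg, levelProg, scoreProg, keepProg, overEntries, WritesReal]) _).trans
      (fr 13 (by simp) (by simp))
  set X := spectralCut M h U (s.reals 13 0 0) with hX
  have hX2 : block n (s2.reals 6) + 1 = X := by
    rw [l2, l1, hX, spectralCut, hs.gap_eq]
  have hW2 : HoldsBest M U s2 W := by
    refine ⟨hW.1, ?_, ?_⟩
    · rw [fr 12 (by simp) (by simp)]; exact hW.2.1
    · rw [fr 17 (by simp) (by simp)]; exact hW.2.2
  obtain ⟨W', hW', hle, hall⟩ : ∃ W', HoldsBest M U s3 W' ∧ density M W ≤ density M W' ∧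
      ∀ u v : Fin n, (u : ℕ) < n → density M (rowLevelSet X U u v) ≤ density M W' := by
    have hb : size.eval s2 = n := c2.size_eq
    have := loop_induction (x := 13) (b := size) (c := loop 14 size tryProg) (s := s2)
      (fun m st => ∃ W', HoldsBest M U st W' ∧ density M W ≤ density M W' ∧
      ∀ u v : Fin n, (u : ℕ) < m → density M (rowLevelSet X U u v) ≤ density M W')
      ⟨W, hW2, le_rfl, fun _ _ hu => absurd hu (by simp)⟩ (fun _ _ _ h => h) ?_
    · rwa [hb] at this
    intro m hm st hA hx hI
    rw [hb] at hm
    obtain ⟨W₁, hW₁, hle₁, hall₁⟩ := hI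
    have hst : SearchContext M h U st := c2.of_agrees hA
      (by simp [tryProg, levelProg, scoreProg, keepProg, overEntries, WritesInt])
      (by simp only [tryProg, levelProg, scoreProg, keepProg, overEntries, WritesReal, false_or]; omega)
    have h6 : st.reals 6 = s2.reals 6 := hA.2 6
      (by simp [tryProg, levelProg, scoreProg, keepProg, overEntries, WritesReal])
    obtain ⟨W₂, hW₂, hle₂, hall₂⟩ : ∃ W', HoldsBest M U ((loop 14 size tryProg).exec st) W' ∧
        density M W₁ ≤ density M W' ∧
        ∀ v : Fin n, (v : ℕ) < n → density M (rowLevelSet X U ⟨m, hm⟩ v) ≤ density M W' := by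
      have hb' : size.eval st = n := hst.size_eq
      have := loop_induction (x := 14) (b := size) (c := tryProg) (s := st)
        (fun k st' => ∃ W', HoldsBest M U st' W' ∧ density M W₁ ≤ density M W' ∧
        ∀ v : Fin n, (v : ℕ) < k → density M (rowLevelSet X U ⟨m, hm⟩ v) ≤ density M W')
        ⟨W₁, hW₁, le_rfl, fun _ hu => absurd hu (by simp)⟩ (fun _ _ _ h => h) ?_
      · rwa [hb'] at this
      intro k hk st' hA' hx' hI'
      rw [hb'] at hk
      obtain ⟨W₂, hW₂, hle₂, hall₂⟩ := hI'
      have hst' : SearchContext M h U st' := hst.of_agrees hA'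
        (by simp [tryProg, levelProg, scoreProg, keepProg, overEntries, WritesInt])
        (by simp only [tryProg, levelProg, scoreProg, keepProg, overEntries, WritesReal, false_or]; omega)
      have h6' : st'.reals 6 = s2.reals 6 := (hA'.2 6
        (by simp [tryProg, levelProg, scoreProg, keepProg, overEntries, WritesReal])).trans h6
      have h13 : st'.ints 13 = st.ints 13 := hA'.1 13
        (by simp [tryProg, levelProg, scoreProg, keepProg, overEntries, WritesInt])
      obtain ⟨W₃, hW₃, hle₃, hnew⟩ := tryProg_spec hst' (u := ⟨m, hm⟩) (v := ⟨k, hk⟩)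
        (by rw [h13, hx]) hx' hW₂
      rw [h6', hX2] at hnew
      refine ⟨W₃, hW₃, hle₂.trans hle₃, fun v hv => ?_⟩
      rcases Nat.lt_succ_iff_lt_or_eq.1 hv with hv | hv
      · exact (hall₂ v hv).trans hle₃
      · obtain rfl : v = ⟨k, hk⟩ := Fin.ext hv
        exact hnew
    refine ⟨W₂, hW₂, hle₁.trans hle₂, fun u v hu => ?_⟩
    rcases Nat.lt_succ_iff_lt_or_eq.1 hu with hu | hu
    · exact (hall₁ u v hu).trans hle₂
    · obtain rfl : u = ⟨m, hm⟩ := Fin.ext hu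
      exact hall₂ v v.2
  refine ⟨?_, W', ⟨hW'.1, ?_, ?_⟩, hle, fun u v => hall u v u.2⟩
  · rw [exec_setReal_reals, updCell_apply, ← e13, ← c3.gap_eq]
    simp [scalar, halfGap, IntExp.eval, RealExp.eval]
  · rw [exec_reals_of_not_writesReal (by simp [WritesReal])]; exact hW'.2.1
  · rw [exec_reals_of_not_writesReal (by simp [WritesReal])]; exact hW'.2.2

theorem searchProg_spec (hs : SearchContext M h U s) :
    SearchContext M h U (searchProg.exec s) ∧ ∃ W, IsIndicator ((searchProg.exec s).reals 12) W ∧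
      IsDensestCandidate M h U W := by
  refine ⟨hs.of_agrees (agrees_exec _ s) (by simp [searchProg, thresholdProg, shiftProg, signProg,
    tryProg, levelProg, scoreProg, keepProg, absSumProg, scaleProg, newtonProg, mulProg,
    overEntries, WritesInt]) (by
    simp only [searchProg, thresholdProg, shiftProg, signProg, tryProg,
    levelProg, scoreProg, keepProg, absSumProg, scaleProg, newtonProg, mulProg, overEntries,
    WritesReal, false_or]; omega), ?_⟩
  simp only [searchProg, exec.eq_4]
  set s1 := (setReal 17 (.const 0) (.const 0) (.const 0)).exec s with hs1
  set s2 := (loop 15 size (setReal 12 (.const 0) (ctr 15) (.const 0))).exec s1 with hs2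
  set s3 := (setReal 13 (.const 0) (.const 0) (.const 0)).exec s2 with hs3
  have c1 : SearchContext M h U s1 := hs.of_agrees (agrees_exec _ s) (by simp [WritesInt])
    (by simp only [WritesReal]; omega)
  have c2 : SearchContext M h U s2 := c1.of_agrees (agrees_exec _ s1) (by simp [WritesInt])
    (by simp only [WritesReal]; omega)
  have c3 : SearchContext M h U s3 := c2.of_agrees (agrees_exec _ s2) (by simp [WritesInt])
    (by simp only [WritesReal]; omega)
  have t0 : s3.reals 13 0 0 = 0 := by
    rw [hs3, exec_setReal_reals, updCell_apply]; simp [IntExp.eval, RealExp.eval]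
  have b0 : HoldsBest M U s3 ∅ := by
    refine ⟨by simp, ?_, ?_⟩
    · rw [hs3, exec_reals_of_not_writesReal (by simp [WritesReal])]
      have key : s2.reals 12 = _ := reals_loop_row (n := n) (i := 0) (F := fun _ => 0) c1.size_eq
        (fun m hm st hA hx => by
          rw [exec_setReal_reals]
          simp [ctr, IntExp.eval, RealExp.eval, hx])
      rw [key]
      intro w
      simp
    · rw [hs3, exec_reals_of_not_writesReal (by simp [WritesReal]), hs2,
        exec_reals_of_not_writesReal (by simp [WritesReal]), hs1, exec_setReal_reals,
        updCell_apply]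
      simp [IntExp.eval, RealExp.eval, density]
  have hb : (IntExp.add (.add size size) (.const 1)).eval s3 = n + n + 1 := by
    simp [IntExp.eval, size, c3.size_eq]
  have := loop_induction (x := 11) (b := .add (.add size size) (.const 1)) (c := thresholdProg)
    (s := s3) (fun m st => SearchContext M h U st ∧ st.reals 13 0 0 = m * h ∧
      ∃ W, HoldsBest M U st W ∧ ∀ j < m, ∀ u v : Fin n,
        density M (rowLevelSet (spectralCut M h U (j * h)) U u v) ≤ density M W)
    ⟨c3, by simp [t0], ∅, b0, by simp⟩ (fun m st k hst => ⟨hst.1.of_agrees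
      (agrees_setInt_loop 11 (.const 0) skip st k) (by simp [WritesInt]) (by simp [WritesReal]),
      hst.2⟩) ?_
  · rw [hb] at this
    obtain ⟨-, -, W, hW, hall⟩ := this
    exact ⟨W, hW.2.1, hW.1, hall⟩
  intro m hm st hA hx hI
  obtain ⟨hst, ht, W, hW, hall⟩ := hI
  obtain ⟨hst', ht', W', hW', hle, hnew⟩ := thresholdProg_spec hst hW
  refine ⟨hst', by rw [ht', ht]; push_cast; ring, W', hW', fun j hj u v => ?_⟩
  rcases Nat.lt_succ_iff_lt_or_eq.1 hj with hj | rfl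
  · exact (hall j hj u v).trans hle
  · rw [← ht]; exact hnew u v

theorem markProg_spec (hs : SearchContext M h U s) {W : Finset (Fin n)}
    (hW : IsIndicator (s.reals 12) W) (x : Fin n) :
    (markProg.exec s).ints 3 x =
      if x ∈ U ∧ 0 ≤ ∑ w ∈ W, M x w then s.ints 10 0 + 1 else s.ints 3 x := by
  have hb : size.eval s = n := hs.size_eq
  have := loop_induction (x := 13) (b := size) (s := s)
    (c := (seq (seq (setReal 18 (.const 0) (.const 0) (.const 0))
      (loop 15 size (setReal 18 (.const 0) (.const 0)
        (.add (scalar 18) (.mul (coord 12 15) (.get 3 (ctr 13) (ctr 15)))))))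
      (cond (.realLe (.const 1) (coord 4 13))
        (cond (.realLe (.const 0) (scalar 18))
          (setInt 3 (ctr 13) (.add (ctr 10) (.const 1))) skip) skip)))
    (fun m st => ∀ x : Fin n, st.ints 3 x =
      if (x : ℕ) < m ∧ x ∈ U ∧ 0 ≤ ∑ w ∈ W, M x w then s.ints 10 0 + 1 else s.ints 3 x)
    (by simp) (fun m st k h => h) ?_
  · rw [hb] at this
    simpa [markProg] using this x
  intro m hm st hA hx hI x
  rw [hb] at hm
  have hst : SearchContext M h U st := hs.of_agrees hA (by simp [WritesInt])
    (by simp only [WritesReal, or_false]; omega)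
  have h12 : st.reals 12 = s.reals 12 := hA.2 12 (by simp [WritesReal])
  have h10 : st.ints 10 = s.ints 10 := hA.1 10 (by simp [WritesInt])
  rw [exec]
  set s1 := (seq (setReal 18 (.const 0) (.const 0) (.const 0))
      (loop 15 size (setReal 18 (.const 0) (.const 0)
        (.add (scalar 18) (.mul (coord 12 15) (.get 3 (ctr 13) (ctr 15))))))).exec st with hs1
  have c1 : SearchContext M h U s1 := hst.of_agrees (agrees_exec _ st) (by simp [WritesInt])
    (by simp only [WritesReal]; omega)
  have i1 : ∀ a, a ≠ 15 → s1.ints a = st.ints a := fun a ha =>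
    exec_ints_of_not_writesInt (by simp only [WritesInt, or_false, false_or]; omega) _
  have key : s1.reals 18 0 0 = ∑ w ∈ W, M ⟨m, hm⟩ w := by
    rw [hs1, exec, reals_loop_accum (i := 0) (j := 0) (n := n)
      (F := fun w => s.reals 12 0 w * st.reals 3 m w)]
    · rw [updCell_apply, exec_setReal_reals, updCell_apply]
      have e : ∀ w : Fin n, st.reals 3 m w = M ⟨m, hm⟩ w := fun w => by
        rw [← hst.matrix_eq]; rfl
      simp [IntExp.eval, RealExp.eval, Finset.sum_range, hW _, e]
    · exact hst.size_eq
    · intro k hk st' hA' hx'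
      have h13 : st'.ints 13 = st.ints 13 := hA'.1 13 (by simp [WritesInt])
      have h3' : st'.reals 3 = st.reals 3 := (hA'.2 3 (by simp [WritesReal])).trans
        (exec_reals_of_not_writesReal (by simp [WritesReal]) _)
      have h12' : st'.reals 12 = s.reals 12 := (hA'.2 12 (by simp [WritesReal])).trans
        ((exec_reals_of_not_writesReal (by simp [WritesReal]) _).trans h12)
      rw [exec_setReal_reals]
      simp [scalar, coord, ctr, IntExp.eval, RealExp.eval, h13, h3', h12', hx, hx']
  have hUm : (1 : ℝ) ≤ s1.reals 4 0 m ↔ (⟨m, hm⟩ : Fin n) ∈ U := by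
    have := c1.indicator ⟨m, hm⟩
    simp only at this
    rw [this]
    split_ifs with h <;> simp [h]
  have hI' : s1.ints 3 x = _ := (congrFun (i1 3 (by simp)) x).trans (hI x)
  have hcond : ∀ y, (cond (.realLe (.const 1) (coord 4 13)) (cond (.realLe (.const 0) (scalar 18))
      (setInt 3 (ctr 13) (.add (ctr 10) (.const 1))) skip) skip |>.exec s1).ints 3 y =
      if y = m ∧ (⟨m, hm⟩ : Fin n) ∈ U ∧ 0 ≤ ∑ w ∈ W, M ⟨m, hm⟩ w then s.ints 10 0 + 1
      else s1.ints 3 y := by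
    intro y
    simp only [exec, RamTest.Holds, RealExp.eval, coord, scalar, ctr, IntExp.eval,
      i1 13 (by simp), hx, Rat.cast_one, Rat.cast_zero, hUm, key]
    split_ifs with h1 h2 h3 <;>
      simp_all [RamState.setInt]
  rw [hcond, hI']
  rcases eq_or_ne (x : ℕ) m with hxm | hxm
  · obtain rfl : x = ⟨m, hm⟩ := Fin.ext hxm
    simp
  · have : (x : ℕ) < m + 1 ↔ (x : ℕ) < m := by omega
    simp [hxm, this]

theorem roundProg_spec (h0 : s.ints 0 0 = n)
    (h1 : (s.reals 1 0 0 - s.reals 1 0 1) / 2 = h) (h2 : block n (s.reals 2) = 1)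
    (h3 : block n (s.reals 3) = M) :
    ∃ W, IsDensestCandidate M h {x : Fin n | s.ints 3 x = 0} W ∧
      ∀ x : Fin n, (roundProg.exec s).ints 3 x =
        if s.ints 3 x = 0 ∧ 0 ≤ ∑ w ∈ W, M x w then s.ints 10 0 + 1 else s.ints 3 x := by
  simp only [roundProg, exec.eq_4]
  have l1 := unlabelledProg_spec h0
  have i1 : ∀ a, a ≠ 15 → (unlabelledProg.exec s).ints a = s.ints a := fun a ha =>
    exec_ints_of_not_writesInt (by simp only [unlabelledProg, WritesInt, or_false]; omega) _
  have r1 : ∀ a, a ≠ 4 → (unlabelledProg.exec s).reals a = s.reals a := fun a ha =>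
    exec_reals_of_not_writesReal (by simp only [unlabelledProg, WritesReal]; omega) _
  have c1 : SearchContext M h {x : Fin n | s.ints 3 x = 0} (unlabelledProg.exec s) :=
    ⟨by rw [i1 0 (by simp), h0], by rw [r1 1 (by simp), h1], by rw [r1 2 (by simp), h2],
      by rw [r1 3 (by simp), h3], l1⟩
  obtain ⟨c2, W, hW, hbest⟩ := searchProg_spec c1
  refine ⟨W, hbest, fun x => ?_⟩
  have i2 : ∀ a, a = 3 ∨ a = 10 →
      (searchProg.exec (unlabelledProg.exec s)).ints a = s.ints a := fun a ha =>
    (exec_ints_of_not_writesInt (by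
      simp only [searchProg, thresholdProg, shiftProg, signProg, tryProg,
        levelProg, scoreProg, keepProg, absSumProg, scaleProg, newtonProg, mulProg, overEntries,
        WritesInt, or_false, false_or]; omega) _).trans (i1 a (by omega))
  rw [markProg_spec c2 hW, i2 3 (by simp), i2 10 (by simp)]
  simp

/-- An invariant of the labelling that holds for the zero labelling, and is preserved when the
unlabelled indices with nonnegative row sums over a densest candidate get a new label, holds for
the output of the recovery program. -/
theorem recoveryProg_induction {n : ℕ} (A : Matrix (Fin n) (Fin n) ℝ) (p q : ℝ) {K : ℕ}
    (k : Fin K → ℕ) (I : ℕ → (Fin n → ℕ) → Prop) (h0 : I 0 fun _ => 0)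
    (hstep : ∀ r < n, ∀ lab : Fin n → ℕ, ∀ W : Finset (Fin n),
      IsDensestCandidate (centredMatrix A p q) ((p - q) / 2) {x | lab x = 0} W → I r lab →
      I (r + 1) fun x =>
        if lab x = 0 ∧ 0 ≤ ∑ w ∈ W, centredMatrix A p q x w then r + 1 else lab x) :
    I n (recoveryProg.label A p q k) := by
  set s := input A p q k with hs
  have n0 : s.ints 0 0 = n := by simp [hs, input]
  have p0 : s.reals 1 0 0 = p := by simp [hs, input]
  have q0 : s.reals 1 0 1 = q := by simp [hs, input]
  have A0 : block n (s.reals 0) = A := by ext i j; simp [hs, input, block]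
  have l1 := identityProg_spec n0 (by simp [hs, input])
  set s1 := identityProg.exec s with hs1
  have r1 : ∀ a, a ≠ 2 → s1.reals a = s.reals a := fun a ha =>
    exec_reals_of_not_writesReal (by simp only [identityProg, WritesReal]; omega) _
  have i1 : ∀ a, a ≠ 15 → s1.ints a = s.ints a := fun a ha =>
    exec_ints_of_not_writesInt (by simp only [identityProg, WritesInt, or_false]; omega) _
  have l2 := centreProg_spec (s := s1) (by rw [i1 0 (by simp), n0]) l1
  rw [r1 0 (by simp), r1 1 (by simp), A0, p0, q0] at l2
  set s2 := centreProg.exec s1 with hs2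
  have r2 : ∀ a, a ≠ 3 → s2.reals a = s1.reals a := fun a ha =>
    exec_reals_of_not_writesReal (by simp only [centreProg, overEntries, WritesReal]; omega) _
  have i2 : ∀ a, a < 15 → s2.ints a = s.ints a := fun a ha =>
    (exec_ints_of_not_writesInt (by simp only [centreProg, overEntries, WritesInt, or_false]; omega)
      _).trans (i1 a (by omega))
  have hb : size.eval s2 = n := by simp [size, IntExp.eval, i2 0 (by simp), n0]
  have := loop_induction (x := 10) (b := size) (c := roundProg) (s := s2)
    (fun m st => I m fun x => st.ints 3 x) ?_ (fun m st k h => h) ?_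
  · rw [hb] at this
    have e : recoveryProg.label A p q k =
        fun x : Fin n => ((loop 10 size roundProg).exec s2).ints 3 x := by
      ext x
      simp [label, recoveryProg, exec, hs2, hs1, hs]
    rwa [e]
  · have : (fun x : Fin n => s2.ints 3 x) = fun _ => 0 := by
      ext x
      rw [i2 3 (by simp)]
      simp [hs, input]
    rwa [this]
  intro m hm st hA hx hI
  rw [hb] at hm
  have hr : ∀ a, 1 ≤ a → a ≤ 3 → st.reals a = s2.reals a := fun a h1 h2 => hA.2 a (by
    simp only [roundProg, unlabelledProg, markProg, searchProg, thresholdProg, shiftProg, signProg,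
      tryProg, levelProg, scoreProg, keepProg, absSumProg, scaleProg, newtonProg, mulProg,
      overEntries, WritesReal, or_false, false_or]; omega)
  have hi : st.ints 0 = s2.ints 0 := hA.1 0 (by
    simp [roundProg, unlabelledProg, markProg, searchProg, thresholdProg, shiftProg, signProg,
      tryProg, levelProg, scoreProg, keepProg, absSumProg, scaleProg, newtonProg, mulProg,
      overEntries, WritesInt])
  obtain ⟨W, hW, hlab⟩ := roundProg_spec (s := st) (n := n) (h := (p - q) / 2)
    (M := centredMatrix A p q) (by rw [hi, i2 0 (by simp), n0])
    (by rw [hr 1 (by simp) (by simp), r2 1 (by simp), r1 1 (by simp), p0, q0])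
    (by rw [hr 2 (by simp) (by simp), r2 2 (by simp), l1]) (by rw [hr 3 (by simp) (by simp), l2])
  have := hstep m hm (fun x => st.ints 3 x) W hW hI
  convert this using 2 with x
  rw [hlab x, hx]

end RamProgram

/-! ### Spectral perturbation of block matrices -/

open Matrix in
/-- The spectral theorem for real symmetric matrices, in terms of the dot product. -/
theorem exists_eigenbasis {n : ℕ} {B : Matrix (Fin n) (Fin n) ℝ} (hB : B.IsSymm) :
    ∃ (v : Fin n → Fin n → ℝ) (l : Fin n → ℝ), (∀ i, B *ᵥ v i = l i • v i) ∧
      (∀ i, v i ⬝ᵥ v i = 1) ∧ ∀ x : Fin n → ℝ, ∑ i, (x ⬝ᵥ v i) ^ 2 = x ⬝ᵥ x := by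
  have hH : B.IsHermitian := by
    rw [Matrix.IsHermitian, Matrix.conjTranspose_eq_transpose_of_trivial]; exact hB
  have hin : ∀ x y : EuclideanSpace ℝ (Fin n), inner ℝ x y = (⇑y) ⬝ᵥ (⇑x) := fun x y => by
    simp [PiLp.inner_apply, dotProduct]
  refine ⟨fun i => ⇑(hH.eigenvectorBasis i), hH.eigenvalues, hH.mulVec_eigenvectorBasis, ?_, ?_⟩
  · intro i
    rw [← hin, real_inner_self_eq_norm_sq, hH.eigenvectorBasis.norm_eq_one, one_pow]
  · intro x
    have h := hH.eigenvectorBasis.sum_sq_norm_inner_right (WithLp.toLp 2 x)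
    rw [← real_inner_self_eq_norm_sq, hin] at h
    simpa [hin] using h

open Matrix in
theorem dotProduct_sq_le {n : ℕ} (x y : Fin n → ℝ) : (x ⬝ᵥ y) ^ 2 ≤ (x ⬝ᵥ x) * (y ⬝ᵥ y) := by
  simpa [dotProduct, sq] using Finset.sum_mul_sq_le_sq_mul_sq Finset.univ x y

open Matrix in
theorem dotProduct_self_nonneg_real {n : ℕ} (x : Fin n → ℝ) : 0 ≤ x ⬝ᵥ x :=
  Finset.sum_nonneg fun i _ => mul_self_nonneg (x i)

open Matrix in
theorem dotProduct_add_self_le {n : ℕ} (x y : Fin n → ℝ) :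
    (x + y) ⬝ᵥ (x + y) ≤ 2 * (x ⬝ᵥ x) + 2 * (y ⬝ᵥ y) := by
  simp only [dotProduct, Finset.mul_sum, ← Finset.sum_add_distrib, Pi.add_apply]
  refine Finset.sum_le_sum fun i _ => ?_
  nlinarith [sq_nonneg (x i - y i)]

/-- The sum of the coordinates of `x` in `C`. -/
def coordSum {n : ℕ} (C : Finset (Fin n)) (x : Fin n → ℝ) : ℝ := ∑ u ∈ C, x u

/-- The orthogonal projection onto the span of the indicators of the sets in `T`, if these are
pairwise disjoint and nonempty. -/
noncomputable def blockProj {n : ℕ} (T : Finset (Finset (Fin n))) : Matrix (Fin n) (Fin n) ℝ :=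
  Matrix.of fun u w => ∑ C ∈ T, if u ∈ C ∧ w ∈ C then (C.card : ℝ)⁻¹ else 0

/-- The squared length of the projection of `x` to the span of the indicators of the sets
in `T`. -/
noncomputable def blockMass {n : ℕ} (T : Finset (Finset (Fin n))) (x : Fin n → ℝ) : ℝ :=
  ∑ C ∈ T, coordSum C x ^ 2 / C.card

open Matrix in
/-- `B` is `d` times the block matrix with blocks of ones on the disjoint sets in `R`, plus a
symmetric matrix `F` of norm at most `τ`. The sets in `T ⊆ R` have at least `m` elements and the
other sets in `R` at most `l`. -/
structure IsBlockSignal {n : ℕ} (R T : Finset (Finset (Fin n))) (B F : Matrix (Fin n) (Fin n) ℝ)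
    (d m l τ : ℝ) : Prop where
  subset : T ⊆ R
  disjoint : (R : Set (Finset (Fin n))).PairwiseDisjoint id
  nonempty : ∀ C ∈ R, C.Nonempty
  le_card : ∀ C ∈ T, m ≤ C.card
  card_le : ∀ C ∈ R, C ∉ T → (C.card : ℝ) ≤ l
  pos : 0 < d
  nonneg : 0 ≤ l
  mulVec_eq : ∀ x u, (B *ᵥ x) u =
    d * (∑ C ∈ R, if u ∈ C then coordSum C x else 0) + (F *ᵥ x) u
  isSymm : F.IsSymm
  norm_le : ∀ x, (F *ᵥ x) ⬝ᵥ (F *ᵥ x) ≤ τ ^ 2 * (x ⬝ᵥ x)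

section Projection

open Matrix

variable {n : ℕ} {R T : Finset (Finset (Fin n))}

theorem blockProj_mulVec (x : Fin n → ℝ) (u : Fin n) :
    (blockProj T *ᵥ x) u = ∑ C ∈ T, if u ∈ C then coordSum C x / C.card else 0 := by
  simp only [mulVec, dotProduct, blockProj, of_apply, Finset.sum_mul]
  rw [Finset.sum_comm]
  refine Finset.sum_congr rfl fun C _ => ?_
  by_cases hu : u ∈ C
  · simp [hu, coordSum, div_eq_inv_mul, Finset.mul_sum]
  · simp [hu]

theorem dotProduct_sum_blocks (a : Finset (Fin n) → ℝ) (x : Fin n → ℝ) :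
    x ⬝ᵥ (fun u => ∑ C ∈ T, if u ∈ C then a C else 0) = ∑ C ∈ T, coordSum C x * a C := by
  simp only [dotProduct, Finset.mul_sum]
  rw [Finset.sum_comm]
  refine Finset.sum_congr rfl fun C _ => ?_
  simp [coordSum, Finset.sum_mul]

theorem coordSum_sum_blocks (hR : (R : Set (Finset (Fin n))).PairwiseDisjoint id) (hT : T ⊆ R)
    (a : Finset (Fin n) → ℝ) {C : Finset (Fin n)} (hC : C ∈ R) :
    coordSum C (fun u => ∑ D ∈ T, if u ∈ D then a D else 0) =
      if C ∈ T then C.card * a C else 0 := by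
  simp only [coordSum]
  rw [Finset.sum_comm]
  have : ∀ D ∈ T, (∑ u ∈ C, if u ∈ D then a D else 0) = if C = D then C.card * a C else 0 := by
    intro D hD
    split_ifs with h
    · subst h
      simp [Finset.sum_ite_mem]
    · have hCD : Disjoint C D := hR hC (hT hD) h
      rw [Finset.sum_ite_mem, Finset.disjoint_iff_inter_eq_empty.1 hCD]
      simp
  rw [Finset.sum_congr rfl this]
  simp

theorem blockMass_nonneg (x : Fin n → ℝ) : 0 ≤ blockMass T x :=
  Finset.sum_nonneg fun _ _ => by positivity

theorem dotProduct_blockProj (x : Fin n → ℝ) : x ⬝ᵥ (blockProj T *ᵥ x) = blockMass T x := by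
  rw [funext fun u => blockProj_mulVec (T := T) x u, dotProduct_sum_blocks, blockMass]
  exact Finset.sum_congr rfl fun C _ => by ring

variable (hR : (R : Set (Finset (Fin n))).PairwiseDisjoint id) (hne : ∀ C ∈ R, C.Nonempty)
  (hT : T ⊆ R)
include hR hne hT

theorem coordSum_blockProj (x : Fin n → ℝ) {C : Finset (Fin n)} (hC : C ∈ R) :
    coordSum C (blockProj T *ᵥ x) = if C ∈ T then coordSum C x else 0 := by
  rw [funext fun u => blockProj_mulVec (T := T) x u, coordSum_sum_blocks hR hT _ hC]
  have : (C.card : ℝ) ≠ 0 := by exact_mod_cast (Finset.card_pos.2 (hne C hC)).ne'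
  split_ifs
  · field_simp
  · rfl

theorem blockProj_dotProduct_self (x : Fin n → ℝ) :
    (blockProj T *ᵥ x) ⬝ᵥ (blockProj T *ᵥ x) = blockMass T x := by
  conv_lhs => rw [funext fun u => blockProj_mulVec (T := T) x u]
  rw [dotProduct_sum_blocks, blockMass]
  refine Finset.sum_congr rfl fun C hC => ?_
  rw [← funext fun u => blockProj_mulVec (T := T) x u,
    coordSum_blockProj hR hne hT x (hT hC), if_pos hC]
  ring

theorem sub_blockProj_dotProduct_self (x : Fin n → ℝ) :
    (x - blockProj T *ᵥ x) ⬝ᵥ (x - blockProj T *ᵥ x) = x ⬝ᵥ x - blockMass T x := by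
  rw [sub_dotProduct, dotProduct_sub, dotProduct_sub, blockProj_dotProduct_self hR hne hT,
    dotProduct_comm (_ *ᵥ _) x, dotProduct_blockProj]
  ring

end Projection

/-- If `a X ≤ w` and `w² ≤ X Y` then `a² X ≤ Y`. -/
theorem sq_mul_le_of_mul_le {a X Y w : ℝ} (ha : 0 ≤ a) (hX : 0 ≤ X) (hY : 0 ≤ Y)
    (h : a * X ≤ w) (hw : w ^ 2 ≤ X * Y) : a ^ 2 * X ≤ Y := by
  rcases hX.eq_or_lt with rfl | hX
  · simpa using hY
  · have : (a * X) ^ 2 ≤ w ^ 2 := pow_le_pow_left₀ (by positivity) h 2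
    have h3 : X * (a ^ 2 * X) ≤ X * Y := by nlinarith
    exact le_of_mul_le_mul_left h3 hX

namespace IsBlockSignal

open Matrix

variable {n : ℕ} {R T : Finset (Finset (Fin n))} {B F : Matrix (Fin n) (Fin n) ℝ} {d m l τ : ℝ}

theorem dotProduct_mulVec_eq (h : IsBlockSignal R T B F d m l τ) (x y : Fin n → ℝ) :
    y ⬝ᵥ (B *ᵥ x) = d * ∑ C ∈ R, coordSum C y * coordSum C x + y ⬝ᵥ (F *ᵥ x) := by
  have : B *ᵥ x = d • (fun u => ∑ C ∈ R, if u ∈ C then coordSum C x else 0) + F *ᵥ x := by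
    ext u
    simp [h.mulVec_eq]
  rw [this, dotProduct_add, dotProduct_smul, dotProduct_sum_blocks, smul_eq_mul]

theorem dotProduct_noise_sq_le (h : IsBlockSignal R T B F d m l τ) (x y : Fin n → ℝ) :
    (y ⬝ᵥ (F *ᵥ x)) ^ 2 ≤ (y ⬝ᵥ y) * (τ ^ 2 * (x ⬝ᵥ x)) :=
  (dotProduct_sq_le _ _).trans
    (mul_le_mul_of_nonneg_left (h.norm_le x) (dotProduct_self_nonneg_real y))

/-- An eigenvector with eigenvalue well above those of the small blocks is almost in the span of the
indicators of the large blocks. -/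
theorem sq_mul_sub_blockMass_le (h : IsBlockSignal R T B F d m l τ) {v : Fin n → ℝ} {μ : ℝ}
    (hv : B *ᵥ v = μ • v) (hv1 : v ⬝ᵥ v = 1) {g : ℝ} (hg : 0 ≤ g) (hμ : g ≤ μ - d * l) :
    g ^ 2 * (1 - blockMass T v) ≤ τ ^ 2 := by
  set z := v - blockProj T *ᵥ v with hz
  have hzz : z ⬝ᵥ z = 1 - blockMass T v := by
    rw [hz, sub_blockProj_dotProduct_self h.disjoint h.nonempty h.subset, hv1]
  have hzv : z ⬝ᵥ v = 1 - blockMass T v := by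
    rw [hz, sub_dotProduct, hv1, dotProduct_comm _ v,
      dotProduct_blockProj]
  have hcz : ∀ C ∈ R, coordSum C z = if C ∈ T then 0 else coordSum C v := by
    intro C hC
    have e : coordSum C z = coordSum C v - coordSum C (blockProj T *ᵥ v) := by
      simp [hz, coordSum, Finset.sum_sub_distrib]
    rw [e, coordSum_blockProj h.disjoint h.nonempty h.subset v hC]
    split_ifs <;> ring
  have key := h.dotProduct_mulVec_eq v z
  rw [hv, dotProduct_smul, hzv, smul_eq_mul] at key
  have hsum : ∑ C ∈ R, coordSum C z * coordSum C v ≤ l * (1 - blockMass T v) := by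
    have h1 : ∀ C ∈ R, coordSum C z * coordSum C v ≤ l * ∑ u ∈ C, z u ^ 2 := by
      intro C hC
      have hn : 0 ≤ ∑ u ∈ C, z u ^ 2 := Finset.sum_nonneg fun _ _ => sq_nonneg _
      rw [hcz C hC]
      split_ifs with hCT
      · rw [zero_mul]; exact mul_nonneg h.nonneg hn
      · have e : coordSum C v = coordSum C z := by rw [hcz C hC, if_neg hCT]
        rw [e, ← sq]
        refine sq_sum_le_card_mul_sum_sq.trans ?_
        exact mul_le_mul_of_nonneg_right (h.card_le C hC hCT) hn
    refine (Finset.sum_le_sum h1).trans ?_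
    have hu : ∑ C ∈ R, ∑ u ∈ C, z u ^ 2 = ∑ u ∈ R.biUnion id, z u ^ 2 :=
      (Finset.sum_biUnion (t := id) h.disjoint).symm
    rw [← Finset.mul_sum, ← hzz, hu]
    refine mul_le_mul_of_nonneg_left ?_ h.nonneg
    simp only [dotProduct, ← sq]
    exact Finset.sum_le_sum_of_subset_of_nonneg (Finset.subset_univ _) fun _ _ _ => sq_nonneg _
  have hZ : 0 ≤ 1 - blockMass T v := hzz ▸ dotProduct_self_nonneg_real z
  refine sq_mul_le_of_mul_le (w := z ⬝ᵥ (F *ᵥ v)) hg hZ (sq_nonneg τ) ?_ ?_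
  · have := mul_le_mul_of_nonneg_left hsum h.pos.le
    have := mul_le_mul_of_nonneg_right hμ hZ
    nlinarith
  · simpa [hzz, hv1] using h.dotProduct_noise_sq_le v z

/-- An eigenvector with eigenvalue well below those of the large blocks is almost orthogonal to
the indicators of the large blocks. -/
theorem sq_mul_blockMass_le (h : IsBlockSignal R T B F d m l τ) {v : Fin n → ℝ} {μ : ℝ}
    (hv : B *ᵥ v = μ • v) (hv1 : v ⬝ᵥ v = 1) {g : ℝ} (hg : 0 ≤ g) (hμ : g ≤ d * m - μ) :
    g ^ 2 * blockMass T v ≤ τ ^ 2 := by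
  set y := blockProj T *ᵥ v with hy
  have hyy : y ⬝ᵥ y = blockMass T v :=
    blockProj_dotProduct_self h.disjoint h.nonempty h.subset v
  have hyv : y ⬝ᵥ v = blockMass T v := by
    rw [dotProduct_comm, hy, dotProduct_blockProj]
  have key := h.dotProduct_mulVec_eq v y
  rw [hv, dotProduct_smul, hyv, smul_eq_mul] at key
  have hsum : m * blockMass T v ≤ ∑ C ∈ R, coordSum C y * coordSum C v := by
    have e : ∑ C ∈ R, coordSum C y * coordSum C v = ∑ C ∈ T, coordSum C v ^ 2 := by
      rw [← Finset.sum_subset h.subset]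
      · refine Finset.sum_congr rfl fun C hC => ?_
        rw [hy, coordSum_blockProj h.disjoint h.nonempty h.subset v (h.subset hC), if_pos hC, sq]
      · intro C hC hCT
        rw [hy, coordSum_blockProj h.disjoint h.nonempty h.subset v hC, if_neg hCT, zero_mul]
    rw [e, blockMass, Finset.mul_sum]
    refine Finset.sum_le_sum fun C hC => ?_
    have hc : (0 : ℝ) < C.card := by
      exact_mod_cast Finset.card_pos.2 (h.nonempty C (h.subset hC))
    rw [mul_div_assoc', div_le_iff₀ hc, mul_comm]
    exact mul_le_mul_of_nonneg_left (h.le_card C hC) (sq_nonneg _)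
  have hY : 0 ≤ blockMass T v := blockMass_nonneg v
  refine sq_mul_le_of_mul_le (w := -(y ⬝ᵥ (F *ᵥ v))) hg hY (sq_nonneg τ) ?_ ?_
  · have := mul_le_mul_of_nonneg_left hsum h.pos.le
    have := mul_le_mul_of_nonneg_right hμ hY
    nlinarith
  · simpa [hyy, hv1] using h.dotProduct_noise_sq_le v y

/-- There are no eigenvalues near the middle of the gap between small and large blocks. -/
theorem abs_eigenvalue_sub_ge (h : IsBlockSignal R T B F d m l τ) {v : Fin n → ℝ} {μ : ℝ}
    (hv : B *ᵥ v = μ • v) (hv1 : v ⬝ᵥ v = 1) {g t : ℝ} (hg : 0 < g) (hl : t - d * l = g)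
    (hm : d * m - t = g) (hτ : 16 * τ ^ 2 ≤ g ^ 2) : g / 2 ≤ |μ - t| := by
  by_contra! hlt
  obtain ⟨h1, h2⟩ := abs_lt.1 hlt
  have e1 := h.sq_mul_sub_blockMass_le hv hv1 (g := g / 2) (by positivity) (by linarith)
  have e2 := h.sq_mul_blockMass_le hv hv1 (g := g / 2) (by positivity) (by linarith)
  nlinarith [pow_pos hg 2]

theorem sum_blockMass (h : IsBlockSignal R T B F d m l τ) {v : Fin n → Fin n → ℝ}
    (hv : ∀ x : Fin n → ℝ, ∑ i, (x ⬝ᵥ v i) ^ 2 = x ⬝ᵥ x) :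
    ∑ i, blockMass T (v i) = T.card := by
  simp only [blockMass]
  rw [Finset.sum_comm, Finset.cast_card]
  refine Finset.sum_congr rfl fun C hC => ?_
  have hc : (C.card : ℝ) ≠ 0 := by
    exact_mod_cast (Finset.card_pos.2 (h.nonempty C (h.subset hC))).ne'
  have := hv fun u => if u ∈ C then 1 else 0
  simp only [dotProduct, ite_mul, one_mul, zero_mul, Finset.sum_ite_mem, Finset.univ_inter] at this
  rw [← Finset.sum_div]
  simp only [coordSum, this]
  simp [hc]

/-- The eigenvectors with eigenvalues below the threshold have little mass in the span of the
indicators of the large blocks. -/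
theorem sum_blockMass_le (h : IsBlockSignal R T B F d m l τ) {v : Fin n → Fin n → ℝ}
    {μ : Fin n → ℝ} (hB : ∀ i, B *ᵥ v i = μ i • v i)
    (hv : ∀ x : Fin n → ℝ, ∑ i, (x ⬝ᵥ v i) ^ 2 = x ⬝ᵥ x) {g t : ℝ} (hg : 0 < g)
    (hm : d * m - t = g) :
    ∑ i with ¬ t < μ i, blockMass T (v i) ≤ T.card * (τ ^ 2 / g ^ 2) := by
  simp only [blockMass]
  rw [Finset.sum_comm, ← nsmul_eq_mul]
  refine Finset.sum_le_card_nsmul _ _ _ fun C hC => ?_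
  have hc : (0 : ℝ) < C.card := by
    exact_mod_cast Finset.card_pos.2 (h.nonempty C (h.subset hC))
  set x : Fin n → ℝ := fun u => if u ∈ C then 1 else 0 with hx
  have hxs : ∀ w, x ⬝ᵥ w = coordSum C w := by
    intro w
    simp [hx, dotProduct, coordSum]
  have hxx : x ⬝ᵥ x = C.card := by rw [hxs]; simp [hx, coordSum]
  have hDx : ∀ D ∈ R, coordSum D x = if C = D then (C.card : ℝ) else 0 := by
    intro D hD
    split_ifs with hCD
    · subst hCD; rw [← hxs, hxx]
    · have : Disjoint C D := h.disjoint (h.subset hC) hD hCD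
      simp only [coordSum, hx, Finset.sum_ite_mem]
      rw [Finset.inter_comm, Finset.disjoint_iff_inter_eq_empty.1 this]
      simp
  have key : ∀ i, ¬ t < μ i → g ^ 2 * coordSum C (v i) ^ 2 ≤ ((F *ᵥ x) ⬝ᵥ v i) ^ 2 := by
    intro i hi
    have e := h.dotProduct_mulVec_eq (v i) x
    have e2 : x ⬝ᵥ (F *ᵥ v i) = (F *ᵥ x) ⬝ᵥ v i := by
      rw [dotProduct_mulVec, ← mulVec_transpose, h.isSymm.eq]
    have e3 : ∑ D ∈ R, coordSum D x * coordSum D (v i) = C.card * coordSum C (v i) := by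
      rw [Finset.sum_eq_single C]
      · rw [hDx C (h.subset hC), if_pos rfl]
      · intro D hD hDC
        rw [hDx D hD, if_neg (Ne.symm hDC), zero_mul]
      · exact fun hh => absurd (h.subset hC) hh
    rw [hB i, dotProduct_smul, hxs, smul_eq_mul, e2, e3] at e
    have e4 : (F *ᵥ x) ⬝ᵥ v i = -((d * C.card - μ i) * coordSum C (v i)) := by linarith
    rw [e4, neg_sq, mul_pow]
    refine mul_le_mul_of_nonneg_right (pow_le_pow_left₀ hg.le ?_ 2) (sq_nonneg _)
    have := mul_le_mul_of_nonneg_left (h.le_card C hC) h.pos.le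
    linarith [not_lt.1 hi]
  have total : g ^ 2 * ∑ i with ¬ t < μ i, coordSum C (v i) ^ 2 ≤ τ ^ 2 * C.card := by
    rw [Finset.mul_sum]
    calc ∑ i with ¬ t < μ i, g ^ 2 * coordSum C (v i) ^ 2
        ≤ ∑ i with ¬ t < μ i, ((F *ᵥ x) ⬝ᵥ v i) ^ 2 :=
          Finset.sum_le_sum fun i hi => key i (Finset.mem_filter.1 hi).2
      _ ≤ ∑ i, ((F *ᵥ x) ⬝ᵥ v i) ^ 2 :=
          Finset.sum_le_sum_of_subset_of_nonneg (Finset.filter_subset _ _)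
            fun _ _ _ => sq_nonneg _
      _ ≤ τ ^ 2 * C.card := by rw [hv, ← hxx]; exact h.norm_le x
  rw [← Finset.sum_div, div_le_div_iff₀ hc (by positivity)]
  linarith

/-- A matrix with the eigenvectors of `B` whose eigenvalues are within `ξ` of the indicator of those
above the threshold is close to the projection onto the span of the indicators of the large
blocks. -/
theorem sum_sq_sub_blockProj_le (h : IsBlockSignal R T B F d m l τ) {v : Fin n → Fin n → ℝ}
    {μ f : Fin n → ℝ} (hB : ∀ i, B *ᵥ v i = μ i • v i) (hv1 : ∀ i, v i ⬝ᵥ v i = 1)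
    (hv : ∀ x : Fin n → ℝ, ∑ i, (x ⬝ᵥ v i) ^ 2 = x ⬝ᵥ x) {g t ξ : ℝ} (hg : 0 < g)
    (hl : t - d * l = g) (hm : d * m - t = g) (hτ : 16 * τ ^ 2 ≤ g ^ 2)
    {X : Matrix (Fin n) (Fin n) ℝ} (hX : ∀ i, X *ᵥ v i = f i • v i)
    (hf : ∀ i, |f i - if t < μ i then 1 else 0| ≤ ξ) :
    ∑ u, ∑ w, (X u w - blockProj T u w) ^ 2 ≤ 2 * n * ξ ^ 2 + 6 * (T.card * (τ ^ 2 / g ^ 2)) := by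
  set P := blockProj T with hP
  have hg2 : 0 < g ^ 2 := by positivity
  have frob : ∑ u, ∑ w, (X u w - P u w) ^ 2 = ∑ i, ((X - P) *ᵥ v i) ⬝ᵥ ((X - P) *ᵥ v i) := by
    have : ∀ u, ∑ w, (X u w - P u w) ^ 2 = ∑ i, ((X - P) *ᵥ v i) u ^ 2 := by
      intro u
      have := hv ((X - P) u)
      simp only [mulVec]
      rw [this]
      simp [dotProduct, sq]
    rw [Finset.sum_congr rfl fun u _ => this u, Finset.sum_comm]
    simp [dotProduct, sq]
  have hsmul : ∀ (c : ℝ) i, |c| ≤ ξ → (c • v i) ⬝ᵥ (c • v i) ≤ ξ ^ 2 := by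
    intro c i hc
    rw [smul_dotProduct, dotProduct_smul, hv1]
    simp only [smul_eq_mul, mul_one]
    rw [← sq, ← sq_abs]
    exact pow_le_pow_left₀ (abs_nonneg c) hc 2
  have term : ∀ i, ((X - P) *ᵥ v i) ⬝ᵥ ((X - P) *ᵥ v i) ≤ 2 * ξ ^ 2 +
      2 * (if t < μ i then 1 - blockMass T (v i) else blockMass T (v i)) := by
    intro i
    have hfi := hf i
    rw [sub_mulVec, hX]
    split_ifs at hfi ⊢ with hi
    · have e : f i • v i - P *ᵥ v i = (f i - 1) • v i + (v i - P *ᵥ v i) := by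
        rw [sub_smul, one_smul]; abel
      have := sub_blockProj_dotProduct_self h.disjoint h.nonempty h.subset (v i)
      rw [hv1] at this
      rw [e, ← this]
      refine (dotProduct_add_self_le _ _).trans ?_
      have := hsmul _ i hfi
      linarith
    · rw [sub_zero] at hfi
      have e : f i • v i - P *ᵥ v i = f i • v i + (-(P *ᵥ v i)) := sub_eq_add_neg _ _
      rw [e, ← blockProj_dotProduct_self h.disjoint h.nonempty h.subset (v i)]
      refine (dotProduct_add_self_le _ _).trans ?_
      have := hsmul _ i hfi
      rw [neg_dotProduct, dotProduct_neg, neg_neg]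
      linarith
  have hdef : ∀ i, t < μ i → 1 - blockMass T (v i) ≤ τ ^ 2 / g ^ 2 := by
    intro i hi
    have := h.sq_mul_sub_blockMass_le (hB i) (hv1 i) hg.le (by linarith)
    rw [le_div_iff₀ hg2]
    linarith
  have hη : τ ^ 2 / g ^ 2 ≤ 1 / 2 := by
    rw [div_le_div_iff₀ hg2 two_pos]
    nlinarith [sq_nonneg τ]
  have hη0 : 0 ≤ τ ^ 2 / g ^ 2 := by positivity
  -- the number of eigenvalues above the threshold is at most `2 |T|`
  have hcard : (({i | t < μ i} : Finset (Fin n)).card : ℝ) * (1 / 2) ≤ T.card := by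
    rw [← h.sum_blockMass hv, ← nsmul_eq_mul]
    refine le_trans (Finset.card_nsmul_le_sum _ _ _ fun i hi => ?_)
      (Finset.sum_le_sum_of_subset_of_nonneg (Finset.filter_subset _ _)
        fun i _ _ => blockMass_nonneg (T := T) (v i))
    have := hdef i (Finset.mem_filter.1 hi).2
    linarith
  have htop : ∑ i with t < μ i, (1 - blockMass T (v i)) ≤ 2 * T.card * (τ ^ 2 / g ^ 2) := by
    refine (Finset.sum_le_card_nsmul _ _ _ fun i hi => hdef i (Finset.mem_filter.1 hi).2).trans ?_
    rw [nsmul_eq_mul]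
    exact mul_le_mul_of_nonneg_right (by linarith) hη0
  have hbot := h.sum_blockMass_le hB hv hg hm
  rw [frob]
  refine (Finset.sum_le_sum fun i _ => term i).trans ?_
  rw [Finset.sum_add_distrib, ← Finset.mul_sum, ← Finset.mul_sum, Finset.sum_ite]
  simp only [Finset.sum_const, Finset.card_univ, Fintype.card_fin, nsmul_eq_mul]
  nlinarith

end IsBlockSignal

/-! ### The Newton-Schulz iteration -/

/-- One step of the Newton-Schulz iteration for the sign of a number. -/
noncomputable def newtonSchulzStep (s : ℝ) : ℝ := (1 / 2) * (3 * s - s * (s * s))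

theorem newtonSchulzStep_neg (s : ℝ) : newtonSchulzStep (-s) = -newtonSchulzStep s := by
  unfold newtonSchulzStep; ring

theorem newtonSchulzStep_iterate_neg (k : ℕ) (s : ℝ) :
    newtonSchulzStep^[k] (-s) = -newtonSchulzStep^[k] s := by
  induction k generalizing s with
  | zero => rfl
  | succ k ih => rw [Function.iterate_succ_apply, newtonSchulzStep_neg, ih,
      ← Function.iterate_succ_apply]

/-- Small numbers grow by a constant factor in each step. -/
theorem le_newtonSchulzStep_iterate (k : ℕ) {s : ℝ} (h0 : 0 < s) (h1 : s ≤ 1) :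
    0 < newtonSchulzStep^[k] s ∧ newtonSchulzStep^[k] s ≤ 1 ∧
      min (1 / 2) ((11 / 8) ^ k * s) ≤ newtonSchulzStep^[k] s := by
  induction k with
  | zero => exact ⟨h0, h1, by simp⟩
  | succ k ih =>
    rw [Function.iterate_succ_apply']
    obtain ⟨i0, i1, i2⟩ := ih
    set x := newtonSchulzStep^[k] s
    have hx2 : x * x ≤ 1 := by nlinarith
    have hge : x ≤ newtonSchulzStep x := by unfold newtonSchulzStep; nlinarith
    refine ⟨i0.trans_le hge, ?_, ?_⟩
    · unfold newtonSchulzStep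
      nlinarith [mul_nonneg (sq_nonneg (1 - x)) (by linarith : 0 ≤ 2 + x)]
    · rcases le_or_gt (1 / 2) x with h | h
      · exact (min_le_left _ _).trans (h.trans hge)
      · have i3 : (11 / 8) ^ k * s ≤ x := by
          rcases min_le_iff.1 i2 with h' | h'
          · linarith
          · exact h'
        refine (min_le_right _ _).trans ?_
        have : 11 / 8 * x ≤ newtonSchulzStep x := by
          unfold newtonSchulzStep
          nlinarith [mul_pos i0 (by linarith : 0 < 1 / 2 - x)]
        rw [pow_succ]
        linarith

/-- Numbers close to `1` converge to `1`. -/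
theorem one_sub_newtonSchulzStep_iterate_le (k : ℕ) {s : ℝ} (h0 : 1 / 2 ≤ s) (h1 : s ≤ 1) :
    1 - newtonSchulzStep^[k] s ≤ (3 / 4) ^ k := by
  induction k with
  | zero => simp; linarith
  | succ k ih =>
    obtain ⟨i0, i1, i2⟩ := le_newtonSchulzStep_iterate k (by linarith : 0 < s) h1
    have i3 : 1 / 2 ≤ newtonSchulzStep^[k] s := by
      refine le_trans (le_min le_rfl ?_) i2
      have : (1 : ℝ) ≤ (11 / 8) ^ k := one_le_pow₀ (by norm_num)
      nlinarith
    rw [Function.iterate_succ_apply']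
    set x := newtonSchulzStep^[k] s
    have : 1 - newtonSchulzStep x ≤ 3 / 4 * (1 - x) := by
      unfold newtonSchulzStep
      nlinarith [mul_nonneg (sub_nonneg.2 i1) (sub_nonneg.2 i3)]
    rw [pow_succ]
    linarith

section

open Matrix

variable {n : ℕ} {v : Fin n → ℝ} {X Y : Matrix (Fin n) (Fin n) ℝ}

theorem newtonSchulz_mulVec {s : ℝ} (h : X *ᵥ v = s • v) :
    X.newtonSchulz *ᵥ v = newtonSchulzStep s • v := by
  simp only [Matrix.newtonSchulz, smul_mulVec, sub_mulVec, ← mulVec_mulVec, h, mulVec_smul,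
    smul_smul, ← sub_smul, newtonSchulzStep, mul_assoc]

theorem newtonSchulz_iterate_mulVec (k : ℕ) {s : ℝ} (h : X *ᵥ v = s • v) :
    Matrix.newtonSchulz^[k] X *ᵥ v = newtonSchulzStep^[k] s • v := by
  induction k with
  | zero => exact h
  | succ k ih =>
    rw [Function.iterate_succ_apply', Function.iterate_succ_apply', newtonSchulz_mulVec ih]

/-- Eigenvalues are at most the sum of the absolute values of the entries. -/
theorem abs_le_absSum {y : ℝ} (h : Y *ᵥ v = y • v) (hv : v ⬝ᵥ v = 1) : |y| ≤ Y.absSum := by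
  have hle : ∀ i, |v i| ≤ 1 := by
    intro i
    rw [← sq_le_one_iff_abs_le_one, ← hv, sq]
    exact Finset.single_le_sum (f := fun i => v i * v i) (fun i _ => mul_self_nonneg _)
      (Finset.mem_univ i)
  have e : y = v ⬝ᵥ (Y *ᵥ v) := by rw [h, dotProduct_smul, hv, smul_eq_mul, mul_one]
  rw [e, Matrix.absSum]
  simp only [dotProduct, mulVec, Finset.mul_sum]
  refine (Finset.abs_sum_le_sum_abs _ _).trans (Finset.sum_le_sum fun i _ => ?_)
  refine (Finset.abs_sum_le_sum_abs _ _).trans (Finset.sum_le_sum fun j _ => ?_)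
  rw [abs_mul, abs_mul]
  have := mul_le_mul (hle i) (mul_le_mul_of_nonneg_left (hle j) (abs_nonneg (Y i j)))
    (by positivity) zero_le_one
  simpa using this

/-- The approximate sign has the eigenvectors of the matrix, and its eigenvalues are close to the
signs of those of the matrix, if the latter are not too small. -/
theorem approxSign_mulVec {y g : ℝ} (hY : Y *ᵥ v = y • v) (hv : v ⬝ᵥ v = 1) (hg : 0 < g)
    (hgy : g ≤ |y|) (hR : Y.absSum ≤ 2 * g * (11 / 8) ^ n) :
    ∃ f : ℝ, Y.approxSign *ᵥ v = f • v ∧ |f - if 0 < y then 1 else -1| ≤ (3 / 4) ^ n := by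
  have hy : |y| ≤ Y.absSum := abs_le_absSum hY hv
  have hR0 : 0 < Y.absSum := hg.trans_le (hgy.trans hy)
  set s := Y.absSum⁻¹ * |y| with hs
  have hs0 : 0 < s := mul_pos (inv_pos.2 hR0) (hg.trans_le hgy)
  have hs1 : s ≤ 1 := by rw [hs, inv_mul_le_iff₀ hR0]; linarith
  have hlow : 1 / 2 ≤ (11 / 8) ^ n * s := by
    rw [hs, ← div_eq_inv_mul, mul_div_assoc', div_le_div_iff₀ two_pos hR0]
    have : (0 : ℝ) < (11 / 8) ^ n := by positivity
    nlinarith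
  obtain ⟨a0, a1, a2⟩ := le_newtonSchulzStep_iterate n hs0 hs1
  rw [min_eq_left hlow] at a2
  have b := one_sub_newtonSchulzStep_iterate_le n a2 a1
  rw [← Function.iterate_add_apply] at b
  have b1 := (le_newtonSchulzStep_iterate (n + n) hs0 hs1).2.1
  have hYs : (Y.absSum⁻¹ • Y) *ᵥ v = (Y.absSum⁻¹ * y) • v := by
    rw [smul_mulVec, hY, smul_smul]
  refine ⟨_, newtonSchulz_iterate_mulVec (n + n) hYs, ?_⟩
  split_ifs with hpos
  · rw [abs_of_pos hpos] at hs
    rw [← hs, abs_sub_comm, abs_of_nonneg (by linarith)]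
    exact b
  · have hneg : y < 0 := lt_of_le_of_ne (not_lt.1 hpos) (by
      rintro rfl; simp at hgy; linarith)
    have : Y.absSum⁻¹ * y = -s := by rw [hs, abs_of_neg hneg]; ring
    rw [this, newtonSchulzStep_iterate_neg, abs_le]
    constructor <;> linarith

end

/-! ### Typical matrices and the signal -/

/-- The deviation of the off-diagonal entries from their means. -/
noncomputable def noiseMatrix {n : ℕ} (P : Finpartition (Finset.univ : Finset (Fin n)))
    (A : Matrix (Fin n) (Fin n) ℝ) (p q : ℝ) : Matrix (Fin n) (Fin n) ℝ :=
  open Classical in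
  Matrix.of fun u w => if u = w then 0 else A u w - if SameCluster P u w then p else q

open Matrix in
/-- The properties of the random matrix on which the recovery is based: the noise has norm at most
`τ` and entries of size at most `κ`, and its row sums over clusters are small compared to the signal
`p - q`. -/
structure IsTypical {n : ℕ} (P : Finpartition (Finset.univ : Finset (Fin n)))
    (A : Matrix (Fin n) (Fin n) ℝ) (p q κ τ : ℝ) : Prop where
  isSymm : A.IsSymm
  norm_le : ∀ x, (noiseMatrix P A p q *ᵥ x) ⬝ᵥ (noiseMatrix P A p q *ᵥ x) ≤ τ ^ 2 * (x ⬝ᵥ x)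
  abs_le : ∀ u w, |noiseMatrix P A p q u w| ≤ κ
  abs_sum_le : ∀ u, ∀ C ∈ P.parts,
    |∑ w ∈ C, noiseMatrix P A p q u w| ≤ (p - q) / 16 * C.card

/-- `T` consists of the large sets in `R`: these have at least `m` elements, the other sets in `R` at
most `m - D`, and all sets in `R` at most `(1 + ε) m`. -/
structure IsTopLevel {n : ℕ} (R T : Finset (Finset (Fin n))) (m D : ℕ) (ε : ℝ) : Prop where
  subset : T ⊆ R
  nonempty : T.Nonempty
  le_card : ∀ C ∈ T, m ≤ C.card
  card_le : ∀ C ∈ R, (C.card : ℝ) ≤ (1 + ε) * m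
  card_add_le : ∀ C ∈ R, C ∉ T → C.card + D ≤ m
  one_le : 1 ≤ D
  le : D ≤ m

/-- The relations between the size of the matrix `n`, the signal `d = p - q`, the entry bound `κ`,
the norm bound `τ`, the separation `D` and the tolerance `ε` that the recovery needs. -/
structure AreAdmissible (n : ℕ) (d κ τ ε : ℝ) (D : ℕ) : Prop where
  signal_pos : 0 < d
  tau_nonneg : 0 ≤ τ
  gap : 16 * τ ^ 2 ≤ (d * D / 2) ^ 2
  column : 4 * (2 * n * ((3 / 4) ^ n) ^ 2 + 6 * (τ ^ 2 / (d * D / 2) ^ 2)) * (d / 2 + κ) ≤ d / 200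
  noise : τ * (d / 2 + κ) ≤ d ^ 2 * D / 100
  tolerance : ε * (d / 2 + κ) ≤ d / 16
  scale : n ^ 2 * (d + κ + d * n) ≤ d * D / 2 * (11 / 8) ^ n

section

open Matrix

variable {n : ℕ} {P : Finpartition (Finset.univ : Finset (Fin n))}
  {A : Matrix (Fin n) (Fin n) ℝ} {p q κ τ ε : ℝ} {R T : Finset (Finset (Fin n))} {m D : ℕ}

theorem sameCluster_comm {u w : Fin n} : SameCluster P u w ↔ SameCluster P w u := by
  simp only [SameCluster, and_comm]

theorem sameCluster_iff_mem {C : Finset (Fin n)} (hC : C ∈ P.parts) {u w : Fin n} (hu : u ∈ C) :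
    SameCluster P u w ↔ w ∈ C := by
  constructor
  · rintro ⟨C', hC', hu', hw'⟩
    rwa [P.eq_of_mem_parts hC hC' hu hu']
  · exact fun hw => ⟨C, hC, hu, hw⟩

theorem isSymm_noiseMatrix (hA : A.IsSymm) : (noiseMatrix P A p q).IsSymm := by
  ext u w
  simp only [transpose_apply, noiseMatrix, of_apply, hA.apply, eq_comm (a := w)]
  rw [show SameCluster P w u = SameCluster P u w from propext sameCluster_comm]

open Classical in
theorem centredMatrix_eq (u w : Fin n) : centredMatrix A p q u w =
    (p - q) / 2 * (if SameCluster P u w then 1 else -1) + noiseMatrix P A p q u w := by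
  simp only [centredMatrix, noiseMatrix, of_apply]
  by_cases h : u = w
  · subst h
    have : SameCluster P u u := ⟨P.part u, P.part_mem.2 (Finset.mem_univ _),
      P.mem_part (Finset.mem_univ _), P.mem_part (Finset.mem_univ _)⟩
    simp [this]
  · simp only [h, if_false]
    split_ifs <;> ring

theorem sum_parts_ite (hRP : R ⊆ P.parts) {C : Finset (Fin n)} (hC : C ∈ R) {u : Fin n}
    (hu : u ∈ C) (f : Finset (Fin n) → ℝ) : (∑ D ∈ R, if u ∈ D then f D else 0) = f C := by
  rw [Finset.sum_eq_single C]
  · simp [hu]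
  · intro D hD hDC
    rw [if_neg]
    exact fun huD => hDC (P.eq_of_mem_parts (hRP hD) (hRP hC) huD hu)
  · exact fun h => absurd hC h

open Classical in
theorem sum_parts_ite_and (hRP : R ⊆ P.parts) {u w : Fin n} (hu : u ∈ R.biUnion id) :
    (∑ C ∈ R, if u ∈ C ∧ w ∈ C then (1 : ℝ) else 0) = if SameCluster P u w then 1 else 0 := by
  obtain ⟨C, hC, hu⟩ := Finset.mem_biUnion.1 hu
  have := sum_parts_ite hRP hC hu fun D => if w ∈ D then (1 : ℝ) else 0
  simp only [← ite_and] at this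
  rw [this]
  simp only [sameCluster_iff_mem (hRP hC) hu]

theorem abs_centredMatrix_le (h : IsTypical P A p q κ τ) (hd : 0 < p - q) (u w : Fin n) :
    |centredMatrix A p q u w| ≤ (p - q) / 2 + κ := by
  classical
  rw [centredMatrix_eq (P := P)]
  refine (abs_add_le _ _).trans (add_le_add ?_ (h.abs_le u w))
  split_ifs <;> simp [abs_of_pos (half_pos hd)]

theorem kappa_nonneg (h : IsTypical P A p q κ τ) (u : Fin n) : 0 ≤ κ :=
  (abs_nonneg _).trans (h.abs_le u u)

/-- The signal matrix restricted to a union of clusters is a block matrix plus noise. -/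
theorem isBlockSignal_restrictedSignal (h : IsTypical P A p q κ τ) (hd : 0 < p - q)
    (hRP : R ⊆ P.parts) (hT : IsTopLevel R T m D ε) :
    IsBlockSignal R T (restrictedSignal (centredMatrix A p q) ((p - q) / 2) (R.biUnion id))
      (Matrix.of fun u w => (if u ∈ R.biUnion id then 1 else 0) *
        (if w ∈ R.biUnion id then 1 else 0) * noiseMatrix P A p q u w)
      (p - q) m (m - D : ℕ) τ where
  subset := hT.subset
  disjoint := P.disjoint.subset hRP
  nonempty C hC := P.nonempty_of_mem_parts (hRP hC)
  le_card C hC := by exact_mod_cast hT.le_card C hC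
  card_le C hC hCT := by
    have := hT.card_add_le C hC hCT
    exact_mod_cast (by omega : C.card ≤ m - D)
  pos := hd
  nonneg := Nat.cast_nonneg _
  mulVec_eq x u := by
    classical
    have e : (∑ C ∈ R, if u ∈ C then coordSum C x else 0) =
        ∑ w, (∑ C ∈ R, if u ∈ C ∧ w ∈ C then (1 : ℝ) else 0) * x w := by
      simp only [Finset.sum_mul]
      rw [Finset.sum_comm]
      refine Finset.sum_congr rfl fun C _ => ?_
      by_cases hu : u ∈ C
      · simp [hu, coordSum]
      · simp [hu]
    rw [e]
    simp only [mulVec, dotProduct, Finset.mul_sum, ← Finset.sum_add_distrib]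
    refine Finset.sum_congr rfl fun w _ => ?_
    simp only [restrictedSignal, of_apply]
    by_cases hu : u ∈ R.biUnion id
    · rw [sum_parts_ite_and hRP hu]
      by_cases hw : w ∈ R.biUnion id
      · rw [centredMatrix_eq (P := P)]
        simp only [hu, hw, if_true]
        split_ifs <;> ring
      · have : ¬ SameCluster P u w := by
          obtain ⟨C, hC, hu⟩ := Finset.mem_biUnion.1 hu
          rw [sameCluster_iff_mem (hRP hC) hu]
          exact fun hw' => hw (Finset.mem_biUnion.2 ⟨C, hC, hw'⟩)
        simp only [hw, this, if_false]
        ring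
    · have : ∀ C ∈ R, ¬ (u ∈ C ∧ w ∈ C) := fun C hC hh =>
        hu (Finset.mem_biUnion.2 ⟨C, hC, hh.1⟩)
      rw [Finset.sum_congr rfl fun C hC => if_neg (this C hC)]
      simp only [hu, if_false, Finset.sum_const_zero]
      ring
  isSymm := by
    ext u w
    simp only [transpose_apply, of_apply, (isSymm_noiseMatrix h.isSymm).apply]
    ring
  norm_le x := by
    set U := R.biUnion id
    set E := noiseMatrix P A p q
    have e : ∀ u, ((Matrix.of fun u w => (if u ∈ U then 1 else 0) * (if w ∈ U then 1 else 0) *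
        E u w) *ᵥ x) u = (if u ∈ U then 1 else 0) * (E *ᵥ fun w => if w ∈ U then x w else 0) u := by
      intro u
      simp only [mulVec, dotProduct, of_apply, Finset.mul_sum]
      refine Finset.sum_congr rfl fun w _ => ?_
      split_ifs <;> ring
    calc _ ≤ (E *ᵥ fun w => if w ∈ U then x w else 0) ⬝ᵥ
          (E *ᵥ fun w => if w ∈ U then x w else 0) := by
          refine Finset.sum_le_sum fun u _ => ?_
          rw [e]
          split_ifs
          · simp
          · simpa using mul_self_nonneg _
      _ ≤ τ ^ 2 * ((fun w => if w ∈ U then x w else 0) ⬝ᵥ fun w => if w ∈ U then x w else 0) :=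
          h.norm_le _
      _ ≤ τ ^ 2 * (x ⬝ᵥ x) := by
          refine mul_le_mul_of_nonneg_left (Finset.sum_le_sum fun u _ => ?_) (sq_nonneg τ)
          dsimp only
          split_ifs
          · exact le_rfl
          · simpa using mul_self_nonneg _

theorem absSum_shift_le (h : IsTypical P A p q κ τ) (hd : 0 < p - q) (U : Finset (Fin n)) {t : ℝ}
    (ht0 : 0 ≤ t) (ht : t ≤ (p - q) * n) :
    (restrictedSignal (centredMatrix A p q) ((p - q) / 2) U -
      t • (1 : Matrix (Fin n) (Fin n) ℝ)).absSum ≤ n ^ 2 * ((p - q) + κ + (p - q) * n) := by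
  have : ∀ u w, |(restrictedSignal (centredMatrix A p q) ((p - q) / 2) U -
      t • (1 : Matrix (Fin n) (Fin n) ℝ)) u w| ≤ (p - q) + κ + (p - q) * n := by
    intro u w
    have hM := abs_centredMatrix_le h hd u w
    have hκ := kappa_nonneg h u
    rw [Matrix.sub_apply]
    refine (abs_sub _ _).trans (add_le_add ?_ ?_)
    · rw [restrictedSignal, of_apply]
      have h1 : |centredMatrix A p q u w + (p - q) / 2| ≤ (p - q) + κ := by
        refine (abs_add_le _ _).trans ?_
        rw [abs_of_pos (half_pos hd)]
        linarith
      split_ifs <;> simp <;> linarith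
    · rw [Matrix.smul_apply, one_apply]
      split_ifs
      · simpa [abs_of_nonneg ht0] using ht
      · simp; positivity
  refine (Finset.sum_le_sum fun u _ => Finset.sum_le_sum fun w _ => this u w).trans ?_
  simp only [Finset.sum_const, Finset.card_univ, Fintype.card_fin, nsmul_eq_mul]
  exact le_of_eq (by ring)

/-- The sum of the entries of the centred matrix over pairs from a set counts pairs in the same
cluster, up to noise. -/
theorem abs_sum_centredMatrix_sub_le (h : IsTypical P A p q κ τ) (hτ : 0 ≤ τ) (hRP : R ⊆ P.parts)
    {W : Finset (Fin n)} (hW : W ⊆ R.biUnion id) :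
    |(∑ a ∈ W, ∑ b ∈ W, centredMatrix A p q a b) -
      (p - q) / 2 * (2 * ∑ C ∈ R, ((W ∩ C).card : ℝ) ^ 2 - (W.card : ℝ) ^ 2)| ≤ τ * W.card := by
  classical
  have e : ∑ a ∈ W, ∑ b ∈ W, centredMatrix A p q a b =
      (p - q) / 2 * (2 * ∑ C ∈ R, ((W ∩ C).card : ℝ) ^ 2 - (W.card : ℝ) ^ 2) +
        ∑ a ∈ W, ∑ b ∈ W, noiseMatrix P A p q a b := by
    have h1 : ∑ a ∈ W, ∑ b ∈ W, (∑ C ∈ R, if a ∈ C ∧ b ∈ C then (1 : ℝ) else 0) =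
        ∑ C ∈ R, ((W ∩ C).card : ℝ) ^ 2 := by
      calc _ = ∑ a ∈ W, ∑ C ∈ R, ∑ b ∈ W, (if a ∈ C ∧ b ∈ C then (1 : ℝ) else 0) :=
            Finset.sum_congr rfl fun _ _ => Finset.sum_comm
        _ = ∑ C ∈ R, ∑ a ∈ W, ∑ b ∈ W, (if a ∈ C ∧ b ∈ C then (1 : ℝ) else 0) :=
            Finset.sum_comm
        _ = _ := by
          refine Finset.sum_congr rfl fun C _ => ?_
          simp [ite_and, Finset.sum_ite_mem, sq]
    rw [← h1, sq, ← smul_eq_mul (W.card : ℝ), Nat.cast_smul_eq_nsmul, ← Finset.sum_const]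
    have h2 : (W.card : ℝ) = ∑ b ∈ W, (1 : ℝ) := by simp
    rw [h2]
    simp only [Finset.mul_sum, ← Finset.sum_sub_distrib, ← Finset.sum_add_distrib]
    refine Finset.sum_congr rfl fun a ha => Finset.sum_congr rfl fun b hb => ?_
    rw [← Finset.mul_sum, sum_parts_ite_and hRP (hW ha), centredMatrix_eq (P := P)]
    split_ifs <;> ring
  rw [e, add_sub_cancel_left]
  set x : Fin n → ℝ := fun u => if u ∈ W then 1 else 0 with hx
  have hxx : x ⬝ᵥ x = W.card := by simp [hx, dotProduct]
  have hE : ∑ a ∈ W, ∑ b ∈ W, noiseMatrix P A p q a b = x ⬝ᵥ (noiseMatrix P A p q *ᵥ x) := by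
    simp [hx, dotProduct, mulVec]
  rw [hE]
  refine abs_le_of_sq_le_sq ?_ (by positivity)
  refine (dotProduct_sq_le _ _).trans ?_
  rw [hxx, mul_pow]
  have := mul_le_mul_of_nonneg_left (h.norm_le x) (Nat.cast_nonneg (α := ℝ) W.card)
  rw [hxx] at this
  linarith

end

/-! ### The candidates and the densest of them -/

section

open Matrix

variable {n : ℕ} {P : Finpartition (Finset.univ : Finset (Fin n))}
  {A : Matrix (Fin n) (Fin n) ℝ} {p q κ τ ε : ℝ} {R T : Finset (Finset (Fin n))} {m D : ℕ}

/-- If row `u` of `X` is close to the normalized indicator of the cluster `C`, then one of its level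
sets is close to `C`. -/
theorem exists_rowLevelSet_close (hRP : R ⊆ P.parts) (hTR : T ⊆ R) {X : Matrix (Fin n) (Fin n) ℝ}
    {C : Finset (Fin n)} (hC : C ∈ T) {u : Fin n} (hu : u ∈ C) {β : ℝ}
    (hX : ∑ w, (X u w - blockProj T u w) ^ 2 ≤ β / C.card) (hβ : 4 * β < 1) :
    ∃ v, ((rowLevelSet ((2 : ℝ) • X) (R.biUnion id) u v \ C).card : ℝ) +
      (C \ rowLevelSet ((2 : ℝ) • X) (R.biUnion id) u v).card ≤ 4 * β * C.card := by
  classical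
  set U := R.biUnion id with hU
  have hCU : C ⊆ U := Finset.subset_biUnion_of_mem id (hTR hC)
  have hc : (0 : ℝ) < C.card := by exact_mod_cast Finset.card_pos.2 ⟨u, hu⟩
  have hP : ∀ w, blockProj T u w = if w ∈ C then (C.card : ℝ)⁻¹ else 0 := by
    intro w
    have := sum_parts_ite (hTR.trans hRP) hC hu fun D => if w ∈ D then (D.card : ℝ)⁻¹ else 0
    simp only [← ite_and] at this
    exact this
  set L : Finset (Fin n) := {w ∈ U | (2 * (C.card : ℝ))⁻¹ ≤ X u w} with hL
  have hbad : ((L \ C).card : ℝ) + (C \ L).card ≤ 4 * β * C.card := by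
    have hdis : Disjoint (L \ C) (C \ L) := disjoint_sdiff_sdiff
    have h1 : (((L \ C) ∪ (C \ L)).card : ℝ) * (2 * (C.card : ℝ))⁻¹ ^ 2 ≤ β / C.card := by
      rw [← nsmul_eq_mul]
      refine le_trans (Finset.card_nsmul_le_sum _ _ _ fun w hw => ?_)
        ((Finset.sum_le_sum_of_subset_of_nonneg (Finset.subset_univ _)
          fun _ _ _ => sq_nonneg _).trans hX)
      rw [hP]
      rcases Finset.mem_union.1 hw with hw | hw
      · obtain ⟨hwL, hwC⟩ := Finset.mem_sdiff.1 hw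
        rw [if_neg hwC, sub_zero]
        exact pow_le_pow_left₀ (by positivity) (Finset.mem_filter.1 hwL).2 2
      · obtain ⟨hwC, hwL⟩ := Finset.mem_sdiff.1 hw
        have hlt : X u w < (2 * (C.card : ℝ))⁻¹ := by
          by_contra! hge
          exact hwL (Finset.mem_filter.2 ⟨hCU hwC, hge⟩)
        rw [if_pos hwC, ← neg_sq (X u w - _)]
        refine pow_le_pow_left₀ (by positivity) ?_ 2
        have : (C.card : ℝ)⁻¹ = 2 * (2 * (C.card : ℝ))⁻¹ := by field_simp
        linarith
    rw [Finset.card_union_of_disjoint hdis] at h1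
    push_cast at h1
    have e : (2 * (C.card : ℝ))⁻¹ ^ 2 = 1 / (4 * (C.card : ℝ) ^ 2) := by
      rw [inv_pow, mul_pow]; norm_num
    rw [e, mul_one_div, div_le_div_iff₀ (by positivity) hc] at h1
    refine le_of_mul_le_mul_right ?_ hc
    linarith
  have hne : L.Nonempty := by
    by_contra hempty
    rw [Finset.not_nonempty_iff_eq_empty] at hempty
    rw [hempty] at hbad
    simp only [Finset.empty_sdiff, Finset.card_empty, Nat.cast_zero, zero_add,
      Finset.sdiff_empty] at hbad
    nlinarith
  obtain ⟨v, hv, hmin⟩ := L.exists_min_image (fun w => X u w) hne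
  refine ⟨v, ?_⟩
  have : rowLevelSet ((2 : ℝ) • X) U u v = L := by
    ext w
    rw [mem_rowLevelSet, hL, Finset.mem_filter]
    simp only [Matrix.smul_apply, smul_eq_mul]
    refine and_congr_right fun hw => ⟨fun h => ?_, fun h => ?_⟩
    · exact (Finset.mem_filter.1 hv).2.trans (by linarith)
    · have := hmin w (Finset.mem_filter.2 ⟨hw, h⟩)
      linarith
  rw [this]
  exact hbad

/-- One of the candidates is close to a large cluster. -/
theorem exists_candidate_close (h : IsTypical P A p q κ τ)
    (hadm : AreAdmissible n (p - q) κ τ ε D) (hRP : R ⊆ P.parts) (hT : IsTopLevel R T m D ε)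
    {β : ℝ} (hβ : 2 * n * ((3 / 4) ^ n) ^ 2 + 6 * (τ ^ 2 / ((p - q) * D / 2) ^ 2) = β)
    (hβ1 : 4 * β < 1) :
    ∃ C ∈ T, ∃ j < n + n + 1, ∃ u v, ∀ L, L = rowLevelSet (spectralCut (centredMatrix A p q)
        ((p - q) / 2) (R.biUnion id) (j * ((p - q) / 2))) (R.biUnion id) u v →
      ((L \ C).card : ℝ) + (C \ L).card ≤ 4 * β * C.card := by
  classical
  have hd := hadm.signal_pos
  set d := p - q with hdef
  set U := R.biUnion id with hU
  set M := centredMatrix A p q with hM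
  set B := restrictedSignal M (d / 2) U with hB
  obtain ⟨C₀, hC₀⟩ := hT.nonempty
  have hmn : m ≤ n := (hT.le_card C₀ hC₀).trans (by simpa using Finset.card_le_univ C₀)
  have hDm := hT.le
  have hD1 := hT.one_le
  set j := 2 * m - D with hj
  set t : ℝ := j * (d / 2) with ht
  have hjc : (j : ℝ) = 2 * m - D := by rw [hj, Nat.cast_sub (by omega)]; push_cast; ring
  have hlc : ((m - D : ℕ) : ℝ) = m - D := by rw [Nat.cast_sub hDm]
  set g : ℝ := d * D / 2 with hg
  have hD0 : (0 : ℝ) < D := by exact_mod_cast hD1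
  have hg0 : 0 < g := by positivity
  have hblock := isBlockSignal_restrictedSignal h hd hRP hT
  have hl : t - d * (m - D : ℕ) = g := by rw [ht, hjc, hlc, hg]; ring
  have hm : d * m - t = g := by rw [ht, hjc, hg]; ring
  have hBsymm : B.IsSymm := by
    ext u w
    have hMs : M w u = M u w := by
      simp only [hM, centredMatrix, of_apply, h.isSymm.apply, eq_comm (a := w)]
    simp only [hB, transpose_apply, restrictedSignal, of_apply, hMs]
    ring
  obtain ⟨v, μ, hv, hv1, hpars⟩ := exists_eigenbasis hBsymm
  set Y := B - t • (1 : Matrix (Fin n) (Fin n) ℝ) with hY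
  have hYv : ∀ i, Y *ᵥ v i = (μ i - t) • v i := by
    intro i
    rw [hY, sub_mulVec, hv, smul_mulVec, one_mulVec, sub_smul]
  have hgap : ∀ i, g / 2 ≤ |μ i - t| := fun i =>
    hblock.abs_eigenvalue_sub_ge (hv i) (hv1 i) hg0 hl hm hadm.gap
  have hYsum : Y.absSum ≤ 2 * (g / 2) * (11 / 8) ^ n := by
    refine (absSum_shift_le h hd U (by positivity) ?_).trans ?_
    · rw [ht, hjc]
      have : (m : ℝ) ≤ n := by exact_mod_cast hmn
      nlinarith
    · refine hadm.scale.trans (le_of_eq ?_)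
      ring
  choose f hf hfe using fun i => approxSign_mulVec (hYv i) (hv1 i) (half_pos hg0) (hgap i) hYsum
  set X := (1 / 2 : ℝ) • (Y.approxSign + 1) with hX
  have hXv : ∀ i, X *ᵥ v i = ((f i + 1) / 2) • v i := by
    intro i
    rw [hX, smul_mulVec, add_mulVec, hf, one_mulVec]
    module
  have hXe : ∀ i, |(f i + 1) / 2 - if t < μ i then 1 else 0| ≤ (3 / 4) ^ n := by
    intro i
    have := hfe i
    simp only [sub_pos] at this
    have h34 : (0 : ℝ) ≤ (3 / 4) ^ n := by positivity
    rw [abs_le] at this ⊢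
    split_ifs at this ⊢ <;> constructor <;> linarith
  have hfrob := hblock.sum_sq_sub_blockProj_le hv hv1 hpars hg0 hl hm hadm.gap hXv hXe
  set err : Fin n → ℝ := fun u => ∑ w, (X u w - blockProj T u w) ^ 2 with herr
  have herr0 : ∀ u, 0 ≤ err u := fun u => Finset.sum_nonneg fun _ _ => sq_nonneg _
  have hT1 : (1 : ℝ) ≤ T.card := by exact_mod_cast Finset.card_pos.2 hT.nonempty
  have hdisj : (T : Set (Finset (Fin n))).PairwiseDisjoint id :=
    P.disjoint.subset (hT.subset.trans hRP)
  -- a cluster and an index in it with at most average error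
  obtain ⟨C, hC, hCerr⟩ : ∃ C ∈ T, ∑ u ∈ C, err u ≤ β := by
    refine Finset.exists_le_of_sum_le hT.nonempty ?_
    have e : ∑ C ∈ T, ∑ u ∈ C, err u = ∑ u ∈ T.biUnion id, err u :=
      (Finset.sum_biUnion (t := id) hdisj).symm
    rw [e, Finset.sum_const, nsmul_eq_mul, ← hβ]
    refine (Finset.sum_le_sum_of_subset_of_nonneg (Finset.subset_univ _)
      fun u _ _ => herr0 u).trans (hfrob.trans ?_)
    have : (0 : ℝ) ≤ 2 * n * ((3 / 4) ^ n) ^ 2 := by positivity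
    nlinarith
  have hCne : C.Nonempty := P.nonempty_of_mem_parts (hRP (hT.subset hC))
  have hc : (0 : ℝ) < C.card := by exact_mod_cast Finset.card_pos.2 hCne
  obtain ⟨u, hu, huerr⟩ : ∃ u ∈ C, err u ≤ β / C.card := by
    refine Finset.exists_le_of_sum_le hCne ?_
    rw [Finset.sum_const, nsmul_eq_mul, mul_div_cancel₀ _ hc.ne']
    exact hCerr
  obtain ⟨w, hw⟩ := exists_rowLevelSet_close hRP hT.subset hC hu huerr hβ1
  refine ⟨C, hC, j, by omega, u, w, fun L hL => ?_⟩
  have e : (2 : ℝ) • X = spectralCut M (d / 2) U (j * (d / 2)) := by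
    rw [hX, smul_smul, spectralCut]
    norm_num
    rfl
  rw [e, ← hL] at hw
  exact hw

/-- The density of a set that is close to a cluster is high. -/
theorem le_density (h : IsTypical P A p q κ τ) (hd : 0 < p - q) (hτ : 0 ≤ τ) (hRP : R ⊆ P.parts)
    {C L : Finset (Fin n)} (hC : C ∈ R) (hL : L ⊆ R.biUnion id) {a : ℝ} (ha0 : 0 ≤ a)
    (ha : 7 * a < 1) (hLC : ((L \ C).card : ℝ) + (C \ L).card ≤ a * C.card) :
    (p - q) / 2 * ((1 - 7 * a) * C.card) - τ ≤ density (centredMatrix A p q) L := by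
  have hc : (0 : ℝ) < C.card := by
    exact_mod_cast Finset.card_pos.2 (P.nonempty_of_mem_parts (hRP hC))
  have e1 : ((L \ C).card : ℝ) + (L ∩ C).card = L.card := by
    exact_mod_cast Finset.card_sdiff_add_card_inter L C
  have e2 : ((C \ L).card : ℝ) + (L ∩ C).card = C.card := by
    rw [Finset.inter_comm]
    exact_mod_cast Finset.card_sdiff_add_card_inter C L
  have p1 : (0 : ℝ) ≤ (L \ C).card := Nat.cast_nonneg _
  have p2 : (0 : ℝ) ≤ (C \ L).card := Nat.cast_nonneg _
  have hl : (0 : ℝ) < L.card := by nlinarith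
  have hsum := abs_le.1 (abs_sum_centredMatrix_sub_le h hτ hRP hL)
  have hsq : ((L ∩ C).card : ℝ) ^ 2 ≤ ∑ D ∈ R, ((L ∩ D).card : ℝ) ^ 2 :=
    Finset.single_le_sum (f := fun D => ((L ∩ D).card : ℝ) ^ 2) (fun _ _ => sq_nonneg _) hC
  rw [density, le_div_iff₀ hl]
  have key : (1 - 7 * a) * C.card * L.card ≤
      2 * ((L ∩ C).card : ℝ) ^ 2 - (L.card : ℝ) ^ 2 := by
    set x : ℝ := ((L ∩ C).card : ℝ)
    set l : ℝ := (L.card : ℝ)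
    set c : ℝ := (C.card : ℝ)
    have hx : (1 - a) * c ≤ x := by linarith
    have hlu : l ≤ (1 + a) * c := by linarith
    have hx2 : ((1 - a) * c) ^ 2 ≤ x ^ 2 := pow_le_pow_left₀ (by nlinarith) hx 2
    have h1 : (1 - 7 * a) * c * l + l ^ 2 ≤
        (1 - 7 * a) * c * ((1 + a) * c) + ((1 + a) * c) ^ 2 := by
      have h3 : 0 ≤ (1 - 7 * a) * c := mul_nonneg (by linarith) hc.le
      have h4 := mul_le_mul_of_nonneg_left hlu h3
      have h5 := pow_le_pow_left₀ hl.le hlu 2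
      linarith
    nlinarith [mul_nonneg ha0 (sq_nonneg c), mul_nonneg (mul_nonneg ha0 ha0) (sq_nonneg c)]
  have := mul_le_mul_of_nonneg_left key (half_pos hd).le
  have := mul_le_mul_of_nonneg_left hsq hd.le
  nlinarith

/-- A set of high density is mostly contained in one cluster. -/
theorem exists_density_le (h : IsTypical P A p q κ τ) (hd : 0 < p - q) (hτ : 0 ≤ τ)
    (hRP : R ⊆ P.parts) (hR : R.Nonempty) {W : Finset (Fin n)} (hW : W ⊆ R.biUnion id)
    (hWne : W.Nonempty) :
    ∃ C ∈ R, density (centredMatrix A p q) W ≤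
      (p - q) / 2 * (2 * (W ∩ C).card - W.card) + τ := by
  obtain ⟨C, hC, hmax⟩ := R.exists_max_image (fun C => (W ∩ C).card) hR
  refine ⟨C, hC, ?_⟩
  have hw : (0 : ℝ) < W.card := by exact_mod_cast Finset.card_pos.2 hWne
  rw [density, div_le_iff₀ hw]
  have hsum := abs_le.1 (abs_sum_centredMatrix_sub_le h hτ hRP hW)
  have htot : ∑ D ∈ R, ((W ∩ D).card : ℝ) ≤ W.card := by
    rw [← Nat.cast_sum, Nat.cast_le, ← Finset.card_biUnion]
    · exact Finset.card_le_card (Finset.biUnion_subset.2 fun D _ => Finset.inter_subset_left)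
    · intro D hD D' hD' hne
      exact (P.disjoint (hRP hD) (hRP hD') hne).mono Finset.inter_subset_right
        Finset.inter_subset_right
  have hsq : ∑ D ∈ R, ((W ∩ D).card : ℝ) ^ 2 ≤ (W ∩ C).card * W.card := by
    refine le_trans (Finset.sum_le_sum (g := fun D => ((W ∩ C).card : ℝ) * (W ∩ D).card)
      fun D hD => ?_) ?_
    · rw [sq]
      exact mul_le_mul_of_nonneg_right (by exact_mod_cast hmax D hD) (Nat.cast_nonneg _)
    · rw [← Finset.mul_sum]
      exact mul_le_mul_of_nonneg_left htot (Nat.cast_nonneg _)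
  have := mul_le_mul_of_nonneg_left hsq hd.le
  nlinarith

/-- The row sums over a densest candidate separate one cluster from all other unlabelled
indices. -/
theorem exists_cluster_of_isDensestCandidate (h : IsTypical P A p q κ τ)
    (hadm : AreAdmissible n (p - q) κ τ ε D) (hRP : R ⊆ P.parts) (hT : IsTopLevel R T m D ε)
    {W : Finset (Fin n)}
    (hW : IsDensestCandidate (centredMatrix A p q) ((p - q) / 2) (R.biUnion id) W) :
    ∃ C ∈ R, ∀ x ∈ R.biUnion id, 0 ≤ ∑ w ∈ W, centredMatrix A p q x w ↔ x ∈ C := by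
  have hd := hadm.signal_pos
  have hτ := hadm.tau_nonneg
  set d := p - q with hdef
  set M := centredMatrix A p q with hM
  set β := 2 * n * ((3 / 4) ^ n) ^ 2 + 6 * (τ ^ 2 / (d * D / 2) ^ 2) with hβ
  have hβ0 : 0 ≤ β := by positivity
  obtain ⟨C₀, hC₀⟩ := hT.nonempty
  obtain ⟨u₀, hu₀⟩ := P.nonempty_of_mem_parts (hRP (hT.subset hC₀))
  have hκ := kappa_nonneg h u₀
  set b := d / 2 + κ with hb
  have hb0 : 0 < b := by positivity
  set a := 4 * β with ha
  have ha0 : 0 ≤ a := by positivity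
  have hab : a * b ≤ d / 200 := hadm.column
  have ha1 : a ≤ 1 / 100 := by nlinarith
  have hτb : τ * b ≤ d ^ 2 * D / 100 := hadm.noise
  have hDm : (D : ℝ) ≤ m := by exact_mod_cast hT.le
  have hD1 : (1 : ℝ) ≤ D := by exact_mod_cast hT.one_le
  have hm0 : (0 : ℝ) < m := by linarith
  have hτd : τ ≤ d * m / 50 := by
    have h1 : τ * (d / 2) ≤ d ^ 2 * m / 100 := by nlinarith
    have h2 : d * τ ≤ d * (d * m / 50) := by linarith
    exact le_of_mul_le_mul_left h2 hd
  obtain ⟨C₁, hC₁, j, hj, u, v, hL⟩ := exists_candidate_close h hadm hRP hT hβ.symm (by linarith)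
  have hlow := le_density h hd hτ hRP (hT.subset hC₁) (Finset.filter_subset _ _) ha0
    (by linarith) (hL _ rfl)
  have hC₁m : (m : ℝ) ≤ C₁.card := by exact_mod_cast hT.le_card C₁ hC₁
  have hlow2 : d / 2 * ((1 - 7 * a) * m) - τ ≤ density M W := by
    refine le_trans ?_ (hlow.trans (hW.density_le j hj u v))
    have : (1 - 7 * a) * m ≤ (1 - 7 * a) * C₁.card :=
      mul_le_mul_of_nonneg_left hC₁m (by linarith)
    have := mul_le_mul_of_nonneg_left this (half_pos hd).le
    linarith
  have hdm : 0 < d * m := mul_pos hd hm0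
  have hWne : W.Nonempty := by
    by_contra hempty
    rw [Finset.not_nonempty_iff_eq_empty] at hempty
    rw [hempty] at hlow2
    simp only [density, Finset.card_empty, Nat.cast_zero, div_zero] at hlow2
    nlinarith
  obtain ⟨C, hC, hup⟩ := exists_density_le h hd hτ hRP ⟨C₀, hT.subset hC₀⟩ hW.subset hWne
  refine ⟨C, hC, fun x hx => ?_⟩
  have e1 : ((W \ C).card : ℝ) + (W ∩ C).card = W.card := by
    exact_mod_cast Finset.card_sdiff_add_card_inter W C
  have e2 : ((C \ W).card : ℝ) + (W ∩ C).card = C.card := by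
    rw [Finset.inter_comm]
    exact_mod_cast Finset.card_sdiff_add_card_inter C W
  have p1 : (0 : ℝ) ≤ (W \ C).card := Nat.cast_nonneg _
  have p2 : (0 : ℝ) ≤ (C \ W).card := Nat.cast_nonneg _
  set δ : ℝ := (W \ C).card + (C \ W).card with hδ
  have hbal : d * ((1 - 7 * a) * m) - 4 * τ ≤ d * (2 * (W ∩ C).card - W.card) := by linarith
  have hCm := hT.card_le C hC
  -- the symmetric difference of `W` and `C` is small
  have hδd : d * δ ≤ d * m * (ε + 7 * a) + 4 * τ := by
    have h1 : d * δ = d * C.card - d * (2 * (W ∩ C).card - W.card) := by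
      rw [hδ, ← e1, ← e2]; ring
    have h2 := mul_le_mul_of_nonneg_left hCm hd.le
    rw [h1]
    linarith
  have hδb : δ * b ≤ 7 / 50 * (d * m) := by
    have h1 := mul_le_mul_of_nonneg_right hδd hb0.le
    have h2 : d * m * (ε * b) ≤ d * m * (d / 16) :=
      mul_le_mul_of_nonneg_left hadm.tolerance hdm.le
    have h3 : d * m * (a * b) ≤ d * m * (d / 200) := mul_le_mul_of_nonneg_left hab hdm.le
    have h4 : d ^ 2 * D ≤ d ^ 2 * m := mul_le_mul_of_nonneg_left hDm (sq_nonneg d)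
    have h5 : 0 < d * (d * m) := mul_pos hd hdm
    have h6 : (d * m * (ε + 7 * a) + 4 * τ) * b =
        d * m * (ε * b) + 7 * (d * m * (a * b)) + 4 * (τ * b) := by ring
    refine le_of_mul_le_mul_left ?_ hd
    linarith
  have hCbig : 17 / 20 * (d * m) ≤ d * C.card := by
    have h1 : d * (2 * (W ∩ C).card - W.card) ≤ d * C.card :=
      mul_le_mul_of_nonneg_left (by linarith) hd.le
    have h2 : d * m * a ≤ d * m * (1 / 100) := mul_le_mul_of_nonneg_left ha1 hdm.le
    linarith
  have habs := abs_centredMatrix_le h hd x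
  -- passing from `W` to `C` changes the row sum by little
  have hdiff : |∑ w ∈ W, M x w - ∑ w ∈ C, M x w| ≤ δ * b := by
    have h1 : ∑ w ∈ W, M x w - ∑ w ∈ C, M x w =
        ∑ w ∈ W \ C, M x w - ∑ w ∈ C \ W, M x w :=
      Finset.sum_sdiff_sub_sum_sdiff.symm
    have h2 : ∀ S : Finset (Fin n), |∑ w ∈ S, M x w| ≤ S.card * b := by
      intro S
      refine (Finset.abs_sum_le_sum_abs _ _).trans ?_
      rw [← nsmul_eq_mul]
      exact Finset.sum_le_card_nsmul _ _ _ fun w _ => habs w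
    rw [h1, hδ, add_mul]
    exact (abs_sub _ _).trans (add_le_add (h2 _) (h2 _))
  have hrow := h.abs_sum_le x C (hRP hC)
  obtain ⟨C', hC', hx'⟩ := Finset.mem_biUnion.1 hx
  have hsame : ∀ w ∈ C, (SameCluster P x w ↔ x ∈ C) := by
    intro w hw
    rw [sameCluster_comm, sameCluster_iff_mem (hRP hC) hw]
  have hCsum : ∑ w ∈ C, M x w = d / 2 * (if x ∈ C then (C.card : ℝ) else -C.card) +
      ∑ w ∈ C, noiseMatrix P A p q x w := by
    classical
    rw [Finset.sum_congr rfl fun w _ => centredMatrix_eq (P := P) x w, Finset.sum_add_distrib,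
      ← Finset.mul_sum, Finset.sum_congr rfl fun w hw => if_congr (hsame w hw) rfl rfl, ← hdef]
    split_ifs <;> simp
  rw [hCsum] at hdiff
  obtain ⟨d1, d2⟩ := abs_le.1 hdiff
  obtain ⟨r1, r2⟩ := abs_le.1 hrow
  by_cases hxC : x ∈ C
  · simp only [hxC, if_true, iff_true] at d1 d2 ⊢
    linarith
  · simp only [hxC, if_false, iff_false, not_le] at d1 d2 ⊢
    linarith

end

/-! ### Recovery of all clusters -/

namespace IsSuperclustering

variable {n : ℕ} {P : Finpartition (Finset.univ : Finset (Fin n))} {K : ℕ}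
  {S : Fin K → Finset (Finset (Fin n))} {Δ ε : ℝ}

theorem card_add_le (h : IsSuperclustering P S Δ ε) (hΔ : 0 < Δ) {i j : Fin K} (hij : i < j)
    {C D : Finset (Fin n)} (hC : C ∈ S i) (hD : D ∈ S j) : (D.card : ℝ) + Δ ≤ C.card := by
  obtain ⟨j, hj⟩ := j
  induction j generalizing D with
  | zero => exact absurd hij (Nat.not_lt_zero _)
  | succ j ih =>
    rcases Nat.lt_succ_iff_lt_or_eq.1 (show (i : ℕ) < j + 1 from hij) with hlt | heq
    · obtain ⟨C', hC'⟩ := h.nonempty ⟨j, by omega⟩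
      have h1 := h.separated ⟨j, by omega⟩ ⟨j + 1, hj⟩ rfl C' hC' D hD
      have h2 := ih (by omega) hlt hC'
      linarith
    · exact h.separated i ⟨j + 1, hj⟩ (by simp [heq]) C hC D hD

theorem epsilon_nonneg (h : IsSuperclustering P S Δ ε) {C : Finset (Fin n)} (hC : C ∈ P.parts) :
    0 ≤ ε := by
  obtain ⟨i, hi⟩ := (h.cover C).1 hC
  have hc : (0 : ℝ) < C.card := by exact_mod_cast Finset.card_pos.2 (P.nonempty_of_mem_parts hC)
  nlinarith [h.within i C hi C hi]

/-- Among any clusters, those in the first supercluster that occurs are the large ones. -/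
theorem exists_isTopLevel (h : IsSuperclustering P S Δ ε) (hΔ : 0 < Δ)
    {R : Finset (Finset (Fin n))} (hRP : R ⊆ P.parts) (hR : R.Nonempty) :
    ∃ T m, IsTopLevel R T m ⌈Δ⌉₊ ε := by
  classical
  obtain ⟨C₀, hC₀⟩ := hR
  obtain ⟨i₀, hi₀⟩ := (h.cover C₀).1 (hRP hC₀)
  obtain ⟨i, hi, hmin⟩ := ({i | ∃ C ∈ S i, C ∈ R} : Finset (Fin K)).exists_min_image id
    ⟨i₀, by simpa using ⟨C₀, hi₀, hC₀⟩⟩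
  simp only [Finset.mem_filter, Finset.mem_univ, true_and, id] at hi hmin
  obtain ⟨C₁, hC₁i, hC₁⟩ := hi
  set T := {C ∈ R | C ∈ S i} with hT
  obtain ⟨B, hB, hBmin⟩ := T.exists_min_image Finset.card ⟨C₁, by simp [hT, hC₁, hC₁i]⟩
  have hB' := hB
  simp only [hT, Finset.mem_filter] at hB'
  have hε := h.epsilon_nonneg (hRP hC₀)
  have hother : ∀ C ∈ R, C ∉ T → C.card + ⌈Δ⌉₊ ≤ B.card := by
    intro C hC hCT
    obtain ⟨j, hj⟩ := (h.cover C).1 (hRP hC)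
    have hij : i ≤ j := hmin j ⟨C, hj, hC⟩
    have hne : i ≠ j := by
      rintro rfl
      exact hCT (Finset.mem_filter.2 ⟨hC, hj⟩)
    have := h.card_add_le hΔ (lt_of_le_of_ne hij hne) hB'.2 hj
    have hle : C.card ≤ B.card := by
      exact_mod_cast (by linarith : (C.card : ℝ) ≤ B.card)
    have : ⌈Δ⌉₊ ≤ B.card - C.card := by
      rw [Nat.ceil_le, Nat.cast_sub hle]
      linarith
    omega
  refine ⟨T, B.card, Finset.filter_subset _ _, ⟨B, hB⟩, hBmin, fun C hC => ?_, hother,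
    Nat.one_le_iff_ne_zero.2 (Nat.ceil_pos.2 hΔ).ne', Nat.ceil_le.2 (h.size_ge B (hRP hB'.1))⟩
  by_cases hCT : C ∈ T
  · exact h.within i C (Finset.mem_filter.1 hCT).2 B hB'.2
  · have h1 : (C.card : ℝ) ≤ B.card := by
      exact_mod_cast (Nat.le_add_right _ _).trans (hother C hC hCT)
    have h2 : (0 : ℝ) ≤ ε * B.card := by positivity
    linarith

end IsSuperclustering

/-- The recovery program recovers the clusters of a typical matrix. -/
theorem recovers_of_isTypical {n : ℕ} {P : Finpartition (Finset.univ : Finset (Fin n))}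
    {A : Matrix (Fin n) (Fin n) ℝ} {p q κ τ ε : ℝ} {D : ℕ} (h : IsTypical P A p q κ τ)
    (hadm : AreAdmissible n (p - q) κ τ ε D)
    (htop : ∀ R ⊆ P.parts, R.Nonempty → ∃ T m, IsTopLevel R T m D ε) {K : ℕ} (k : Fin K → ℕ) :
    RamProgram.recoveryProg.Recovers P p q k A := by
  classical
  -- the clusters in `R` are still to be found
  have key := RamProgram.recoveryProg_induction A p q k (fun r lab => ∃ R ⊆ P.parts,
    R.card ≤ n - r ∧ (∀ x, lab x = 0 ↔ x ∈ R.biUnion id) ∧ (∀ x, lab x ≤ r) ∧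
    ∀ x y, lab x ≠ 0 → lab y ≠ 0 → (lab x = lab y ↔ SameCluster P x y)) ?_ ?_
  · obtain ⟨R, -, hcard, hR, -, hlab⟩ := key
    obtain rfl : R = ∅ := Finset.card_eq_zero.1 (by omega)
    have hne : ∀ x, RamProgram.recoveryProg.label A p q k x ≠ 0 := fun x h0 => by
      have := (hR x).1 h0
      simp at this
    exact fun u v => hlab u v (hne u) (hne v)
  · refine ⟨P.parts, subset_rfl, ?_, fun x => ?_, by simp, by simp⟩
    · simpa using P.card_parts_le_card
    · have := P.biUnion_parts
      simp [this]
  · intro r hr lab W hW hI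
    obtain ⟨R, hRP, hcard, hR, hle, hlab⟩ := hI
    have hU : ({x | lab x = 0} : Finset (Fin n)) = R.biUnion id := by
      ext x
      simp only [Finset.mem_filter, Finset.mem_univ, true_and, hR]
    rw [hU] at hW
    rcases R.eq_empty_or_nonempty with rfl | hRne
    · have hne : ∀ x, lab x ≠ 0 := fun x h0 => by simpa using (hR x).1 h0
      refine ⟨∅, by simp, by simp, ?_, ?_, ?_⟩
      · intro x
        simp only [hne x, false_and, if_false]
        exact iff_of_false not_false (by simp)
      · intro x
        simp only [hne x, false_and, if_false]
        exact (hle x).trans (Nat.le_succ r)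
      · intro x y
        simp only [hne x, hne y, false_and, if_false]
        exact hlab x y
    obtain ⟨T, m, hT⟩ := htop R hRP hRne
    obtain ⟨C, hC, hsep⟩ := exists_cluster_of_isDensestCandidate h hadm hRP hT hW
    have hlab' : ∀ x, (if lab x = 0 ∧ 0 ≤ ∑ w ∈ W, centredMatrix A p q x w then r + 1 else lab x) =
        if x ∈ C then r + 1 else lab x := by
      intro x
      have : (lab x = 0 ∧ 0 ≤ ∑ w ∈ W, centredMatrix A p q x w) ↔ x ∈ C := by
        constructor
        · rintro ⟨h0, hs⟩
          exact (hsep x ((hR x).1 h0)).1 hs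
        · intro hx
          have hxU : x ∈ R.biUnion id := Finset.mem_biUnion.2 ⟨C, hC, hx⟩
          exact ⟨(hR x).2 hxU, (hsep x hxU).2 hx⟩
      simp only [this]
    simp only [hlab']
    have hCR : ∀ x, x ∈ (R.erase C).biUnion id ↔ x ∉ C ∧ x ∈ R.biUnion id := by
      intro x
      simp only [Finset.mem_biUnion, Finset.mem_erase, id]
      constructor
      · rintro ⟨C', ⟨hne, hC'⟩, hx⟩
        exact ⟨fun hxC => hne (P.eq_of_mem_parts (hRP hC') (hRP hC) hx hxC), C', hC', hx⟩
      · rintro ⟨hxC, C', hC', hx⟩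
        exact ⟨C', ⟨fun he => hxC (he ▸ hx), hC'⟩, hx⟩
    refine ⟨R.erase C, (Finset.erase_subset _ _).trans hRP, ?_, fun x => ?_, fun x => ?_,
      fun x y => ?_⟩
    · rw [Finset.card_erase_of_mem hC]; omega
    · rw [hCR]
      by_cases hx : x ∈ C
      · simp [hx]
      · simp only [hx, if_false, not_false_eq_true, true_and]
        exact hR x
    · split_ifs
      · exact le_rfl
      · exact (hle x).trans (Nat.le_succ r)
    · have hx := hle x
      have hy := hle y
      by_cases hxC : x ∈ C <;> by_cases hyC : y ∈ C
      · simp only [hxC, hyC, if_true, sameCluster_iff_mem (hRP hC) hxC]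
        simp
      · simp only [hxC, hyC, if_true, if_false, sameCluster_iff_mem (hRP hC) hxC, iff_false]
        intro _ _; omega
      · rw [sameCluster_comm, sameCluster_iff_mem (hRP hC) hyC]
        simp only [hxC, hyC, if_true, if_false, iff_false]
        intro _ _; omega
      · simp only [hxC, hyC, if_false]
        exact hlab x y

/-! ### Hoeffding's inequality and nets -/

/-- Hoeffding's inequality for weighted sums of the coordinates of a product measure. -/
theorem measureReal_pi_le_sum_mul_le {ι : Type*} [Fintype ι] {ν : ι → Measure ℝ}
    [∀ i, IsProbabilityMeasure (ν i)] {g : ι → ℝ → ℝ} (hg : ∀ i, Measurable (g i)) {κ : ℝ}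
    (hκ : 0 ≤ κ) (hb : ∀ i, ∀ᵐ x ∂ν i, |g i x| ≤ κ) (h0 : ∀ i, ∫ x, g i x ∂ν i = 0)
    (a : ι → ℝ) {V : ℝ} (hV : ∑ i, a i ^ 2 ≤ V) {r : ℝ} (hr : 0 ≤ r) :
    (Measure.pi ν).real {ω | r ≤ ∑ i, a i * g i (ω i)} ≤ Real.exp (-r ^ 2 / (2 * (κ ^ 2 * V))) := by
  have hV0 : 0 ≤ V := (Finset.sum_nonneg fun _ _ => sq_nonneg _).trans hV
  have hindep : iIndepFun (fun i (ω : ι → ℝ) => a i * g i (ω i)) (Measure.pi ν) :=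
    iIndepFun_pi (X := fun i x => a i * g i x) fun i => ((hg i).const_mul _).aemeasurable
  have hsub : ∀ i ∈ Finset.univ, HasSubgaussianMGF (fun ω : ι → ℝ => a i * g i (ω i))
      ((a i ^ 2).toNNReal * (‖κ - -κ‖₊ / 2) ^ 2) (Measure.pi ν) := by
    intro i _
    rw [Real.toNNReal_of_nonneg (sq_nonneg _)]
    refine HasSubgaussianMGF.const_mul ?_ (a i)
    refine hasSubgaussianMGF_of_mem_Icc_of_integral_eq_zero
      ((hg i).comp (measurable_pi_apply i)).aemeasurable ?_ ?_
    · have := (measurePreserving_eval ν i).quasiMeasurePreserving.ae (hb i)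
      filter_upwards [this] with ω hω
      exact abs_le.1 hω
    · rw [integral_comp_eval (hg i).aestronglyMeasurable, h0]
  have hsum := HasSubgaussianMGF.sum_of_iIndepFun hindep hsub
  have hc : ((∑ i, (a i ^ 2).toNNReal * (‖κ - -κ‖₊ / 2) ^ 2 : NNReal) : ℝ) ≤
      κ ^ 2 * V := by
    have e : (‖κ - -κ‖ / 2) ^ 2 = κ ^ 2 := by
      rw [Real.norm_eq_abs, sub_neg_eq_add, abs_of_nonneg (by linarith)]; ring
    push_cast
    simp only [Real.coe_toNNReal _ (sq_nonneg _), e]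
    rw [← Finset.sum_mul, mul_comm]
    exact mul_le_mul_of_nonneg_left hV (sq_nonneg κ)
  have hsum' : HasSubgaussianMGF (fun ω : ι → ℝ => ∑ i, a i * g i (ω i))
      (κ ^ 2 * V).toNNReal (Measure.pi ν) := by
    refine ⟨hsum.integrable_exp_mul, fun t => (hsum.mgf_le t).trans (Real.exp_le_exp.2 ?_)⟩
    have := mul_le_mul_of_nonneg_right hc (sq_nonneg t)
    rw [Real.coe_toNNReal _ (by positivity)]
    linarith
  have := hsum'.measure_ge_le hr
  rwa [Real.coe_toNNReal _ (by positivity)] at this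

/-- A maximal `1`-separated subset of the ball of radius `2` is a finite net. -/
theorem exists_finset_net (n : ℕ) : ∃ N : Finset (EuclideanSpace ℝ (Fin n)), N.card ≤ 5 ^ n ∧
    (∀ c ∈ N, ‖c‖ ≤ 2) ∧ ∀ y, ‖y‖ ≤ 2 → ∃ c ∈ N, ‖y - c‖ ≤ 1 := by
  classical
  set Sep : Finset (EuclideanSpace ℝ (Fin n)) → Prop := fun s =>
    (∀ c ∈ s, ‖c‖ ≤ 2) ∧ ∀ c ∈ s, ∀ d ∈ s, c ≠ d → 1 ≤ ‖c - d‖ with hSep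
  have hcard : ∀ s, Sep s → s.card ≤ 5 ^ n := fun s hs => by
    simpa using Besicovitch.card_le_of_separated s hs.1 hs.2
  set cards : Set ℕ := {k | ∃ s, Sep s ∧ s.card = k} with hcards
  have hbdd : BddAbove cards := ⟨5 ^ n, by rintro k ⟨s, hs, rfl⟩; exact hcard s hs⟩
  obtain ⟨N, hN, hNk⟩ : sSup cards ∈ cards :=
    Nat.sSup_mem ⟨0, ∅, ⟨by simp, by simp⟩, by simp⟩ hbdd
  refine ⟨N, hcard N hN, hN.1, fun y hy => ?_⟩
  by_contra! hfar
  have hyN : y ∉ N := fun h => by have := hfar y h; simp at this; linarith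
  have : Sep (insert y N) := by
    refine ⟨fun c hc => ?_, fun c hc d hd hcd => ?_⟩
    · rcases Finset.mem_insert.1 hc with rfl | hc
      exacts [hy, hN.1 c hc]
    · rcases Finset.mem_insert.1 hc with rfl | hc' <;>
        rcases Finset.mem_insert.1 hd with rfl | hd'
      · exact absurd rfl hcd
      · exact (hfar d hd').le
      · rw [norm_sub_rev]; exact (hfar c hc').le
      · exact hN.2 c hc' d hd' hcd
  have := le_csSup hbdd ⟨insert y N, this, rfl⟩
  rw [← hNk, Finset.card_insert_of_notMem hyN] at this
  omega

open Matrix in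
/-- The norm of a matrix is bounded by its bilinear form on a net. -/
theorem norm_le_of_net {n : ℕ} {N : Finset (EuclideanSpace ℝ (Fin n))}
    (hN : ∀ y, ‖y‖ ≤ 2 → ∃ c ∈ N, ‖y - c‖ ≤ 1) {E : Matrix (Fin n) (Fin n) ℝ} {r : ℝ}
    (hE : ∀ c ∈ N, ∀ d ∈ N, (⇑c) ⬝ᵥ (E *ᵥ ⇑d) ≤ r) (x : Fin n → ℝ) :
    (E *ᵥ x) ⬝ᵥ (E *ᵥ x) ≤ r ^ 2 * (x ⬝ᵥ x) := by
  set L := toEuclideanCLM (n := Fin n) (𝕜 := ℝ) E with hL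
  have hin : ∀ y z : EuclideanSpace ℝ (Fin n), inner ℝ y (L z) = (⇑y) ⬝ᵥ (E *ᵥ ⇑z) := fun y z =>
    inner_toEuclideanCLM E y z
  -- testing against the net on the left
  have h1 : ∀ d ∈ N, ‖L d‖ ≤ r := by
    intro d hd
    rcases eq_or_ne (L d) 0 with h0 | h0
    · obtain ⟨c, hc, -⟩ := hN 0 (by simp)
      have h2 := hE c hc d hd
      rw [← hin, h0, inner_zero_right] at h2
      rw [h0, norm_zero]
      exact h2
    · have hpos : 0 < ‖L d‖ := norm_pos_iff.2 h0
      set y := (2 / ‖L d‖) • L d with hy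
      obtain ⟨c, hc, hyc⟩ := hN y (by
        rw [hy, norm_smul, Real.norm_of_nonneg (by positivity), div_mul_cancel₀ _ hpos.ne'])
      have e1 : inner ℝ y (L d) = 2 * ‖L d‖ := by
        rw [hy, real_inner_smul_left, real_inner_self_eq_norm_sq]
        field_simp
      have e2 : inner ℝ (y - c) (L d) ≤ ‖L d‖ :=
        (real_inner_le_norm _ _).trans (mul_le_of_le_one_left hpos.le hyc)
      have e3 := hE c hc d hd
      rw [← hin] at e3
      rw [inner_sub_left] at e2
      linarith
  have hr : 0 ≤ r := by
    obtain ⟨c, hc, -⟩ := hN 0 (by simp)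
    exact (norm_nonneg _).trans (h1 c hc)
  -- testing against the net on the right
  have h2 : ∀ z, ‖z‖ ≤ 2 → ‖L z‖ ≤ r + ‖L‖ := by
    intro z hz
    obtain ⟨c, hc, hzc⟩ := hN z hz
    calc ‖L z‖ = ‖L c + L (z - c)‖ := by rw [← map_add]; congr 2; abel
      _ ≤ ‖L c‖ + ‖L (z - c)‖ := norm_add_le _ _
      _ ≤ r + ‖L‖ := add_le_add (h1 c hc)
        ((L.le_opNorm _).trans (mul_le_of_le_one_right (norm_nonneg _) hzc))
  have h3 : ‖L‖ ≤ (r + ‖L‖) / 2 := by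
    refine L.opNorm_le_bound (by positivity) fun z => ?_
    rcases eq_or_ne z 0 with rfl | hz
    · simp
    · have hpos : 0 < ‖z‖ := norm_pos_iff.2 hz
      have := h2 ((2 / ‖z‖) • z) (by
        rw [norm_smul, Real.norm_of_nonneg (by positivity), div_mul_cancel₀ _ hpos.ne'])
      rw [map_smul, norm_smul, Real.norm_of_nonneg (by positivity), div_mul_eq_mul_div,
        div_le_iff₀ hpos] at this
      linarith
  have h4 : ‖L‖ ≤ r := by linarith
  have h5 : ‖L (WithLp.toLp 2 x)‖ ≤ r * ‖WithLp.toLp 2 x‖ :=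
    (L.le_opNorm _).trans (mul_le_mul_of_nonneg_right h4 (norm_nonneg _))
  have h6 := pow_le_pow_left₀ (norm_nonneg _) h5 2
  rw [mul_pow, EuclideanSpace.real_norm_sq_eq, EuclideanSpace.real_norm_sq_eq] at h6
  simpa [dotProduct, sq, hL] using h6

/-! ### Concentration of the noise -/

section

open Matrix

variable {n : ℕ} {P : Finpartition (Finset.univ : Finset (Fin n))} {p q σ κ : ℝ}
  {D₁ D₂ D₃ : Measure ℝ}

/-- The noise at an unordered pair of indices, as a function of the entry `x` there. -/
noncomputable def noiseEntry (P : Finpartition (Finset.univ : Finset (Fin n))) (p q : ℝ)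
    (e : Sym2 (Fin n)) (x : ℝ) : ℝ :=
  open Classical in
  if e.IsDiag then 0 else x - if ∃ C ∈ P.parts, ∀ u ∈ e, u ∈ C then p else q

theorem noiseMatrix_symmMatrix (ω : Sym2 (Fin n) → ℝ) (u w : Fin n) :
    noiseMatrix P (symmMatrix ω) p q u w = noiseEntry P p q s(u, w) (ω s(u, w)) := by
  simp only [noiseMatrix, noiseEntry, symmMatrix, SameCluster, of_apply, Sym2.mk_isDiag_iff,
    Sym2.ball]
  congr

theorem measurable_noiseEntry (e : Sym2 (Fin n)) : Measurable (noiseEntry P p q e) := by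
  change Measurable fun x => noiseEntry P p q e x
  by_cases h : e.IsDiag
  · simp only [noiseEntry, h, if_true]
    exact measurable_const
  · simp only [noiseEntry, h, if_false]
    exact measurable_id.sub_const _

theorem isProbabilityMeasure_entryLaw (h₁ : IsEntryDistribution D₁ p σ κ)
    (h₂ : IsEntryDistribution D₂ q σ κ) (h₃ : IsEntryDistribution D₃ 0 σ κ) (e : Sym2 (Fin n)) :
    IsProbabilityMeasure (entryLaw P D₁ D₂ D₃ e) := by
  unfold entryLaw
  split_ifs
  exacts [h₃.isProbabilityMeasure, h₁.isProbabilityMeasure, h₂.isProbabilityMeasure]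

theorem IsEntryDistribution.integral_sub_mean {D : Measure ℝ} {m : ℝ}
    (h : IsEntryDistribution D m σ κ) : ∫ x, (x - m) ∂D = 0 := by
  have := h.isProbabilityMeasure
  rw [integral_sub h.integrable (integrable_const _), h.mean]
  simp

theorem integral_noiseEntry (h₁ : IsEntryDistribution D₁ p σ κ)
    (h₂ : IsEntryDistribution D₂ q σ κ) (e : Sym2 (Fin n)) :
    ∫ x, noiseEntry P p q e x ∂(entryLaw P D₁ D₂ D₃ e) = 0 := by
  unfold entryLaw noiseEntry
  split_ifs
  exacts [integral_zero _ _, h₁.integral_sub_mean, h₂.integral_sub_mean]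

theorem ae_abs_noiseEntry_le {κ' : ℝ} (hκ : κ ≤ κ') (h0 : 0 ≤ κ')
    (h₁ : IsEntryDistribution D₁ p σ κ) (h₂ : IsEntryDistribution D₂ q σ κ) (e : Sym2 (Fin n)) :
    ∀ᵐ x ∂(entryLaw P D₁ D₂ D₃ e), |noiseEntry P p q e x| ≤ κ' := by
  unfold entryLaw noiseEntry
  split_ifs
  · simpa using ae_of_all _ fun _ => h0
  · exact h₁.bounded.mono fun x hx => hx.trans hκ
  · exact h₂.bounded.mono fun x hx => hx.trans hκ

theorem card_filter_sym2_mk_le (e : Sym2 (Fin n)) :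
    (Finset.univ.filter fun z : Fin n × Fin n => s(z.1, z.2) = e).card ≤ 2 := by
  induction e using Sym2.ind with
  | _ a b =>
    refine (Finset.card_le_card (t := {(a, b), (b, a)}) ?_).trans Finset.card_le_two
    rintro ⟨u, w⟩ h
    simpa using h

/-- A bilinear form in the noise is a sum over the independent entries. -/
theorem dotProduct_noiseMatrix_mulVec (x y : Fin n → ℝ) (ω : Sym2 (Fin n) → ℝ) :
    x ⬝ᵥ (noiseMatrix P (symmMatrix ω) p q *ᵥ y) =
      ∑ e, (∑ z : Fin n × Fin n with s(z.1, z.2) = e, x z.1 * y z.2) *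
        noiseEntry P p q e (ω e) := by
  have h : x ⬝ᵥ (noiseMatrix P (symmMatrix ω) p q *ᵥ y) = ∑ z : Fin n × Fin n,
      x z.1 * y z.2 * noiseEntry P p q s(z.1, z.2) (ω s(z.1, z.2)) := by
    simp only [dotProduct, mulVec, Finset.mul_sum, Fintype.sum_prod_type, noiseMatrix_symmMatrix]
    exact Finset.sum_congr rfl fun _ _ => Finset.sum_congr rfl fun _ _ => by ring
  rw [h, ← Finset.sum_fiberwise Finset.univ fun z : Fin n × Fin n => s(z.1, z.2)]
  refine Finset.sum_congr rfl fun e _ => ?_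
  rw [Finset.sum_mul]
  refine Finset.sum_congr rfl fun z hz => ?_
  rw [(Finset.mem_filter.1 hz).2]

theorem sum_sq_sum_filter_le (x y : Fin n → ℝ) :
    ∑ e : Sym2 (Fin n), (∑ z : Fin n × Fin n with s(z.1, z.2) = e, x z.1 * y z.2) ^ 2 ≤
      2 * ((x ⬝ᵥ x) * (y ⬝ᵥ y)) := by
  have h : (x ⬝ᵥ x) * (y ⬝ᵥ y) = ∑ z : Fin n × Fin n, (x z.1 * y z.2) ^ 2 := by
    simp only [dotProduct, Finset.sum_mul_sum, Fintype.sum_prod_type]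
    exact Finset.sum_congr rfl fun _ _ => Finset.sum_congr rfl fun _ _ => by ring
  rw [h, ← Finset.sum_fiberwise Finset.univ fun z : Fin n × Fin n => s(z.1, z.2), Finset.mul_sum]
  refine Finset.sum_le_sum fun e _ => sq_sum_le_card_mul_sum_sq.trans ?_
  refine mul_le_mul_of_nonneg_right ?_ (Finset.sum_nonneg fun _ _ => sq_nonneg _)
  exact_mod_cast card_filter_sym2_mk_le e

theorem isProbabilityMeasure_plantedMatrix (h₁ : IsEntryDistribution D₁ p σ κ)
    (h₂ : IsEntryDistribution D₂ q σ κ) (h₃ : IsEntryDistribution D₃ 0 σ κ) :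
    IsProbabilityMeasure (plantedMatrix P D₁ D₂ D₃) := by
  have := isProbabilityMeasure_entryLaw (P := P) h₁ h₂ h₃
  exact Measure.isProbabilityMeasure_map measurable_symmMatrix.aemeasurable

theorem measurable_entry (u w : Fin n) : Measurable fun A : Matrix (Fin n) (Fin n) ℝ => A u w :=
  (measurable_pi_apply w).comp (measurable_pi_apply u)

theorem measurable_noiseMatrix (u w : Fin n) : Measurable fun A => noiseMatrix P A p q u w := by
  by_cases h : u = w
  · simp only [noiseMatrix, of_apply, h, if_true]
    exact measurable_const
  · simp only [noiseMatrix, of_apply, h, if_false]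
    exact (measurable_entry u w).sub_const _

/-- Bilinear forms in the noise are subgaussian. -/
theorem plantedMatrix_real_le_dotProduct_le {κ' : ℝ} (hκ : κ ≤ κ') (h0 : 0 ≤ κ')
    (h₁ : IsEntryDistribution D₁ p σ κ) (h₂ : IsEntryDistribution D₂ q σ κ)
    (h₃ : IsEntryDistribution D₃ 0 σ κ) {x y : Fin n → ℝ} {V r : ℝ}
    (hV : (x ⬝ᵥ x) * (y ⬝ᵥ y) ≤ V) (hr : 0 ≤ r) :
    (plantedMatrix P D₁ D₂ D₃).real {A | r ≤ x ⬝ᵥ (noiseMatrix P A p q *ᵥ y)} ≤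
      Real.exp (-r ^ 2 / (4 * (κ' ^ 2 * V))) := by
  have := isProbabilityMeasure_entryLaw (P := P) h₁ h₂ h₃
  have hmeas : Measurable fun A => x ⬝ᵥ (noiseMatrix P A p q *ᵥ y) := by
    simp only [dotProduct, mulVec]
    exact Finset.measurable_sum _ fun u _ => Measurable.const_mul (Finset.measurable_sum _ fun w _ =>
      (measurable_noiseMatrix u w).mul_const (y w)) (x u)
  rw [plantedMatrix, measureReal_def, Measure.map_apply measurable_symmMatrix
    (measurableSet_le measurable_const hmeas), ← measureReal_def]
  have := measureReal_pi_le_sum_mul_le (ν := entryLaw P D₁ D₂ D₃) (measurable_noiseEntry (P := P))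
    h0 (ae_abs_noiseEntry_le hκ h0 h₁ h₂) (integral_noiseEntry h₁ h₂)
    (fun e => ∑ z : Fin n × Fin n with s(z.1, z.2) = e, x z.1 * y z.2)
    (V := 2 * V) ((sum_sq_sum_filter_le x y).trans (by linarith)) hr
  simp only [Set.preimage_ofPred_eq, dotProduct_noiseMatrix_mulVec]
  refine this.trans (le_of_eq ?_)
  congr 2
  ring

theorem ae_isSymm_plantedMatrix :
    ∀ᵐ A ∂(plantedMatrix P D₁ D₂ D₃), A.IsSymm := by
  have hm : MeasurableSet {A : Matrix (Fin n) (Fin n) ℝ | A.IsSymm} := by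
    simp only [IsSymm.ext_iff, Set.ofPred_forall]
    exact MeasurableSet.iInter fun u => MeasurableSet.iInter fun w =>
      measurableSet_eq_fun (measurable_entry w u) (measurable_entry u w)
  rw [plantedMatrix, ae_map_iff measurable_symmMatrix.aemeasurable hm]
  refine ae_of_all _ fun ω => IsSymm.ext fun u w => ?_
  simp [symmMatrix, Sym2.eq_swap]

theorem ae_abs_noiseMatrix_le {κ' : ℝ} (hκ : κ ≤ κ') (h0 : 0 ≤ κ')
    (h₁ : IsEntryDistribution D₁ p σ κ) (h₂ : IsEntryDistribution D₂ q σ κ)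
    (h₃ : IsEntryDistribution D₃ 0 σ κ) :
    ∀ᵐ A ∂(plantedMatrix P D₁ D₂ D₃), ∀ u w, |noiseMatrix P A p q u w| ≤ κ' := by
  have := isProbabilityMeasure_entryLaw (P := P) h₁ h₂ h₃
  refine ae_all_iff.2 fun u => ae_all_iff.2 fun w => ?_
  rw [plantedMatrix, ae_map_iff measurable_symmMatrix.aemeasurable
    (measurableSet_le (measurable_noiseMatrix u w).abs measurable_const)]
  have := (Measure.quasiMeasurePreserving_eval (μ := entryLaw P D₁ D₂ D₃) s(u, w)).ae
    (ae_abs_noiseEntry_le (P := P) (D₃ := D₃) hκ h0 h₁ h₂ s(u, w))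
  filter_upwards [this] with ω hω
  rwa [noiseMatrix_symmMatrix]

/-- The random matrix is typical with high probability. The norm is controlled by a union bound over
a net of at most `5 ^ n` points, the row sums by one over all vertices and clusters. -/
theorem plantedMatrix_real_not_isTypical_le {κ' : ℝ} (hκ : κ ≤ κ') (h0 : 0 < κ') (hd : q < p)
    (h₁ : IsEntryDistribution D₁ p σ κ) (h₂ : IsEntryDistribution D₂ q σ κ)
    (h₃ : IsEntryDistribution D₃ 0 σ κ) {D : ℕ} (hD : ∀ C ∈ P.parts, D ≤ C.card) :
    (plantedMatrix P D₁ D₂ D₃).real {A | ¬ IsTypical P A p q κ' (20 * κ' * √n)} ≤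
      (1 / 2) ^ n + 2 * n ^ 2 * Real.exp (-((p - q) ^ 2 * D / (1024 * κ' ^ 2))) := by
  classical
  have := isProbabilityMeasure_plantedMatrix (P := P) h₁ h₂ h₃
  set ν := plantedMatrix P D₁ D₂ D₃ with hν
  obtain ⟨N, hcard, hN2, hN⟩ := exists_finset_net n
  set B₁ : Set (Matrix (Fin n) (Fin n) ℝ) := ⋃ z ∈ N ×ˢ N,
    {A | 20 * κ' * √n ≤ (⇑z.1) ⬝ᵥ (noiseMatrix P A p q *ᵥ ⇑z.2)} with hB₁
  set ind : Finset (Fin n) → Fin n → ℝ := fun C w => if w ∈ C then 1 else 0 with hind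
  set B₂ : ℝ → Set (Matrix (Fin n) (Fin n) ℝ) := fun s =>
    ⋃ z ∈ (Finset.univ : Finset (Fin n)) ×ˢ P.parts, {A | (p - q) / 16 * z.2.card ≤
      Pi.single z.1 s ⬝ᵥ (noiseMatrix P A p q *ᵥ ind z.2)} with hB₂
  have hsub : ∀ᵐ A ∂ν, A ∈ {A | ¬ IsTypical P A p q κ' (20 * κ' * √n)} →
      A ∈ B₁ ∪ (B₂ 1 ∪ B₂ (-1)) := by
    filter_upwards [ae_isSymm_plantedMatrix, ae_abs_noiseMatrix_le hκ h0.le h₁ h₂ h₃]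
      with A hA1 hA2 hA
    by_contra hcon
    refine hA ⟨hA1, norm_le_of_net hN fun c hc d hdN => ?_, hA2, fun u C hC => ?_⟩
    · by_contra! hlt
      exact hcon (Or.inl (Set.mem_biUnion (x := (c, d)) (by simp [hc, hdN]) hlt.le))
    · have e : ∀ s : ℝ, Pi.single u s ⬝ᵥ (noiseMatrix P A p q *ᵥ ind C) =
          s * ∑ w ∈ C, noiseMatrix P A p q u w := fun s => by
        rw [single_dotProduct]
        simp [mulVec, dotProduct, hind]
      rw [abs_le]
      constructor
      · by_contra! hlt
        refine hcon (Or.inr (Or.inr (Set.mem_biUnion (x := (u, C)) (by simp [hC]) ?_)))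
        simp only [Set.mem_ofPred_eq, e]
        linarith
      · by_contra! hlt
        refine hcon (Or.inr (Or.inl (Set.mem_biUnion (x := (u, C)) (by simp [hC]) ?_)))
        simp only [Set.mem_ofPred_eq, e]
        linarith
  have hb1 : ν.real B₁ ≤ (1 / 2) ^ n := by
    have hz : ∀ z ∈ N ×ˢ N, ν.real {A | 20 * κ' * √n ≤ (⇑z.1) ⬝ᵥ (noiseMatrix P A p q *ᵥ ⇑z.2)} ≤
        (1 / 50) ^ n := by
      intro z hz
      obtain ⟨hz1, hz2⟩ := Finset.mem_product.1 hz
      have hsq : ∀ c ∈ N, (⇑c) ⬝ᵥ (⇑c) ≤ 4 := fun c hc => by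
        have := pow_le_pow_left₀ (norm_nonneg _) (hN2 c hc) 2
        rw [EuclideanSpace.real_norm_sq_eq] at this
        simp only [dotProduct, ← sq]
        linarith
      have hV : ((⇑z.1) ⬝ᵥ (⇑z.1)) * ((⇑z.2) ⬝ᵥ (⇑z.2)) ≤ 16 :=
        (mul_le_mul (hsq _ hz1) (hsq _ hz2)
          (Finset.sum_nonneg fun _ _ => mul_self_nonneg _) (by norm_num)).trans (by norm_num)
      refine (plantedMatrix_real_le_dotProduct_le hκ h0.le h₁ h₂ h₃ hV (by positivity)).trans ?_
      have e : -(20 * κ' * √n) ^ 2 / (4 * (κ' ^ 2 * 16)) = n * (-(25 / 4)) := by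
        rw [mul_pow, Real.sq_sqrt (Nat.cast_nonneg _)]
        field_simp
        ring
      rw [e, Real.exp_nat_mul]
      refine pow_le_pow_left₀ (Real.exp_pos _).le ?_ n
      rw [Real.exp_neg, ← one_div]
      refine one_div_le_one_div_of_le (by norm_num) ?_
      calc (50 : ℝ) ≤ 2 ^ 6 := by norm_num
        _ ≤ Real.exp 1 ^ 6 := pow_le_pow_left₀ (by norm_num)
            (by linarith [Real.add_one_le_exp (1 : ℝ)]) 6
        _ = Real.exp 6 := by rw [← Real.exp_nat_mul]; norm_num
        _ ≤ Real.exp (25 / 4) := Real.exp_le_exp.2 (by norm_num)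
    calc ν.real B₁ ≤ ∑ z ∈ N ×ˢ N, _ := measureReal_biUnion_finset_le _ _
      _ ≤ ∑ z ∈ N ×ˢ N, (1 / 50 : ℝ) ^ n := Finset.sum_le_sum hz
      _ = (N.card : ℝ) * N.card * (1 / 50) ^ n := by
        rw [Finset.sum_const, Finset.card_product, nsmul_eq_mul, Nat.cast_mul]
      _ ≤ 5 ^ n * 5 ^ n * (1 / 50) ^ n := by
        have : (N.card : ℝ) ≤ 5 ^ n := by exact_mod_cast hcard
        gcongr
      _ = (1 / 2) ^ n := by rw [← mul_pow, ← mul_pow]; norm_num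
  have hb2 : ∀ s : ℝ, s * s = 1 → ν.real (B₂ s) ≤
      n ^ 2 * Real.exp (-((p - q) ^ 2 * D / (1024 * κ' ^ 2))) := by
    intro s hs
    have hz : ∀ z ∈ (Finset.univ : Finset (Fin n)) ×ˢ P.parts,
        ν.real {A | (p - q) / 16 * z.2.card ≤
          Pi.single z.1 s ⬝ᵥ (noiseMatrix P A p q *ᵥ ind z.2)} ≤
        Real.exp (-((p - q) ^ 2 * D / (1024 * κ' ^ 2))) := by
      intro z hz
      have hzC := (Finset.mem_product.1 hz).2
      have hpos : (0 : ℝ) < z.2.card := by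
        exact_mod_cast (P.nonempty_of_mem_parts hzC).card_pos
      have hV : ((Pi.single z.1 s : Fin n → ℝ) ⬝ᵥ Pi.single z.1 s) * (ind z.2 ⬝ᵥ ind z.2) ≤
          z.2.card := by
        rw [single_dotProduct]
        simp [hs, dotProduct, hind]
      refine (plantedMatrix_real_le_dotProduct_le hκ h0.le h₁ h₂ h₃ hV
        (by have := sub_pos.2 hd; positivity)).trans ?_
      refine Real.exp_le_exp.2 ?_
      have e : -((p - q) / 16 * z.2.card) ^ 2 / (4 * (κ' ^ 2 * z.2.card)) =
          -((p - q) ^ 2 * z.2.card / (1024 * κ' ^ 2)) := by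
        field_simp
        ring
      rw [e]
      have : (D : ℝ) ≤ z.2.card := by exact_mod_cast hD _ hzC
      gcongr
    calc ν.real (B₂ s) ≤ ∑ z ∈ (Finset.univ : Finset (Fin n)) ×ˢ P.parts, _ :=
          measureReal_biUnion_finset_le _ _
      _ ≤ ∑ z ∈ (Finset.univ : Finset (Fin n)) ×ˢ P.parts, _ := Finset.sum_le_sum hz
      _ = (n : ℝ) * P.parts.card * Real.exp (-((p - q) ^ 2 * D / (1024 * κ' ^ 2))) := by
        rw [Finset.sum_const, Finset.card_product, nsmul_eq_mul, Nat.cast_mul, Finset.card_univ,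
          Fintype.card_fin]
      _ ≤ n ^ 2 * Real.exp (-((p - q) ^ 2 * D / (1024 * κ' ^ 2))) := by
        have : (P.parts.card : ℝ) ≤ n := by
          have := P.card_parts_le_card
          rw [Finset.card_univ, Fintype.card_fin] at this
          exact_mod_cast this
        rw [sq (n : ℝ)]
        gcongr
  calc ν.real {A | ¬ IsTypical P A p q κ' (20 * κ' * √n)}
      ≤ ν.real (B₁ ∪ (B₂ 1 ∪ B₂ (-1))) :=
        ENNReal.toReal_mono (measure_ne_top _ _) (measure_mono_ae hsub)
    _ ≤ ν.real B₁ + (ν.real (B₂ 1) + ν.real (B₂ (-1))) :=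
        (measureReal_union_le _ _).trans (add_le_add le_rfl (measureReal_union_le _ _))
    _ ≤ _ := by linarith [hb1, hb2 1 (by norm_num), hb2 (-1) (by norm_num)]

end

/-! ### Large `n` -/

/-- The bound on the separation in terms of `√n` implies the admissibility of the parameters.
The constant `10 ^ 4` is dictated by the field `column`, which is quadratic in `τ / (d D / 2)`. -/
theorem areAdmissible_of_le {n D : ℕ} {d κ ε : ℝ} (hn : 1 ≤ n) (hd : 0 < d) (hκ : 0 < κ)
    (hD : 1 ≤ D) (hDn : D ≤ n) (h : 10 ^ 4 * (κ * (d / 2 + κ) * √n) ≤ d ^ 2 * D)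
    (htol : ε * (d / 2 + κ) ≤ d / 16) (h₁ : 6400 * (n : ℝ) ^ 2 * (9 / 16) ^ n ≤ 1)
    (h₂ : 6 * (n : ℝ) ^ 3 ≤ (11 / 8) ^ n) : AreAdmissible n d κ (20 * κ * √n) ε D := by
  have hn1 : (1 : ℝ) ≤ n := by exact_mod_cast hn
  have hD1 : (1 : ℝ) ≤ D := by exact_mod_cast hD
  have hDn' : (D : ℝ) ≤ n := by exact_mod_cast hDn
  have hs1 : 1 ≤ √(n : ℝ) := Real.one_le_sqrt.2 hn1
  set s := √(n : ℝ) with hs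
  have hdD : 0 < d * D := by positivity
  have hκs : 0 < κ * s := by positivity
  have hlin : 5000 * (κ * s) ≤ d * D := by
    refine le_of_mul_le_mul_right ?_ hd
    nlinarith [mul_pos hκs hκ]
  -- the entries are at most polynomially larger than the signal, so exponential factors absorb them
  have hκn : κ ≤ d * n := by
    refine (sq_le_sq₀ hκ.le (by positivity)).1 ?_
    calc κ ^ 2 = 1 * (κ * (0 + κ) * 1) := by ring
      _ ≤ 10 ^ 4 * (κ * (d / 2 + κ) * s) := by gcongr <;> linarith
      _ ≤ d ^ 2 * D := h
      _ ≤ d ^ 2 * n ^ 2 := by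
        gcongr
        exact hDn'.trans (le_self_pow₀ hn1 two_ne_zero)
      _ = (d * n) ^ 2 := by ring
  have hsum : d / 2 + κ ≤ 2 * d * n := by nlinarith
  refine ⟨hd, by positivity, ?_, ?_, ?_, htol, ?_⟩
  · have : 4 * (20 * κ * s) ≤ d * D / 2 := by linarith
    have := pow_le_pow_left₀ (by positivity) this 2
    linarith
  · have e1 : 2 * n * ((3 / 4 : ℝ) ^ n) ^ 2 * (d / 2 + κ) ≤ d / 1600 := by
      have : ((3 / 4 : ℝ) ^ n) ^ 2 = (9 / 16) ^ n := by
        rw [← pow_mul, mul_comm, pow_mul]; norm_num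
      rw [this]
      calc 2 * n * (9 / 16 : ℝ) ^ n * (d / 2 + κ) ≤ 2 * n * (9 / 16 : ℝ) ^ n * (2 * d * n) := by
            gcongr
        _ = 6400 * (n : ℝ) ^ 2 * (9 / 16) ^ n * (d / 1600) := by ring
        _ ≤ 1 * (d / 1600) := mul_le_mul_of_nonneg_right h₁ (by positivity)
        _ = d / 1600 := one_mul _
    have e2 : 6 * ((20 * κ * s) ^ 2 / (d * D / 2) ^ 2) * (d / 2 + κ) ≤ d / 1600 := by
      rw [mul_div_assoc', div_mul_eq_mul_div, div_le_iff₀ (by positivity)]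
      have h1 : 10 ^ 4 * (κ * (d / 2 + κ) * s) * (5000 * (κ * s)) ≤ d ^ 2 * D * (d * D) :=
        mul_le_mul h hlin (by positivity) (by positivity)
      have h2 : d / 1600 * (d * D / 2) ^ 2 = d ^ 2 * D * (d * D) / 6400 := by ring
      rw [h2]
      have h3 : 0 < κ * s * (κ * s) * (d / 2 + κ) := by positivity
      nlinarith
    linarith
  · nlinarith
  · calc (n : ℝ) ^ 2 * (d + κ + d * n) ≤ n ^ 2 * (d * n + d * n + d * n) := by
          gcongr; exact le_mul_of_one_le_right hd.le hn1
      _ = d / 2 * (6 * (n : ℝ) ^ 3) := by ring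
      _ ≤ d / 2 * (11 / 8) ^ n := by gcongr
      _ ≤ d * D / 2 * (11 / 8) ^ n := by
        gcongr
        exact le_mul_of_one_le_right hd.le hD1

theorem eventually_mul_pow_le :
    ∀ᶠ n : ℕ in atTop, 6400 * (n : ℝ) ^ 2 * (9 / 16) ^ n ≤ 1 ∧ 6 * (n : ℝ) ^ 3 ≤ (11 / 8) ^ n := by
  have h1 := (tendsto_pow_const_mul_const_pow_of_abs_lt_one 2
    (r := (9 / 16 : ℝ)) (by rw [abs_of_pos] <;> norm_num)).eventually_le_const
    (show (0 : ℝ) < 1 / 6400 by norm_num)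
  have h2 := (tendsto_pow_const_div_const_pow_of_one_lt 3
    (r := (11 / 8 : ℝ)) (by norm_num)).eventually_le_const (show (0 : ℝ) < 1 / 6 by norm_num)
  filter_upwards [h1, h2] with n h1 h2
  rw [div_le_iff₀ (by positivity)] at h2
  constructor <;> linarith

theorem tendsto_failure_bound :
    Tendsto (fun n : ℕ => (1 / 2 : ℝ) ^ n + 2 * n ^ 2 * Real.exp (-√n)) atTop (𝓝 0) := by
  have h1 : Tendsto (fun n : ℕ => (1 / 2 : ℝ) ^ n) atTop (𝓝 0) :=
    tendsto_pow_atTop_nhds_zero_of_lt_one (by norm_num) (by norm_num)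
  have h2 := ((Real.tendsto_pow_mul_exp_neg_atTop_nhds_zero 4).comp
    (Real.tendsto_sqrt_atTop.comp tendsto_natCast_atTop_atTop)).const_mul 2
  have := h1.add h2
  rw [mul_zero, add_zero] at this
  refine this.congr fun n => ?_
  have e : √(n : ℝ) ^ 4 = n ^ 2 := by
    rw [show 4 = 2 * 2 from rfl, pow_mul, Real.sq_sqrt (Nat.cast_nonneg n)]
  simp only [Function.comp, e, mul_assoc]

/-- The failure probability for one large `n`. A degenerate `κ` is replaced by `(p - q) / n`, so that
all quotients by it are meaningful; for this choice the separation condition holds automatically once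
`√n ≥ 2 * 10 ^ 4`. -/
theorem plantedMatrix_not_recovers_le {n : ℕ} {P : Finpartition (Finset.univ : Finset (Fin n))}
    {K : ℕ} {S : Fin K → Finset (Finset (Fin n))} {p q σ κ Δ ε : ℝ} {D₁ D₂ D₃ : Measure ℝ}
    (hd : q < p) (hΔ : 0 < Δ) (hS : IsSuperclustering P S Δ ε)
    (h₁ : IsEntryDistribution D₁ p σ κ) (h₂ : IsEntryDistribution D₂ q σ κ)
    (h₃ : IsEntryDistribution D₃ 0 σ κ)
    (hε : ε < (p - q) / (34 * max |p| |q| + 32 * κ + 2))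
    (hΔκ : 10 ^ 4 * (κ * (max |p| |q| + κ) * √n / (p - q) ^ 2) ≤ Δ)
    (hn : 4 * 10 ^ 8 ≤ n)
    (e₁ : 6400 * (n : ℝ) ^ 2 * (9 / 16) ^ n ≤ 1) (e₂ : 6 * (n : ℝ) ^ 3 ≤ (11 / 8) ^ n)
    (k : Fin K → ℕ) :
    plantedMatrix P D₁ D₂ D₃ {M | ¬ RamProgram.recoveryProg.Recovers P p q k M} ≤
      ENNReal.ofReal ((1 / 2) ^ n + 2 * n ^ 2 * Real.exp (-√n)) := by
  have := isProbabilityMeasure_plantedMatrix (P := P) h₁ h₂ h₃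
  set d := p - q with hdef
  set μ := max |p| |q| with hμ
  have hd0 : 0 < d := sub_pos.2 hd
  have hdμ : d / 2 ≤ μ := by
    have h1 : |p| ≤ μ := le_max_left _ _
    have h2 : |q| ≤ μ := le_max_right _ _
    linarith [le_abs_self p, neg_abs_le q]
  have hκ0 : 0 ≤ κ := by
    have := h₁.isProbabilityMeasure
    obtain ⟨x, hx⟩ := h₁.bounded.exists
    exact (abs_nonneg _).trans hx
  have hnpos : (4 * 10 ^ 8 : ℝ) ≤ n := by exact_mod_cast hn
  have hn0 : (0 : ℝ) < n := by linarith
  have hs : 2 * 10 ^ 4 ≤ √(n : ℝ) := Real.le_sqrt_of_sq_le (by linarith)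
  have hs2 : √(n : ℝ) * √n = n := Real.mul_self_sqrt hn0.le
  set κ' := max κ (d / n) with hκ'
  have hκ'0 : 0 < κ' := lt_max_of_lt_right (by positivity)
  set D := ⌈Δ⌉₊ with hD
  have hD1 : 1 ≤ D := Nat.one_le_iff_ne_zero.2 (Nat.ceil_pos.2 hΔ).ne'
  have hDC : ∀ C ∈ P.parts, D ≤ C.card := fun C hC => Nat.ceil_le.2 (hS.size_ge C hC)
  have hDn : D ≤ n := by
    have : NeZero n := ⟨by omega⟩
    have hne : P.parts.Nonempty := P.parts_nonempty (Finset.univ_nonempty.ne_empty)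
    obtain ⟨C, hC⟩ := hne
    exact (hDC C hC).trans (by simpa using Finset.card_le_univ C)
  have hdn : d / n ≤ d / 2 := div_le_div_of_nonneg_left hd0.le two_pos (by linarith)
  -- the separation condition for the modified bound on the entries
  have hstar : 10 ^ 4 * (κ' * (d / 2 + κ') * √n) ≤ d ^ 2 * D := by
    rcases le_total (d / n) κ with hle | hle
    · rw [hκ', max_eq_left hle]
      rw [mul_div_assoc', div_le_iff₀ (by positivity)] at hΔκ
      calc 10 ^ 4 * (κ * (d / 2 + κ) * √n) ≤ 10 ^ 4 * (κ * (μ + κ) * √n) := by gcongr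
        _ ≤ Δ * d ^ 2 := hΔκ
        _ ≤ D * d ^ 2 := by gcongr; exact Nat.le_ceil Δ
        _ = d ^ 2 * D := mul_comm _ _
    · rw [hκ', max_eq_right hle]
      have hD1' : (1 : ℝ) ≤ D := by exact_mod_cast hD1
      calc 10 ^ 4 * (d / n * (d / 2 + d / n) * √n) ≤ 10 ^ 4 * (d / n * (d / 2 + d / 2) * √n) := by
            gcongr
        _ = d ^ 2 * (10 ^ 4 * √n) / n := by ring
        _ ≤ d ^ 2 * n / n := by
          gcongr
          nlinarith
        _ = d ^ 2 * 1 := by field_simp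
        _ ≤ d ^ 2 * D := by gcongr
  have htol : ε * (d / 2 + κ') ≤ d / 16 := by
    have hden : 0 < 34 * μ + 32 * κ + 2 := by linarith
    have hle : d / 2 + κ' ≤ (34 * μ + 32 * κ + 2) / 16 := by
      rcases max_cases κ (d / n) with ⟨h, -⟩ | ⟨h, -⟩ <;> rw [hκ', h] <;> linarith
    rw [lt_div_iff₀ hden] at hε
    rcases le_total ε 0 with h0 | h0
    · have : ε * (d / 2 + κ') ≤ 0 := mul_nonpos_of_nonpos_of_nonneg h0 (by positivity)
      linarith
    · have := mul_le_mul_of_nonneg_left hle h0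
      linarith
  have hadm := areAdmissible_of_le (ε := ε) (by omega) hd0 hκ'0 hD1 hDn hstar htol e₁ e₂
  have hsub : {M | ¬ RamProgram.recoveryProg.Recovers P p q k M} ⊆
      {M | ¬ IsTypical P M p q κ' (20 * κ' * √n)} := fun M hM hM' =>
    hM (recovers_of_isTypical hM' hadm (fun R hRP hR => hS.exists_isTopLevel hΔ hRP hR) k)
  refine (measure_mono hsub).trans ?_
  rw [← ofReal_measureReal]
  refine ENNReal.ofReal_le_ofReal ((plantedMatrix_real_not_isTypical_le (le_max_left κ (d / n))
    hκ'0 hd h₁ h₂ h₃ hDC).trans ?_)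
  gcongr
  -- the exponent `d² D / (1024 κ'²)` exceeds `√n` because `10 ^ 4 κ'² √n ≤ d² D`
  rw [le_div_iff₀ (by positivity)]
  have h3 : 0 < κ' * d * √n := by positivity
  have h4 : 0 < κ' ^ 2 * √n := by positivity
  nlinarith

theorem mainTheorem2 :
    ∃ (c : ℝ) (prog : RamProgram) (T : Polynomial ℕ), 0 < c ∧
      -- the running time is polynomial in `n`, on every input
      (∀ (n : ℕ) (M : Matrix (Fin n) (Fin n) ℝ) (p q : ℝ) (K : ℕ) (k : Fin K → ℕ),
        (∀ i, 1 ≤ k i) → ∑ i, k i ≤ n →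
          prog.time (RamProgram.input M p q k) ≤ T.eval n) ∧
      -- the partition is recovered with probability tending to one
      ∀ (P : ∀ n : ℕ, Finpartition (Finset.univ : Finset (Fin n)))
        (K : ℕ → ℕ) (S : ∀ n : ℕ, Fin (K n) → Finset (Finset (Fin n)))
        (p q σ κ Δ ε : ℕ → ℝ) (D₁ D₂ D₃ : ℕ → Measure ℝ),
        (∀ n, q n < p n) →
        (∀ n, 0 < Δ n) →
        (∀ n, IsSuperclustering (P n) (S n) (Δ n) (ε n)) →
        (∀ n, IsEntryDistribution (D₁ n) (p n) (σ n) (κ n)) →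
        (∀ n, IsEntryDistribution (D₂ n) (q n) (σ n) (κ n)) →
        (∀ n, IsEntryDistribution (D₃ n) 0 (σ n) (κ n)) →
        (∀ᶠ n in atTop, ε n < (p n - q n) / (34 * max |p n| |q n| + 32 * κ n + 2)) →
        (∀ᶠ n : ℕ in atTop,
          c * (κ n * (max |p n| |q n| + κ n) * √(n : ℝ) / (p n - q n) ^ 2) ≤ Δ n) →
        (fun n : ℕ => (max |p n| |q n| + κ n) ^ 2 * κ n ^ 2 * Real.log n / (p n - q n) ^ 2)
          =o[atTop] Δ →
        Tendsto (fun n => plantedMatrix (P n) (D₁ n) (D₂ n) (D₃ n)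
            {M | ¬ prog.Recovers (P n) (p n) (q n) (fun i => (S n i).card) M})
          atTop (𝓝 0) := by
  refine ⟨10 ^ 4, RamProgram.recoveryProg, RamProgram.recoveryProg.timePoly, by norm_num,
    fun n M p q K k _ _ => ?_, ?_⟩
  · have := RamProgram.time_le_timePoly RamProgram.hasSizeLoops_recoveryProg
      RamProgram.not_writesInt_recoveryProg (RamProgram.input M p q k)
    simpa [RamProgram.input] using this
  · intro P K S p q σ κ Δ ε D₁ D₂ D₃ hpq hΔ hS h₁ h₂ h₃ hε hΔκ _
    have hlim := ENNReal.tendsto_ofReal tendsto_failure_bound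
    rw [ENNReal.ofReal_zero] at hlim
    refine tendsto_of_tendsto_of_tendsto_of_le_of_le' tendsto_const_nhds hlim
      (Eventually.of_forall fun _ => zero_le) ?_
    filter_upwards [hε, hΔκ, eventually_mul_pow_le, eventually_ge_atTop (4 * 10 ^ 8)]
      with n hε hΔκ e hn
    exact plantedMatrix_not_recovers_le (hpq n) (hΔ n) (hS n) (h₁ n) (h₂ n) (h₃ n) hε hΔκ hn e.1 e.2 _
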